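/- Let $\mathcal{N}\subset\mathcal{B}(H)$ be a von Neumann algebra with a faithful normal tracial state $\tau$, and let $\mathcal{N}_0\subset\mathcal{N}_1\subset\mathcal{N}_2\subset\cdots$ be an increasing sequence of von Neumann subalgebras of $\mathcal{N}$ (with the same unit). Let $f\in L_1(\mathcal{N},\tau)_+$, that is, $f$ is a (possibly unbounded) positive self-adjoint operator affiliated with $\mathcal{N}$ with $\tau(f)=\sup_k\tau\big(f\,\mathbf{1}_{[0,k]}(f)\big)<\infty$. Let $f_n=\mathbf{E}_n(f)\in L_1(\mathcal{N}_n,\tau)_+$ be its conditional expectation onto $\mathcal{N}_n$, the unique element with $\tau(f_n x)=\tau(f x)$ for all $0\le x\in\mathcal{N}_n$. For $\lambda>0$ let Cuculescu's projections be given by \[ q_0(\lambda)=\mathbf{1},\qquad q_{n}(\lambda)=q_{n-1}(\lambda)\,\mathbf{1}_{[0,\lambda]}\big(q_{n-1}(\lambda)\,f_n\,q_{n-1}(\lambda)\big)\quad(n\ge 1),\qquad q(\lambda)=\bigwedge_{n\ge 0}q_n(\lambda), \] where $q_{n-1}(\lambda)f_nq_{n-1}(\lambda)$ is the product of measurable operators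 (the closure of the algebraic product). Then $\mathbf{1}-q(\lambda)\in\mathcal{N}$ and \[ \tau\big(\mathbf{1}-q(\lambda)\big)\;\le\;\frac{2}{\lambda}\,\tau\Big(f\,\mathbf{1}_{(\frac{\lambda}{2},\infty)}(f)\Big). \] -/

import Mathlib

open scoped ENNReal ComplexOrder

noncomputable section

namespace NCMart

variable {H : Type*} [NormedAddCommGroup H] [InnerProductSpace ℂ H] [CompleteSpace H]

/-- The weak-* (ultraweak) topology of `B(H)`: the coarsest topology for which all functionals
`x ↦ ∑ i, ⟪ξ i, x (η i)⟫`, with `ξ`, `η` square-summable sequences of vectors, are continuous. -/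
@[reducible] def ultraweakTopology (H : Type*) [NormedAddCommGroup H] [InnerProductSpace ℂ H]
    [CompleteSpace H] : TopologicalSpace (H →L[ℂ] H) :=
  ⨅ (ξ : lp (fun _ : ℕ => H) 2) (η : lp (fun _ : ℕ => H) 2),
    TopologicalSpace.induced (fun x : H →L[ℂ] H => ∑' i, inner ℂ (ξ i) (x (η i))) inferInstance

/-- A faithful normal tracial state on the von Neumann algebra `N`. -/
structure TracialState (N : VonNeumannAlgebra H) where
  toLinearMap : N.toStarSubalgebra →ₗ[ℂ] ℂ
  map_one' : toLinearMap 1 = 1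
  nonneg' : ∀ x, 0 ≤ toLinearMap (star x * x)
  faithful' : ∀ x, toLinearMap (star x * x) = 0 → x = 0
  tracial' : ∀ x y, toLinearMap (x * y) = toLinearMap (y * x)
  normal' : @Continuous _ _ (TopologicalSpace.induced Subtype.val (ultraweakTopology H))
    inferInstance toLinearMap

open Classical in
/-- `Re τ(a)` for an operator `a` that belongs to `N` (and `0` for `a ∉ N`). -/
def TracialState.re {N : VonNeumannAlgebra H} (τ : TracialState N) (a : H →L[ℂ] H) : ℝ :=
  if h : a ∈ N.toStarSubalgebra then (τ.toLinearMap ⟨a, h⟩).re else 0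

/-- The orthogonal projection onto (the closure of) a subspace. -/
def proj (K : Submodule ℂ H) : H →L[ℂ] H := K.topologicalClosure.starProjection

/-- `R` is the bounded inverse `(1 + T)⁻¹` of `1 + T`. There is at most one such `R`. -/
def IsResolvent (T : H →ₗ.[ℂ] H) (R : H →L[ℂ] H) : Prop :=
  (∀ y : H, ∃ hy : R y ∈ T.domain, R y + T ⟨R y, hy⟩ = y) ∧
    ∀ x : T.domain, R ((x : H) + T x) = x

open Classical in
/-- The bounded operator `(1 + T)⁻¹`; it exists for every positive self-adjoint `T`. -/
def resolvent (T : H →ₗ.[ℂ] H) : H →L[ℂ] H :=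
  if h : ∃ R, IsResolvent T R then h.choose else 0

/-- The spectral projection `1_{[0,s]}(T)` of a positive self-adjoint operator `T`, for `s ≥ 0`.
With `R = (1 + T)⁻¹` it is `1_{[c,1]}(R)`, where `c = 1 / (1 + s)`, that is, the
projection onto the kernel of the operator `(c - R)₊` given by the continuous functional
calculus of the bounded self-adjoint operator `R`. -/
def spectralLE (T : H →ₗ.[ℂ] H) (s : ℝ) : H →L[ℂ] H :=
  proj (LinearMap.ker (cfc (fun r : ℝ => max ((1 + s)⁻¹ - r) 0) (resolvent T)).toLinearMap)

/-- The spectral projection `1_{(s,∞)}(T)` of a positive self-adjoint operator `T`, `s ≥ 0`. -/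
def spectralGT (T : H →ₗ.[ℂ] H) (s : ℝ) : H →L[ℂ] H := 1 - spectralLE T s

open Classical in
/-- The bounded operator `T 1_{[0,s]}(T)`, for `T` positive and self-adjoint. -/
def truncation (T : H →ₗ.[ℂ] H) (s : ℝ) : H →L[ℂ] H :=
  if h : ∃ a : H →L[ℂ] H, ∀ x, ∃ hx : spectralLE T s x ∈ T.domain,
    a x = T ⟨spectralLE T s x, hx⟩ then h.choose else 0

/-- The trace `τ(T x) ∈ [0,∞]` for a positive self-adjoint operator `T` affiliated with `N` and
`0 ≤ x ∈ N`: the supremum (increasing limit) of `τ(T 1_{[0,k]}(T) x)` over `k = 0, 1, 2, …`. -/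
def TracialState.traceMul {N : VonNeumannAlgebra H} (τ : TracialState N) (T : H →ₗ.[ℂ] H)
    (x : H →L[ℂ] H) : ℝ≥0∞ :=
  ⨆ k : ℕ, ENNReal.ofReal (τ.re (truncation T k * x))

/-- `T` is affiliated with `M`: it commutes with all elements of the commutant of `M`. -/
def Affiliated (M : VonNeumannAlgebra H) (T : H →ₗ.[ℂ] H) : Prop :=
  ∀ u ∈ M.commutant, ∀ x : T.domain, ∃ hx : u x ∈ T.domain, T ⟨u x, hx⟩ = u (T x)

/-- `f ∈ L₁(M, τ)₊`, for a von Neumann subalgebra `M` of `N`: `f` is a (possibly unbounded)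
positive self-adjoint operator affiliated with `M`, with `τ(f) < ∞`. -/
structure TracialState.MemL1Pos {N : VonNeumannAlgebra H} (τ : TracialState N)
    (M : VonNeumannAlgebra H) (f : H →ₗ.[ℂ] H) : Prop where
  isSelfAdjoint : IsSelfAdjoint f
  nonneg : ∀ x : f.domain, 0 ≤ (inner ℂ (f x) (x : H)).re
  affiliated : Affiliated M f
  trace_lt_top : τ.traceMul f 1 < ∞

/-- `g` is the conditional expectation of `f ∈ L₁(N, τ)₊` onto `M ≤ N`: it is the element of
`L₁(M, τ)₊` with `τ(g x) = τ(f x)` for all `x ∈ M₊`. -/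
def TracialState.IsCondExp {N : VonNeumannAlgebra H} (τ : TracialState N)
    (M : VonNeumannAlgebra H) (f g : H →ₗ.[ℂ] H) : Prop :=
  τ.MemL1Pos M g ∧ ∀ x ∈ M, 0 ≤ x → τ.traceMul g x = τ.traceMul f x

open Classical in
/-- The conditional expectation of `f ∈ L₁(N, τ)₊` onto `M ≤ N`; it exists and is unique. -/
def TracialState.condExp {N : VonNeumannAlgebra H} (τ : TracialState N)
    (M : VonNeumannAlgebra H) (f : H →ₗ.[ℂ] H) : H →ₗ.[ℂ] H :=
  if h : ∃ g, τ.IsCondExp M f g then h.choose else 0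

/-- The algebraic product `q f q`, on its natural domain `{x | q x ∈ dom f}`. -/
def algCompress (q : H →L[ℂ] H) (f : H →ₗ.[ℂ] H) : H →ₗ.[ℂ] H where
  domain := f.domain.comap q.toLinearMap
  toFun := q.toLinearMap ∘ₗ f.toFun ∘ₗ
    (q.toLinearMap.restrict (p := f.domain.comap q.toLinearMap) (q := f.domain) fun _ hx => hx)

/-- The product `q f q` of measurable operators: the closure of the algebraic product. -/
def compress (q : H →L[ℂ] H) (f : H →ₗ.[ℂ] H) : H →ₗ.[ℂ] H := (algCompress q f).closure

/-- Cuculescu's projections of a sequence `(f n)` of positive operators at height `s`: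
`q 0 = 1` and `q (n+1) = q n * 1_{[0,s]}(q n * f (n+1) * q n)`. -/
def cuculescuSeq (f : ℕ → H →ₗ.[ℂ] H) (s : ℝ) : ℕ → H →L[ℂ] H
  | 0 => 1
  | n + 1 => cuculescuSeq f s n * spectralLE (compress (cuculescuSeq f s n) (f (n + 1))) s

/-- Cuculescu's projection `q(s) = ⋀ n, q n`, the projection onto the intersection of the ranges
of Cuculescu's projections for the martingale `f n` of conditional expectations of `f`. -/
def TracialState.cuculescu {N : VonNeumannAlgebra H} (τ : TracialState N)
    (F : ℕ → VonNeumannAlgebra H) (f : H →ₗ.[ℂ] H) (s : ℝ) : H →L[ℂ] H :=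
  proj (⨅ n, LinearMap.range (cuculescuSeq (fun n => τ.condExp (F n) f) s n).toLinearMap)

end NCMart

end

noncomputable section

namespace NCMart

open Filter Topology

variable {H : Type*} [NormedAddCommGroup H] [InnerProductSpace ℂ H] [CompleteSpace H]

/-! Write λ for the height `s`, and put p_k = q_{k-1} (1 - e_k) with e_k = 1_{[0,λ]}(q_{k-1} f_k
q_{k-1}). The p_k are projections in N_k, and 1 - q_n = p_1 + … + p_n. On the range of p_k the
compression of f_k exceeds λ, so λ τ(p_k) ≤ τ(f_k p_k) = τ(f p_k), and summation gives λ τ(1 - q_n)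
≤ τ(f (1 - q_n)). Cutting f at height λ/2 bounds the right side by (λ/2) τ(1 - q_n) + τ(f
1_{(λ/2,∞)}(f)). The first term is finite and half as large as the left side, whence the constant
2/λ; normality of the trace allows n → ∞. This is `cuculescu_main`, which rests on `cuculescu_step`,
`traceMul_le` and `tendsto_proj_iInf`.

Unbounded operators T are handled through the positive contraction R = (1 + T)⁻¹: spectral
projections and truncations of T are bounded functions of R. The closure of the algebraic product q
g q has such a resolvent because the trace is finite: the domain of q g q and the range of 1 + q g q
have closures whose projections lie in N with trace arbitrarily near 1, hence equal to 1
(`isEssentiallyPos_algCompress`).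

That the conditional expectation exists is a Radon–Nikodym theorem for the functional φ = τ(f ·)
restricted to M (`exists_density`). If g is the density, then (1 + g)⁻¹ should minimise τ((1 - x)²)
+ φ(x²). A minimiser R over 0 ≤ x ≤ 2 exists by a Chebyshev and completeness argument. Its Euler
equation, tested on commutators, shows that R lies in the centralizer of φ; the equation then reads
φ(R z) = τ((1 - R) z), so that g = R⁻¹ - 1. -/

/-! ### Membership in a von Neumann algebra, and projections onto subspaces. -/

theorem mem_of_forall_commute {M : VonNeumannAlgebra H} {a : H →L[ℂ] H}
    (h : ∀ u ∈ M.commutant, Commute u a) : a ∈ M := by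
  rw [← M.commutant_commutant, VonNeumannAlgebra.mem_commutant_iff]
  exact fun u hu => h u hu

theorem commute_of_mem_commutant {M : VonNeumannAlgebra H} {a u : H →L[ℂ] H} (ha : a ∈ M)
    (hu : u ∈ M.commutant) : Commute u a :=
  (VonNeumannAlgebra.mem_commutant_iff.mp hu a ha).symm

theorem smul_mem {M : VonNeumannAlgebra H} {a : H →L[ℂ] H} (ha : a ∈ M) (r : ℝ) : r • a ∈ M :=
  mem_of_forall_commute fun _ hu => (commute_of_mem_commutant ha hu).smul_right r

/-- Whatever commutes with `a` commutes with its functional calculus. Where the calculus is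
undefined its value is 0, which also lies in `M`. -/
theorem cfc_mem {M : VonNeumannAlgebra H} {a : H →L[ℂ] H} (ha : a ∈ M) (φ : ℝ → ℝ) :
    cfc φ a ∈ M :=
  mem_of_forall_commute fun _ hu => ((commute_of_mem_commutant ha hu).symm.cfc_real φ).symm

theorem isStarProjection_proj (K : Submodule ℂ H) : IsStarProjection (proj K) :=
  isStarProjection_starProjection

theorem proj_apply_of_mem {K : Submodule ℂ H} {x : H} (hx : x ∈ K) : proj K x = x :=
  Submodule.starProjection_eq_self_iff.mpr (K.le_topologicalClosure hx)

theorem proj_apply_mem (K : Submodule ℂ H) (x : H) : proj K x ∈ K.topologicalClosure :=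
  Submodule.starProjection_apply_mem _ x

theorem mul_eq_of_proj_le {K : Submodule ℂ H} {a : H →L[ℂ] H} (h : ∀ x ∈ K, a x = x) :
    a * proj K = proj K := by
  ext x
  have hcl : IsClosed {y : H | a y = y} := isClosed_eq a.continuous continuous_id
  have hx : proj K x ∈ closure (K : Set H) := by
    simpa [← Submodule.topologicalClosure_coe] using proj_apply_mem K x
  exact closure_minimal (fun y hy => h y hy) hcl hx

theorem mul_proj_eq_zero {K : Submodule ℂ H} {a : H →L[ℂ] H} (h : ∀ x ∈ K, a x = 0) :
    a * proj K = 0 := by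
  ext x
  have hcl : IsClosed {y : H | a y = 0} := isClosed_eq a.continuous continuous_const
  have hx : proj K x ∈ closure (K : Set H) := by
    simpa [← Submodule.topologicalClosure_coe] using proj_apply_mem K x
  exact closure_minimal (fun y hy => h y hy) hcl hx

theorem mul_proj_ker (a : H →L[ℂ] H) : a * proj (LinearMap.ker a.toLinearMap) = 0 :=
  mul_proj_eq_zero fun _ hx => hx

theorem proj_mono {K L : Submodule ℂ H} (h : K ≤ L) : proj K ≤ proj L :=
  Submodule.starProjection_le_starProjection_iff.mpr (Submodule.topologicalClosure_mono h)

theorem mul_eq_mul_mul {K : Submodule ℂ H} {u : H →L[ℂ] H} (h : ∀ x ∈ K, u x ∈ K) :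
    proj K * (u * proj K) = u * proj K := by
  have := mul_proj_eq_zero (K := K) (a := proj K * u - u) (fun x hx => by
    simp [proj_apply_of_mem (h x hx)])
  rwa [sub_mul, sub_eq_zero, mul_assoc] at this

theorem commute_proj {K : Submodule ℂ H} {u : H →L[ℂ] H} (h : ∀ x ∈ K, u x ∈ K)
    (h' : ∀ x ∈ K, star u x ∈ K) : Commute u (proj K) := by
  have h1 := mul_eq_mul_mul h
  have h2 := congrArg star (mul_eq_mul_mul h')
  simp only [star_mul, star_star, (isStarProjection_proj K).isSelfAdjoint.star_eq, mul_assoc] at h2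
  exact h1.symm.trans h2

/-- The commutant is closed under adjoints, so invariance of `K` already makes `K` reducing. -/
theorem proj_mem {M : VonNeumannAlgebra H} {K : Submodule ℂ H}
    (h : ∀ u ∈ M.commutant, ∀ x ∈ K, u x ∈ K) : proj K ∈ M :=
  mem_of_forall_commute fun u hu => commute_proj (h u hu) (h (star u) (star_mem hu))

/-- A star projection is the projection onto its range. -/
theorem proj_range {p : H →L[ℂ] H} (hp : IsStarProjection p) :
    proj (LinearMap.range p.toLinearMap) = p := by
  have h1 : p * proj (LinearMap.range p.toLinearMap) = proj (LinearMap.range p.toLinearMap) := by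
    refine mul_eq_of_proj_le ?_
    rintro _ ⟨y, rfl⟩
    exact congrArg (fun a : H →L[ℂ] H => a y) hp.isIdempotentElem.eq
  have h2 : proj (LinearMap.range p.toLinearMap) * p = p := by
    ext x
    exact proj_apply_of_mem ⟨x, rfl⟩
  have h3 := congrArg star h1
  rw [star_mul, (isStarProjection_proj _).isSelfAdjoint.star_eq, hp.isSelfAdjoint.star_eq, h2] at h3
  exact h3.symm

/-! ### The trace: positivity, monotonicity, normality. -/

section Trace

variable {N : VonNeumannAlgebra H} (τ : TracialState N)

theorem TracialState.re_of_mem {a : H →L[ℂ] H} (ha : a ∈ N) :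
    τ.re a = (τ.toLinearMap ⟨a, ha⟩).re := dif_pos ha

theorem TracialState.re_one : τ.re 1 = 1 := by
  rw [τ.re_of_mem (one_mem N)]
  exact congrArg Complex.re τ.map_one'

theorem TracialState.re_add {a b : H →L[ℂ] H} (ha : a ∈ N) (hb : b ∈ N) :
    τ.re (a + b) = τ.re a + τ.re b := by
  rw [τ.re_of_mem ha, τ.re_of_mem hb, τ.re_of_mem (add_mem ha hb), ← Complex.add_re, ← map_add]
  rfl

theorem TracialState.re_smul {a : H →L[ℂ] H} (ha : a ∈ N) (r : ℝ) :
    τ.re (r • a) = r * τ.re a := by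
  have : (⟨r • a, smul_mem ha r⟩ : N.toStarSubalgebra) = (r : ℂ) • ⟨a, ha⟩ := by
    ext; simp
  rw [τ.re_of_mem ha, τ.re_of_mem (smul_mem ha r), this, map_smul, smul_eq_mul,
    Complex.re_ofReal_mul]

theorem TracialState.re_sub {a b : H →L[ℂ] H} (ha : a ∈ N) (hb : b ∈ N) :
    τ.re (a - b) = τ.re a - τ.re b := by
  rw [τ.re_of_mem ha, τ.re_of_mem hb, τ.re_of_mem (sub_mem ha hb), ← Complex.sub_re, ← map_sub]
  rfl

theorem TracialState.re_mul_comm {a b : H →L[ℂ] H} (ha : a ∈ N) (hb : b ∈ N) :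
    τ.re (a * b) = τ.re (b * a) := by
  rw [τ.re_of_mem (mul_mem ha hb), τ.re_of_mem (mul_mem hb ha)]
  exact congrArg Complex.re (τ.tracial' ⟨a, ha⟩ ⟨b, hb⟩)

/-- Positivity and faithfulness of the trace are given only on elements `star x * x`; a square root
inside `N` carries them over to all positive operators. -/
theorem exists_mem_eq_star_mul_self {a : H →L[ℂ] H} (ha : a ∈ N) (h : 0 ≤ a) :
    ∃ b ∈ N, 0 ≤ b ∧ a = b * b := by
  refine ⟨cfc Real.sqrt a, cfc_mem ha _, cfc_nonneg fun x _ => Real.sqrt_nonneg x, ?_⟩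
  rw [← cfc_mul Real.sqrt Real.sqrt a]
  conv_lhs => rw [← cfc_id ℝ a]
  exact cfc_congr fun x hx => (Real.mul_self_sqrt (spectrum_nonneg_of_nonneg h hx)).symm

theorem TracialState.re_nonneg {a : H →L[ℂ] H} (ha : a ∈ N) (h : 0 ≤ a) : 0 ≤ τ.re a := by
  obtain ⟨b, hb, hb0, rfl⟩ := exists_mem_eq_star_mul_self ha h
  have := τ.nonneg' ⟨b, hb⟩
  rw [τ.re_of_mem ha]
  have e : star (⟨b, hb⟩ : N.toStarSubalgebra) * ⟨b, hb⟩ = ⟨b * b, ha⟩ := by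
    ext1; exact congrArg (· * b) (IsSelfAdjoint.of_nonneg hb0).star_eq
  rw [e] at this
  exact (Complex.le_def.mp this).1

theorem TracialState.eq_zero_of_re_eq_zero {a : H →L[ℂ] H} (ha : a ∈ N) (h : 0 ≤ a)
    (h0 : τ.re a = 0) : a = 0 := by
  obtain ⟨b, hb, hb0, rfl⟩ := exists_mem_eq_star_mul_self ha h
  have := τ.nonneg' ⟨b, hb⟩
  rw [τ.re_of_mem ha] at h0
  have e : star (⟨b, hb⟩ : N.toStarSubalgebra) * ⟨b, hb⟩ = ⟨b * b, ha⟩ := by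
    ext1; exact congrArg (· * b) (IsSelfAdjoint.of_nonneg hb0).star_eq
  have hz : (⟨b, hb⟩ : N.toStarSubalgebra) = 0 := by
    refine τ.faithful' _ ?_
    rw [e] at this ⊢
    exact Complex.ext h0 (Complex.le_def.mp this).2.symm
  have hb' : b = 0 := congrArg Subtype.val hz
  simp [hb']

theorem TracialState.re_mono {a b : H →L[ℂ] H} (ha : a ∈ N) (hb : b ∈ N) (h : a ≤ b) :
    τ.re a ≤ τ.re b := by
  have := τ.re_nonneg (sub_mem hb ha) (sub_nonneg.mpr h)
  rwa [τ.re_sub hb ha, sub_nonneg] at this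

/-- With `c = √b`, traciality gives τ(ab) = τ(cac). -/
theorem TracialState.re_mul_nonneg {a b : H →L[ℂ] H} (ha : a ∈ N) (hb : b ∈ N) (h : 0 ≤ a)
    (h' : 0 ≤ b) : 0 ≤ τ.re (a * b) := by
  obtain ⟨c, hc, hc0, rfl⟩ := exists_mem_eq_star_mul_self hb h'
  rw [← mul_assoc, τ.re_mul_comm (mul_mem ha hc) hc, ← mul_assoc]
  exact τ.re_nonneg (mul_mem (mul_mem hc ha) hc) (conjugate_nonneg_of_nonneg h hc0)

theorem TracialState.re_mul_mono_left {a b c : H →L[ℂ] H} (ha : a ∈ N) (hb : b ∈ N) (hc : c ∈ N)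
    (h : a ≤ b) (h' : 0 ≤ c) : τ.re (a * c) ≤ τ.re (b * c) := by
  have := τ.re_mul_nonneg (sub_mem hb ha) hc (sub_nonneg.mpr h) h'
  rwa [sub_mul, τ.re_sub (mul_mem hb hc) (mul_mem ha hc), sub_nonneg] at this

theorem TracialState.re_mul_mono_right {a b c : H →L[ℂ] H} (ha : a ∈ N) (hb : b ∈ N) (hc : c ∈ N)
    (h : a ≤ b) (h' : 0 ≤ c) : τ.re (c * a) ≤ τ.re (c * b) := by
  rw [τ.re_mul_comm hc ha, τ.re_mul_comm hc hb]
  exact τ.re_mul_mono_left ha hb hc h h'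

/-- A normal trace is sequentially continuous for bounded strongly convergent sequences. -/
theorem TracialState.tendsto_re {a : ℕ → H →L[ℂ] H} {b : H →L[ℂ] H} (ha : ∀ n, a n ∈ N)
    (hb : b ∈ N) (C : ℝ) (hC : ∀ n, ‖a n‖ ≤ C) (h : ∀ x, Tendsto (fun n => a n x) atTop (𝓝 (b x))) :
    Tendsto (fun n => τ.re (a n)) atTop (𝓝 (τ.re b)) := by
  have key : Tendsto (fun n => τ.toLinearMap ⟨a n, ha n⟩) atTop (𝓝 (τ.toLinearMap ⟨b, hb⟩)) := by
    let : TopologicalSpace N.toStarSubalgebra :=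
      TopologicalSpace.induced Subtype.val (ultraweakTopology H)
    have hcont : Continuous τ.toLinearMap := τ.normal'
    refine (hcont.tendsto _).comp ?_
    let := ultraweakTopology H
    rw [nhds_induced, tendsto_comap_iff]
    simp only [nhds_iInf, nhds_induced, tendsto_iInf, tendsto_comap_iff]
    intro ξ η
    -- Ultraweak convergence is tested on one pair ξ, η of square-summable sequences; Cauchy–Schwarz
    -- makes the dominating series summable.
    refine tendsto_tsum_of_dominated_convergence (bound := fun i => C * (‖ξ i‖ * ‖η i‖)) ?_ ?_ ?_
    · refine Summable.mul_left _ ?_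
      have h1 : Summable fun i => ‖ξ i‖ ^ (2 : ℝ) := by
        simpa using (lp.memℓp ξ).summable (by simp)
      have h2 : Summable fun i => ‖η i‖ ^ (2 : ℝ) := by
        simpa using (lp.memℓp η).summable (by simp)
      exact Real.summable_mul_of_Lp_Lq_of_nonneg Real.HolderConjugate.two_two
        (fun i => norm_nonneg _) (fun i => norm_nonneg _) h1 h2
    · exact fun i => (tendsto_const_nhds).inner (h (η i))
    · refine Eventually.of_forall fun n i => ?_
      calc ‖inner ℂ (ξ i) (a n (η i))‖ ≤ ‖ξ i‖ * ‖a n (η i)‖ := norm_inner_le_norm _ _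
        _ ≤ ‖ξ i‖ * (C * ‖η i‖) := by
          gcongr
          exact ((a n).le_opNorm _).trans (by gcongr; exact hC n)
        _ = C * (‖ξ i‖ * ‖η i‖) := by ring
  have := (Complex.continuous_re.tendsto _).comp key
  rw [τ.re_of_mem hb]
  exact this.congr fun n => (τ.re_of_mem (ha n)).symm

end Trace

/-! ### Range projections as strong limits. -/

omit [CompleteSpace H] in
theorem tendsto_zero_of_mem_closure {c : ℕ → H →L[ℂ] H} {C : ℝ} (hC : ∀ n, ‖c n‖ ≤ C)
    {K : Set H} (h : ∀ y ∈ K, Tendsto (fun n => c n y) atTop (𝓝 0)) {x : H} (hx : x ∈ closure K) :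
    Tendsto (fun n => c n x) atTop (𝓝 0) := by
  have hC0 : 0 ≤ C := (norm_nonneg _).trans (hC 0)
  rw [Metric.tendsto_atTop]
  intro ε hε
  obtain ⟨y, hy, hxy⟩ := Metric.mem_closure_iff.mp hx (ε / 2 / (C + 1)) (by positivity)
  obtain ⟨n₀, hn₀⟩ := Metric.tendsto_atTop.mp (h y hy) (ε / 2) (by positivity)
  refine ⟨n₀, fun n hn => ?_⟩
  have h1 := hn₀ n hn
  rw [dist_zero_right] at h1 ⊢
  rw [dist_eq_norm] at hxy
  have h2 : ‖c n (x - y)‖ ≤ (C + 1) * ‖x - y‖ :=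
    ((c n).le_opNorm _).trans (by gcongr; linarith [hC n])
  have h3 : (C + 1) * ‖x - y‖ < ε / 2 := by
    rwa [lt_div_iff₀ (by positivity), mul_comm] at hxy
  calc ‖c n x‖ = ‖c n (x - y) + c n y‖ := by rw [← map_add, sub_add_cancel]
    _ ≤ ‖c n (x - y)‖ + ‖c n y‖ := norm_add_le _ _
    _ < ε := by linarith

section Regularized

variable (a : H →L[ℂ] H) (ε : ℝ)

/-- The operator `(a a* + ε)⁻¹`. -/
def regInv : H →L[ℂ] H := cfc (fun r : ℝ => (r + ε)⁻¹) (a * star a)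

variable {a ε}

theorem regInv_nonneg (hε : 0 < ε) : 0 ≤ regInv a ε := by
  refine cfc_nonneg fun r hr => ?_
  have := spectrum_nonneg_of_nonneg (mul_star_self_nonneg a) hr
  positivity

theorem mul_regInv (hε : 0 < ε) : a * star a * regInv a ε + ε • regInv a ε = 1 := by
  have hsp : ∀ r ∈ spectrum ℝ (a * star a), r + ε ≠ 0 := fun r hr => by
    have := spectrum_nonneg_of_nonneg (mul_star_self_nonneg a) hr
    positivity
  have hc : ContinuousOn (fun r : ℝ => (r + ε)⁻¹) (spectrum ℝ (a * star a)) :=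
    ContinuousOn.inv₀ (by fun_prop) hsp
  have hsa : IsSelfAdjoint (a * star a) := IsSelfAdjoint.mul_star_self a
  have h1 : a * star a * regInv a ε = cfc (fun r : ℝ => r * (r + ε)⁻¹) (a * star a) := by
    rw [cfc_mul (fun r : ℝ => r) (fun r : ℝ => (r + ε)⁻¹) (a * star a) continuousOn_id hc,
      cfc_id' ℝ (a * star a), regInv]
  have h2 : ε • regInv a ε = cfc (fun r : ℝ => ε • (r + ε)⁻¹) (a * star a) :=
    (cfc_smul ε (fun r : ℝ => (r + ε)⁻¹) (a * star a) hc).symm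
  rw [h1, h2, ← cfc_add (a * star a) (fun r : ℝ => r * (r + ε)⁻¹) (fun r : ℝ => ε • (r + ε)⁻¹)
    (continuousOn_id.mul hc) (hc.const_smul ε), ← cfc_one ℝ (a * star a)]
  exact cfc_congr fun r hr => by
    have := hsp r hr
    simp only [smul_eq_mul, Pi.one_apply]
    field_simp

/-- Pairing (a a* + ε) w = a x with w gives ‖a* w‖² + ε ‖w‖² = Re ⟨a* w, x⟩ ≤ ‖a* w‖ ‖x‖. -/
theorem regInv_estimate (hε : 0 < ε) (x : H) :
    ‖star a (regInv a ε (a x))‖ ≤ ‖x‖ ∧ ε * ‖regInv a ε (a x)‖ ^ 2 ≤ ‖x‖ ^ 2 := by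
  set w := regInv a ε (a x)
  have h1 : a (star a w) + ε • w = a x :=
    congrArg (fun b : H →L[ℂ] H => b (a x)) (mul_regInv (a := a) hε)
  have hadj : ∀ y z : H, inner ℂ (star a y) z = inner ℂ y (a z) := fun y z =>
    ContinuousLinearMap.adjoint_inner_left a z y
  have h2 : (inner ℂ (star a w) x).re = ‖star a w‖ ^ 2 + ε * ‖w‖ ^ 2 := by
    rw [hadj, ← h1, inner_add_right, ← hadj, inner_self_eq_norm_sq_to_K, Complex.add_re]
    congr 1
    · norm_cast
    · rw [← Complex.coe_smul, inner_smul_right, Complex.re_ofReal_mul, inner_self_eq_norm_sq_to_K]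
      norm_cast
  have h3 : (inner ℂ (star a w) x).re ≤ ‖star a w‖ * ‖x‖ :=
    (Complex.re_le_norm _).trans (norm_inner_le_norm _ _)
  have h4 : 0 ≤ ε * ‖w‖ ^ 2 := by positivity
  have h5 : ‖star a w‖ ≤ ‖x‖ := by
    by_contra! hlt
    nlinarith [norm_nonneg x]
  exact ⟨h5, by nlinarith [norm_nonneg (star a w), norm_nonneg x]⟩

theorem star_mul_regInv_mul_le_one (hε : 0 < ε) : star a * regInv a ε * a ≤ 1 := by
  have h0 : 0 ≤ star a * regInv a ε * a := star_left_conjugate_nonneg (regInv_nonneg hε) a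
  rw [← CStarAlgebra.norm_le_one_iff_of_nonneg _ h0]
  refine ContinuousLinearMap.opNorm_le_bound _ zero_le_one fun x => ?_
  rw [one_mul]
  exact (regInv_estimate hε x).1

theorem mul_star_mul_regInv_le_one (hε : 0 < ε) : ‖a * star a * regInv a ε‖ ≤ 1 := by
  have h0 : 0 ≤ regInv a ε := regInv_nonneg hε
  have hsa : IsSelfAdjoint (a * star a) := IsSelfAdjoint.mul_star_self a
  have hcomm : Commute (a * star a) (regInv a ε) := ((Commute.refl (a * star a)).cfc_real _).symm
  have h1 : 0 ≤ a * star a * regInv a ε := hcomm.mul_nonneg (mul_star_self_nonneg a) h0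
  rw [CStarAlgebra.norm_le_one_iff_of_nonneg _ h1, ← mul_regInv (a := a) hε]
  exact le_add_of_nonneg_right (smul_nonneg hε.le h0)

/-- On a vector a z the error is ε w with w = (a a* + ε)⁻¹ a z, and ‖ε w‖ ≤ √ε ‖z‖. The uniform norm
bound extends this to the closure of the range, and both sides vanish on its orthogonal complement.
These approximants take the place of a polar decomposition when traces of range projections are
compared. -/
theorem tendsto_mul_regInv (x : H) :
    Tendsto (fun n : ℕ => (a * star a * regInv a (1 / ((n : ℝ) + 1))) x) atTop
      (𝓝 (proj (LinearMap.range a.toLinearMap) x)) := by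
  set K := LinearMap.range a.toLinearMap
  have hpos : ∀ n : ℕ, (0 : ℝ) < 1 / ((n : ℝ) + 1) := fun n => Nat.one_div_pos_of_nat
  have hk : star a * proj K = star a := by
    have h : proj K * a = a := by ext z; exact proj_apply_of_mem ⟨z, rfl⟩
    simpa [(isStarProjection_proj K).isSelfAdjoint.star_eq] using congrArg star h
  have hfac : ∀ n : ℕ, a * star a * regInv a (1 / ((n : ℝ) + 1)) * proj K
      = a * star a * regInv a (1 / ((n : ℝ) + 1)) := fun n => by
    have hc : Commute (a * star a) (regInv a (1 / ((n : ℝ) + 1))) :=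
      ((Commute.refl (a * star a)).cfc_real _).symm
    rw [hc.eq, ← mul_assoc, mul_assoc, hk]
  have hz : Tendsto (fun n : ℕ => (a * star a * regInv a (1 / ((n : ℝ) + 1)) - 1) (proj K x))
      atTop (𝓝 0) := by
    refine tendsto_zero_of_mem_closure (C := 1 + 1) (K := K) (fun n => ?_) ?_ ?_
    · refine (norm_sub_le _ _).trans (add_le_add (mul_star_mul_regInv_le_one (hpos n)) ?_)
      exact ContinuousLinearMap.norm_id_le
    · rintro _ ⟨z, rfl⟩
      have hsq : Tendsto (fun n : ℕ => √(1 / ((n : ℝ) + 1)) * ‖z‖) atTop (𝓝 0) := by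
        have := ((Real.continuous_sqrt.tendsto 0).comp
          (tendsto_one_div_add_atTop_nhds_zero_nat (𝕜 := ℝ))).mul_const ‖z‖
        simpa using this
      refine squeeze_zero_norm (fun n => ?_) hsq
      set ε : ℝ := 1 / ((n : ℝ) + 1)
      have h1 : (a * star a * regInv a ε - 1) (a z) = -(ε • regInv a ε (a z)) := by
        have := congrArg (fun b : H →L[ℂ] H => b (a z)) (mul_regInv (a := a) (hpos n))
        have h : (a * star a * regInv a ε) (a z) + ε • regInv a ε (a z) = a z := this
        rw [sub_apply, one_apply_eq_self, sub_eq_iff_eq_add,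
          ← sub_eq_neg_add, eq_sub_iff_add_eq]
        exact h
      have h2 := (regInv_estimate (a := a) (hpos n) z).2
      change ‖(a * star a * regInv a ε - 1) (a z)‖ ≤ _
      rw [h1, norm_neg, norm_smul, Real.norm_of_nonneg (hpos n).le]
      refine le_of_sq_le_sq ?_ (by positivity)
      rw [mul_pow, mul_pow, Real.sq_sqrt (hpos n).le, sq, mul_assoc]
      exact mul_le_mul_of_nonneg_left h2 (hpos n).le
    · rw [← Submodule.topologicalClosure_coe]
      exact proj_apply_mem K x
  have := hz.add_const (proj K x)
  rw [zero_add] at this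
  refine this.congr fun n => ?_
  rw [sub_apply, one_apply_eq_self, sub_add_cancel]
  exact congrArg (fun b : H →L[ℂ] H => b x) (hfac n)

end Regularized

theorem proj_range_mem {M : VonNeumannAlgebra H} {a : H →L[ℂ] H} (ha : a ∈ M) :
    proj (LinearMap.range a.toLinearMap) ∈ M := by
  refine proj_mem fun u hu => ?_
  rintro _ ⟨z, rfl⟩
  exact ⟨u z, (congrArg (fun b : H →L[ℂ] H => b z) (commute_of_mem_commutant ha hu).eq).symm⟩

theorem proj_ker_mem {M : VonNeumannAlgebra H} {a : H →L[ℂ] H} (ha : a ∈ M) :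
    proj (LinearMap.ker a.toLinearMap) ∈ M := by
  refine proj_mem fun u hu x hx => ?_
  have h := congrArg (fun b : H →L[ℂ] H => b x) (commute_of_mem_commutant ha hu).eq
  have hx' : a x = 0 := hx
  change a (u x) = 0
  simpa [hx'] using h.symm

/-- The range projection of `a = a e` has trace at most `τ e`. -/
theorem TracialState.re_proj_range_le {N : VonNeumannAlgebra H} (τ : TracialState N)
    {a e : H →L[ℂ] H} (ha : a ∈ N) (he : e ∈ N) (hp : IsStarProjection e) (h : a * e = a) :
    τ.re (proj (LinearMap.range a.toLinearMap)) ≤ τ.re e := by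
  have hpos : ∀ n : ℕ, (0 : ℝ) < 1 / ((n : ℝ) + 1) := fun n => Nat.one_div_pos_of_nat
  have hr : ∀ ε, regInv a ε ∈ N := fun ε => cfc_mem (mul_mem ha (star_mem ha)) _
  refine le_of_tendsto (τ.tendsto_re (fun n => mul_mem (mul_mem ha (star_mem ha)) (hr _))
    (proj_range_mem ha) 1 (fun n => mul_star_mul_regInv_le_one (hpos n)) tendsto_mul_regInv)
    (Eventually.of_forall fun n => ?_)
  set k := regInv a (1 / ((n : ℝ) + 1))
  have hk : k ∈ N := hr _
  have hes := hp.isSelfAdjoint.star_eq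
  have h1 : star a * k * a = e * (star a * k * a) * e := by
    have h' : e * star a = star a := by simpa [hes] using congrArg star h
    rw [← mul_assoc, ← mul_assoc, h', mul_assoc _ a e, h]
  -- Cyclicity replaces a a* k by a* k a, which is at most 1 and is supported under e; hence it is
  -- at most e.
  rw [mul_assoc, τ.re_mul_comm ha (mul_mem (star_mem ha) hk), h1]
  refine τ.re_mono (h1 ▸ mul_mem (mul_mem (star_mem ha) hk) ha) he ?_
  have := star_left_conjugate_le_conjugate (star_mul_regInv_mul_le_one (a := a) (hpos n)) e
  rwa [hes, mul_one, hp.isIdempotentElem.eq] at this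

/-! ### Positive unbounded operators and their resolvents. -/

/-- `u` maps the domain of `S` to itself and commutes with `S` on it. -/
def CommutesWith (u : H →L[ℂ] H) (S : H →ₗ.[ℂ] H) : Prop :=
  ∀ x : S.domain, ∃ hx : u x ∈ S.domain, S ⟨u x, hx⟩ = u (S x)

/-- A densely defined positive symmetric operator `S` for which `1 + S` has dense range. -/
structure IsEssentiallyPos (S : H →ₗ.[ℂ] H) : Prop where
  dense : Dense (S.domain : Set H)
  symm : ∀ x y : S.domain, inner ℂ (S x) (y : H) = inner ℂ (x : H) (S y)
  nonneg : ∀ x : S.domain, 0 ≤ (inner ℂ (S x) (x : H)).re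
  dense_range : Dense (Set.range fun x : S.domain => (x : H) + S x)

theorem IsEssentiallyPos.isClosable {S : H →ₗ.[ℂ] H} (hS : IsEssentiallyPos S) : S.IsClosable :=
  ((LinearPMap.adjoint_isClosed hS.dense).isClosable).leIsClosable
    (LinearPMap.IsFormalAdjoint.le_adjoint hS.dense fun x y => hS.symm x y)

/-- Symmetry and positivity pass to the closure G of the graph. The map (x, y) ↦ x + y is bounded
below on G, so its range is closed; it is also dense, so the map is a bijection of G onto H.
Composing its inverse with the two coordinates gives R and 1 - R. -/
theorem IsEssentiallyPos.exists_resolvent {S : H →ₗ.[ℂ] H} (hS : IsEssentiallyPos S) :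
    ∃ R : H →L[ℂ] H, 0 ≤ R ∧ R ≤ 1 ∧ IsResolvent S.closure R ∧
      ∀ x : S.domain, R ((x : H) + S x) = x := by
  set G := S.graph.topologicalClosure
  have hgr : S.closure.graph = G := (hS.isClosable.graph_closure_eq_closure_graph).symm
  have hGc : IsClosed (G : Set (H × H)) := Submodule.isClosed_topologicalClosure _
  have hGd : (G : Set (H × H)) = closure (S.graph : Set (H × H)) :=
    Submodule.topologicalClosure_coe _
  have hsymm : ∀ p ∈ G, ∀ q ∈ G, inner ℂ p.2 q.1 = inner ℂ p.1 q.2 := by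
    have h1 : ∀ p ∈ (S.graph : Set (H × H)), ∀ q ∈ G, inner ℂ p.2 q.1 = inner ℂ p.1 q.2 := by
      intro p hp q hq
      have hcl : IsClosed {q : H × H | inner ℂ p.2 q.1 = inner ℂ p.1 q.2} :=
        isClosed_eq (by fun_prop) (by fun_prop)
      refine closure_minimal (fun q hq => ?_) hcl (hGd.subset hq)
      obtain ⟨x, hx1, hx2⟩ := LinearPMap.mem_graph_iff _ |>.mp hp
      obtain ⟨y, hy1, hy2⟩ := LinearPMap.mem_graph_iff _ |>.mp hq
      change inner ℂ p.2 q.1 = inner ℂ p.1 q.2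
      rw [← hx1, ← hx2, ← hy1, ← hy2]
      exact hS.symm x y
    intro p hp q hq
    have hcl : IsClosed {p : H × H | inner ℂ p.2 q.1 = inner ℂ p.1 q.2} :=
      isClosed_eq (by fun_prop) (by fun_prop)
    exact closure_minimal (fun p hp => h1 p hp q hq) hcl (hGd.subset hp)
  have hpos : ∀ p ∈ G, 0 ≤ (inner ℂ p.2 p.1).re := by
    intro p hp
    have hcl : IsClosed {p : H × H | 0 ≤ (inner ℂ p.2 p.1).re} :=
      isClosed_le continuous_const (Complex.continuous_re.comp (by fun_prop))
    refine closure_minimal (fun q hq => ?_) hcl (hGd.subset hp)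
    obtain ⟨y, hy1, hy2⟩ := LinearPMap.mem_graph_iff _ |>.mp hq
    change 0 ≤ (inner ℂ q.2 q.1).re
    rw [← hy1, ← hy2]
    exact hS.nonneg y
  -- Positivity gives ‖x + y‖² ≥ ‖x‖² + ‖y‖², and the norm on the product is the maximum of the two.
  have hnorm : ∀ p ∈ G, ‖p‖ ≤ ‖p.1 + p.2‖ := by
    intro p hp
    have h1 := norm_add_sq (𝕜 := ℂ) p.2 p.1
    have h2 : 0 ≤ RCLike.re (inner ℂ p.2 p.1) := hpos p hp
    rw [add_comm p.2] at h1
    refine max_le ?_ ?_ <;> refine le_of_sq_le_sq ?_ (norm_nonneg _) <;>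
      nlinarith [sq_nonneg ‖p.1‖, sq_nonneg ‖p.2‖]
  have : CompleteSpace G := hGc.completeSpace_coe
  let A : G →L[ℂ] H := (ContinuousLinearMap.fst ℂ H H + ContinuousLinearMap.snd ℂ H H).comp
    G.subtypeL
  have hA : ∀ p : G, A p = (p : H × H).1 + (p : H × H).2 := fun _ => rfl
  have hanti : AntilipschitzWith 1 A :=
    A.antilipschitz_of_bound fun p => by simpa [hA] using hnorm p p.2
  have hsurj : Function.Surjective A := by
    have hcl := hanti.isClosed_range A.uniformContinuous
    rw [← Set.range_eq_univ, ← hcl.closure_eq, ← Set.univ_subset_iff, ← hS.dense_range.closure_eq]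
    refine closure_mono ?_
    rintro _ ⟨x, rfl⟩
    exact ⟨⟨(x, S x), S.graph.le_topologicalClosure (S.mem_graph x)⟩, rfl⟩
  let E : G ≃ₗ[ℂ] H := LinearEquiv.ofBijective A.toLinearMap ⟨hanti.injective, hsurj⟩
  have hE : ∀ p : G, E p = (p : H × H).1 + (p : H × H).2 := fun _ => rfl
  let R : H →L[ℂ] H := LinearMap.mkContinuous
    ((LinearMap.fst ℂ H H).comp (G.subtype.comp E.symm.toLinearMap)) 1 fun y => by
      have h := hnorm _ (E.symm y).2
      rw [← hE, E.apply_symm_apply] at h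
      rw [one_mul]
      exact (le_max_left _ _).trans h
  have hR : ∀ y, R y = (E.symm y : H × H).1 := fun _ => rfl
  have hRy : ∀ y, y = R y + (E.symm y : H × H).2 := fun y => by
    rw [hR, ← hE, E.apply_symm_apply]
  have hRp : ∀ p ∈ G, R (p.1 + p.2) = p.1 := fun p hp => by
    rw [hR, ← hE ⟨p, hp⟩, E.symm_apply_apply]
  refine ⟨R, ?_, ?_, ⟨fun y => ?_, fun x => ?_⟩, fun x => ?_⟩
  · rw [ContinuousLinearMap.nonneg_iff_isPositive]
    refine ⟨fun x y => ?_, fun x => ?_⟩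
    · change inner ℂ (R x) y = inner ℂ x (R y)
      conv_lhs => rw [hRy y]
      conv_rhs => rw [hRy x]
      rw [inner_add_left, inner_add_right, hR, hR]
      rw [hsymm _ (E.symm x).2 _ (E.symm y).2]
    · change 0 ≤ (inner ℂ (R x) x).re
      have e : inner ℂ (R x) x = inner ℂ (R x) (R x) + inner ℂ (R x) (E.symm x : H × H).2 := by
        rw [← inner_add_right, ← hRy x]
      rw [e, hR x, Complex.add_re, ← hsymm _ (E.symm x).2 _ (E.symm x).2]
      exact add_nonneg (inner_self_nonneg (𝕜 := ℂ)) (hpos _ (E.symm x).2)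
  · rw [ContinuousLinearMap.le_def]
    have h1R : ∀ x, (1 - R) x = (E.symm x : H × H).2 := fun x => by
      rw [sub_apply, one_apply_eq_self, sub_eq_iff_eq_add']
      exact hRy x
    refine ⟨fun x y => ?_, fun x => ?_⟩
    · change inner ℂ ((1 - R) x) y = inner ℂ x ((1 - R) y)
      rw [h1R, h1R]
      conv_lhs => rw [hRy y]
      conv_rhs => rw [hRy x]
      rw [inner_add_left, inner_add_right, hR, hR]
      rw [hsymm _ (E.symm x).2 _ (E.symm y).2]
    · change 0 ≤ (inner ℂ ((1 - R) x) x).re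
      rw [h1R]
      have e : inner ℂ (E.symm x : H × H).2 x = inner ℂ (E.symm x : H × H).2 (R x)
          + inner ℂ (E.symm x : H × H).2 (E.symm x : H × H).2 := by
        rw [← inner_add_right, ← hRy x]
      rw [e, hR x, Complex.add_re]
      exact add_nonneg (hpos _ (E.symm x).2) (inner_self_nonneg (𝕜 := ℂ))
  · have hm : (R y, (E.symm y : H × H).2) ∈ S.closure.graph := hgr.ge (E.symm y).2
    obtain ⟨z, hz1, hz2⟩ := LinearPMap.mem_graph_iff _ |>.mp hm
    have hz1' : (z : H) = R y := hz1
    refine ⟨hz1' ▸ z.2, ?_⟩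
    have : (⟨R y, hz1' ▸ z.2⟩ : S.closure.domain) = z := Subtype.ext hz1'.symm
    rw [this, hz2]
    exact (hRy y).symm
  · exact hRp (x, S.closure x) (hgr.le (S.closure.mem_graph x))
  · exact hRp (x, S x) (S.graph.le_topologicalClosure (S.mem_graph x))

-- The two sides agree on the dense range of 1 + S. Only the core S has to be tested, not its
-- closure.
omit [CompleteSpace H] in
theorem commute_resolvent_of_core {S : H →ₗ.[ℂ] H} (hS : IsEssentiallyPos S) {R u : H →L[ℂ] H}
    (hR : ∀ x : S.domain, R ((x : H) + S x) = x) (hu : CommutesWith u S) : Commute u R := by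
  refine ContinuousLinearMap.ext fun y => ?_
  refine congrFun (Continuous.ext_on hS.dense_range (f := fun y => u (R y)) (g := fun y => R (u y))
    (by fun_prop) (by fun_prop) ?_) y
  rintro _ ⟨x, rfl⟩
  obtain ⟨hx, hx'⟩ := hu x
  change u (R ((x : H) + S x)) = R (u ((x : H) + S x))
  rw [hR, map_add, ← hx', hR ⟨u x, hx⟩]

omit [CompleteSpace H] in
theorem IsResolvent.eq {T : H →ₗ.[ℂ] H} {R R' : H →L[ℂ] H} (h : IsResolvent T R)
    (h' : IsResolvent T R') : R = R' := by
  ext y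
  obtain ⟨hy, hy'⟩ := h.1 y
  have := h'.2 ⟨R y, hy⟩
  rw [hy'] at this
  exact this.symm

omit [CompleteSpace H] in
theorem IsResolvent.resolvent_eq {T : H →ₗ.[ℂ] H} {R : H →L[ℂ] H} (h : IsResolvent T R) :
    resolvent T = R := by
  have hex : ∃ R, IsResolvent T R := ⟨R, h⟩
  rw [resolvent, dif_pos hex]
  exact hex.choose_spec.eq h

omit [CompleteSpace H] in
theorem IsResolvent.injective {T : H →ₗ.[ℂ] H} {R : H →L[ℂ] H} (h : IsResolvent T R) {y : H}
    (hy : R y = 0) : y = 0 := by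
  obtain ⟨hd, hy'⟩ := h.1 y
  have h0 : (⟨R y, hd⟩ : T.domain) = 0 := Subtype.ext hy
  rw [h0, LinearPMap.map_zero, hy, add_zero] at hy'
  exact hy'.symm

/-- A positive self-adjoint operator is essentially positive. -/
theorem isEssentiallyPos_of_isSelfAdjoint {f : H →ₗ.[ℂ] H} (hf : IsSelfAdjoint f)
    (hpos : ∀ x : f.domain, 0 ≤ (inner ℂ (f x) (x : H)).re) : IsEssentiallyPos f := by
  have hd : Dense (f.domain : Set H) := hf.dense_domain
  have had : f.adjoint = f := hf
  have hsymm : ∀ x y : f.domain, inner ℂ (f x) (y : H) = inner ℂ (x : H) (f y) := by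
    have h := LinearPMap.adjoint_isFormalAdjoint hd
    rw [had] at h
    exact fun x y => h x y
  refine ⟨hd, hsymm, hpos, ?_⟩
  let L : Submodule ℂ H := LinearMap.range (f.domain.subtype + f.toFun)
  have hL : (L : Set H) = Set.range fun x : f.domain => (x : H) + f x := rfl
  rw [← hL, Submodule.dense_iff_topologicalClosure_eq_top,
    Submodule.topologicalClosure_eq_top_iff, Submodule.eq_bot_iff]
  intro z hz
  -- A vector z orthogonal to the range of 1 + f lies in the domain of f* = f, with f z = -z;
  -- positivity then forces z = 0.
  have hz' : ∀ x : f.domain, inner ℂ (-z) (x : H) = inner ℂ z (f x) := fun x => by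
    have : inner ℂ ((x : H) + f x) z = 0 := hz _ ⟨x, rfl⟩
    rw [← inner_conj_symm, map_eq_zero, inner_add_right] at this
    rw [inner_neg_left]
    exact neg_eq_of_add_eq_zero_right this
  have hzd : z ∈ f.adjoint.domain := LinearPMap.mem_adjoint_domain_of_exists z ⟨-z, hz'⟩
  have hzv := LinearPMap.adjoint_apply_eq hd ⟨z, hzd⟩ hz'
  have hzm : (z, -z) ∈ f.graph := by
    rw [← had, ← hzv]
    exact f.adjoint.mem_graph ⟨z, hzd⟩
  obtain ⟨x, hx1, hx2⟩ := LinearPMap.mem_graph_iff _ |>.mp hzm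
  have := hpos x
  rw [hx1, hx2, inner_neg_left, Complex.neg_re] at this
  have h2 : 0 ≤ (inner ℂ z z).re := inner_self_nonneg (𝕜 := ℂ)
  have h3 : (inner ℂ z z).re = 0 := by simp only at this; linarith
  exact inner_self_eq_zero.mp (Complex.ext h3 (inner_self_im (𝕜 := ℂ) z))

theorem IsSelfAdjoint.closure_eq {f : H →ₗ.[ℂ] H} (hf : IsSelfAdjoint f) : f.closure = f := by
  have hc : f.IsClosed := hf.isClosed
  refine LinearPMap.eq_of_eq_graph ?_
  rw [← hc.isClosable.graph_closure_eq_closure_graph]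
  exact hc.submodule_topologicalClosure_eq

/-! ### Spectral projections of T as functions of R = (1 + T)⁻¹; T ≤ t corresponds to R ≥ c = (1 +
t)⁻¹. -/

section Bounded

/-- The spectral projection `1_{[c,1]}(R)`, with `c = (1 + t)⁻¹`. -/
def specProj (R : H →L[ℂ] H) (t : ℝ) : H →L[ℂ] H :=
  proj (LinearMap.ker (cfc (fun r : ℝ => max ((1 + t)⁻¹ - r) 0) R).toLinearMap)

/-- The operator `max(R, c)⁻¹`, with `c = (1 + t)⁻¹`. -/
def specInv (R : H →L[ℂ] H) (t : ℝ) : H →L[ℂ] H := cfc (fun r : ℝ => (max r (1 + t)⁻¹)⁻¹) R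

variable {R : H →L[ℂ] H} {t : ℝ}

theorem isStarProjection_specProj : IsStarProjection (specProj R t) := isStarProjection_proj _

theorem specProj_mem {M : VonNeumannAlgebra H} (hR : R ∈ M) (t : ℝ) : specProj R t ∈ M :=
  proj_ker_mem (cfc_mem hR _)

theorem specInv_mem {M : VonNeumannAlgebra H} (hR : R ∈ M) (t : ℝ) : specInv R t ∈ M :=
  cfc_mem hR _

theorem commute_specProj {u : H →L[ℂ] H} (h : Commute u R) (h' : Commute (star u) R) (t : ℝ) :
    Commute u (specProj R t) := by
  have key : ∀ v : H →L[ℂ] H, Commute v R → ∀ x ∈ LinearMap.ker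
      (cfc (fun r : ℝ => max ((1 + t)⁻¹ - r) 0) R).toLinearMap, v x ∈ LinearMap.ker
      (cfc (fun r : ℝ => max ((1 + t)⁻¹ - r) 0) R).toLinearMap := fun v hv x hx => by
    have h := congrArg (fun b : H →L[ℂ] H => b x)
      (hv.symm.cfc_real fun r : ℝ => max ((1 + t)⁻¹ - r) 0).eq
    have hx' : cfc (fun r : ℝ => max ((1 + t)⁻¹ - r) 0) R x = 0 := hx
    simpa [hx'] using h
  exact commute_proj (key u h) (key (star u) h')

theorem commute_specProj_self (hR : IsSelfAdjoint R) (t : ℝ) : Commute R (specProj R t) :=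
  commute_specProj (Commute.refl R) (by rw [hR.star_eq]) t

theorem commute_specInv_specProj (hR : IsSelfAdjoint R) (s t : ℝ) :
    Commute (specInv R s) (specProj R t) :=
  ((commute_specProj_self hR t).cfc_real _)

theorem commute_specProj_specProj (hR : IsSelfAdjoint R) (s t : ℝ) :
    Commute (specProj R s) (specProj R t) := by
  refine commute_specProj (commute_specProj_self hR s).symm ?_ t
  rw [isStarProjection_specProj.isSelfAdjoint.star_eq]
  exact (commute_specProj_self hR s).symm

theorem mem_Icc_of_mem_spectrum (h0 : 0 ≤ R) (h1 : R ≤ 1) {r : ℝ} (hr : r ∈ spectrum ℝ R) :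
    0 ≤ r ∧ r ≤ 1 :=
  ⟨spectrum_nonneg_of_nonneg h0 hr,
    (CFC.le_one_iff (R := ℝ) R (IsSelfAdjoint.of_nonneg h0)).mp h1 r hr⟩

theorem continuous_max_inv (ht : 0 ≤ t) : Continuous fun r : ℝ => (max r (1 + t)⁻¹)⁻¹ := by
  have : 0 < (1 + t)⁻¹ := by positivity
  exact Continuous.inv₀ (by fun_prop) fun r => (lt_max_of_lt_right this).ne'

theorem one_le_specInv (h0 : 0 ≤ R) (h1 : R ≤ 1) (ht : 0 ≤ t) : 1 ≤ specInv R t := by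
  have hc : 0 < (1 + t)⁻¹ := by positivity
  have hc1 : (1 + t)⁻¹ ≤ 1 := inv_le_one_of_one_le₀ (by linarith)
  rw [specInv, one_le_cfc_iff _ R (continuous_max_inv ht).continuousOn (IsSelfAdjoint.of_nonneg h0)]
  intro r hr
  exact (one_le_inv₀ (lt_max_of_lt_right hc)).mpr
    (max_le (mem_Icc_of_mem_spectrum h0 h1 hr).2 hc1)

theorem specInv_le (h0 : 0 ≤ R) (ht : 0 ≤ t) : specInv R t ≤ (1 + t) • 1 := by
  have hc : 0 < (1 + t)⁻¹ := by positivity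
  rw [← Algebra.algebraMap_eq_smul_one, specInv]
  refine cfc_le_algebraMap _ _ R ?_ (continuous_max_inv ht).continuousOn
    (IsSelfAdjoint.of_nonneg h0)
  intro r hr
  exact inv_le_of_inv_le₀ (by positivity) (le_max_right _ _)

/-- R max(R, c)⁻¹ = 1 - (1 + t)(c - R)₊, and the spectral projection is the projection onto the
kernel of (c - R)₊. -/
theorem mul_specInv_mul_specProj (h0 : 0 ≤ R) (ht : 0 ≤ t) :
    R * specInv R t * specProj R t = specProj R t := by
  have hsa : IsSelfAdjoint R := IsSelfAdjoint.of_nonneg h0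
  have hc : 0 < (1 + t)⁻¹ := by positivity
  have h1 : R * specInv R t + (1 + t) • cfc (fun r : ℝ => max ((1 + t)⁻¹ - r) 0) R = 1 := by
    have e1 : R * specInv R t = cfc (fun r : ℝ => r * (max r (1 + t)⁻¹)⁻¹) R := by
      rw [cfc_mul (fun r : ℝ => r) (fun r : ℝ => (max r (1 + t)⁻¹)⁻¹) R continuousOn_id
        (continuous_max_inv ht).continuousOn, cfc_id' ℝ R, specInv]
    rw [e1, ← cfc_smul (1 + t) (fun r : ℝ => max ((1 + t)⁻¹ - r) 0) R (by fun_prop),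
      ← cfc_add R (fun r : ℝ => r * (max r (1 + t)⁻¹)⁻¹) _
        (continuous_id.mul (continuous_max_inv ht)).continuousOn (by fun_prop), ← cfc_one ℝ R]
    refine cfc_congr fun r hr => ?_
    simp only [smul_eq_mul, Pi.one_apply]
    have ht1 : 1 + t ≠ 0 := by positivity
    rcases le_total r (1 + t)⁻¹ with h | h
    · rw [max_eq_right h, max_eq_left (by linarith)]
      field_simp
      ring
    · rw [max_eq_left h, max_eq_right (by linarith), mul_zero, add_zero,
        mul_inv_cancel₀ (hc.trans_le h).ne']
  have h2 := congrArg (· * specProj R t) h1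
  simpa only [add_mul, smul_mul_assoc, specProj, mul_proj_ker, smul_zero, add_zero, one_mul] using h2

/-- (c - R)₊ (R - c)₊ = 0, so the range of (R - c)₊ lies in the kernel of (c - R)₊. -/
theorem specProj_mul_cfc (h0 : 0 ≤ R) :
    specProj R t * cfc (fun r : ℝ => max (r - (1 + t)⁻¹) 0) R
      = cfc (fun r : ℝ => max (r - (1 + t)⁻¹) 0) R := by
  have hsa : IsSelfAdjoint R := IsSelfAdjoint.of_nonneg h0
  have h : cfc (fun r : ℝ => max ((1 + t)⁻¹ - r) 0) R *
      cfc (fun r : ℝ => max (r - (1 + t)⁻¹) 0) R = 0 := by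
    rw [← cfc_mul _ _ R (by fun_prop) (by fun_prop), ← cfc_zero ℝ R]
    refine cfc_congr fun r _ => ?_
    rcases le_total r (1 + t)⁻¹ with h | h
    · simp [max_eq_right (sub_nonpos.mpr h)]
    · simp [max_eq_right (sub_nonpos.mpr h)]
  ext x
  exact proj_apply_of_mem (congrArg (fun b : H →L[ℂ] H => b x) h)

theorem cfc_mul_one_sub_specProj (h0 : 0 ≤ R) :
    cfc (fun r : ℝ => max (r - (1 + t)⁻¹) 0) R * (1 - specProj R t) = 0 := by
  have h := (commute_specProj_self (IsSelfAdjoint.of_nonneg h0) t).cfc_real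
    fun r : ℝ => max (r - (1 + t)⁻¹) 0
  rw [mul_sub, mul_one, h.eq, specProj_mul_cfc h0, sub_self]

theorem norm_mul_one_sub_specProj_le (h0 : 0 ≤ R) (ht : 0 ≤ t) :
    ‖R * (1 - specProj R t)‖ ≤ (1 + t)⁻¹ := by
  have hsa : IsSelfAdjoint R := IsSelfAdjoint.of_nonneg h0
  have hc : 0 < (1 + t)⁻¹ := by positivity
  -- The summand (R - c)₊ is annihilated by the complementary projection; what remains has norm at
  -- most c.
  have h1 : R = cfc (fun r : ℝ => min r (1 + t)⁻¹) R + cfc (fun r : ℝ => max (r - (1 + t)⁻¹) 0) R := by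
    rw [← cfc_add R _ _ (by fun_prop) (by fun_prop)]
    conv_lhs => rw [← cfc_id' ℝ R]
    refine cfc_congr fun r _ => ?_
    rcases le_total r (1 + t)⁻¹ with h | h
    · simp [h]
    · simp [h]
  have h2 : R * (1 - specProj R t) = cfc (fun r : ℝ => min r (1 + t)⁻¹) R * (1 - specProj R t) := by
    have := congrArg (· * (1 - specProj R t)) h1
    simpa only [add_mul, cfc_mul_one_sub_specProj h0, add_zero] using this
  rw [h2]
  refine (norm_mul_le _ _).trans ?_
  have h3 : ‖cfc (fun r : ℝ => min r (1 + t)⁻¹) R‖ ≤ (1 + t)⁻¹ := by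
    refine norm_cfc_le hc.le fun r hr => ?_
    have := spectrum_nonneg_of_nonneg h0 hr
    rw [Real.norm_of_nonneg (le_min this hc.le)]
    exact min_le_right _ _
  have h4 : ‖1 - specProj R t‖ ≤ 1 := IsStarProjection.norm_le _ isStarProjection_specProj.one_sub
  calc _ ≤ (1 + t)⁻¹ * 1 := mul_le_mul h3 h4 (norm_nonneg _) hc.le
    _ = _ := mul_one _

/-- cR - R² = R (c - R)₊ - R (R - c)₊, where the first term is positive and the second annihilates
y. In terms of T this becomes the lower bound `le_re_inner` for the quadratic form. -/
theorem norm_sq_le_of_specProj_eq_zero (h0 : 0 ≤ R) {y : H}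
    (hy : specProj R t y = 0) : ‖R y‖ ^ 2 ≤ (1 + t)⁻¹ * (inner ℂ (R y) y).re := by
  have hsa : IsSelfAdjoint R := IsSelfAdjoint.of_nonneg h0
  have h1 : (1 + t)⁻¹ • R - R * R = cfc (fun r : ℝ => r * max ((1 + t)⁻¹ - r) 0) R
      - R * cfc (fun r : ℝ => max (r - (1 + t)⁻¹) 0) R := by
    have e1 : R * cfc (fun r : ℝ => max (r - (1 + t)⁻¹) 0) R
        = cfc (fun r : ℝ => r * max (r - (1 + t)⁻¹) 0) R := by
      rw [cfc_mul (fun r : ℝ => r) _ R continuousOn_id (by fun_prop), cfc_id' ℝ R]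
    have e2 : (1 + t)⁻¹ • R - R * R = cfc (fun r : ℝ => (1 + t)⁻¹ • r - r * r) R := by
      rw [cfc_sub (fun r : ℝ => (1 + t)⁻¹ • r) (fun r : ℝ => r * r) R (by fun_prop) (by fun_prop),
        cfc_smul (1 + t)⁻¹ (fun r : ℝ => r) R continuousOn_id,
        cfc_mul (fun r : ℝ => r) (fun r : ℝ => r) R continuousOn_id continuousOn_id, cfc_id' ℝ R]
    rw [e1, e2, ← cfc_sub _ _ R (by fun_prop) (by fun_prop)]
    refine cfc_congr fun r _ => ?_
    simp only [smul_eq_mul]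
    rcases le_total r (1 + t)⁻¹ with h | h
    · rw [max_eq_left (sub_nonneg.mpr h), max_eq_right (sub_nonpos.mpr h)]; ring
    · rw [max_eq_right (sub_nonpos.mpr h), max_eq_left (sub_nonneg.mpr h)]; ring
  have h2 : cfc (fun r : ℝ => max (r - (1 + t)⁻¹) 0) R y = 0 := by
    have := congrArg (fun b : H →L[ℂ] H => b y) (cfc_mul_one_sub_specProj (t := t) h0)
    simpa [hy] using this
  have h3 := congrArg (fun b : H →L[ℂ] H => (inner ℂ (b y) y).re) h1
  have h4 : 0 ≤ cfc (fun r : ℝ => r * max ((1 + t)⁻¹ - r) 0) R :=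
    cfc_nonneg fun r hr => mul_nonneg (spectrum_nonneg_of_nonneg h0 hr) (le_max_right _ _)
  have h5 : 0 ≤ (inner ℂ (cfc (fun r : ℝ => r * max ((1 + t)⁻¹ - r) 0) R y) y).re :=
    ((ContinuousLinearMap.nonneg_iff_isPositive _).mp h4).re_inner_nonneg_left y
  have h6 : (inner ℂ (R (R y)) y).re = ‖R y‖ ^ 2 := by
    have : inner ℂ (R (R y)) y = inner ℂ (R y) (R y) :=
      ((ContinuousLinearMap.nonneg_iff_isPositive _).mp h0).inner_left_eq_inner_right _ _
    rw [this, inner_self_eq_norm_sq_to_K]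
    norm_cast
  simp only [sub_apply, mul_apply_eq_comp, h2, map_zero, sub_zero, inner_sub_left, Complex.sub_re, h6,
    smul_apply] at h3
  rw [← Complex.coe_smul, inner_smul_left, Complex.conj_ofReal, Complex.re_ofReal_mul] at h3
  linarith

/-- An injective self-adjoint R has dense range, and on that range the error is at most ‖(1 - e_k)
R‖ ≤ 1/(1 + k). -/
theorem tendsto_specProj (h0 : 0 ≤ R) (hinj : ∀ y, R y = 0 → y = 0) (x : H) :
    Tendsto (fun k : ℕ => specProj R k x) atTop (𝓝 x) := by
  have hsa : IsSelfAdjoint R := IsSelfAdjoint.of_nonneg h0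
  have hdense : x ∈ closure (LinearMap.range R.toLinearMap : Set H) := by
    rw [← Submodule.topologicalClosure_coe]
    have : (LinearMap.range R.toLinearMap).topologicalClosure = ⊤ := by
      rw [Submodule.topologicalClosure_eq_top_iff, Submodule.eq_bot_iff]
      intro z hz
      refine hinj z (ext_inner_left ℂ fun v => ?_)
      rw [inner_zero_right, ← hz (R v) ⟨v, rfl⟩]
      exact (((ContinuousLinearMap.nonneg_iff_isPositive _).mp h0).inner_left_eq_inner_right v z).symm
    rw [this]; trivial
  have h := tendsto_zero_of_mem_closure (c := fun k : ℕ => 1 - specProj R k) (C := 1)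
    (fun k => IsStarProjection.norm_le _ isStarProjection_specProj.one_sub) ?_ hdense
  · have := h.const_sub x
    simpa using this
  · rintro _ ⟨z, rfl⟩
    have hlim : Tendsto (fun k : ℕ => (1 + (k : ℝ))⁻¹ * ‖z‖) atTop (𝓝 0) := by
      have := (tendsto_one_div_add_atTop_nhds_zero_nat (𝕜 := ℝ)).mul_const ‖z‖
      simpa [add_comm] using this
    refine squeeze_zero_norm (fun k => ?_) hlim
    have hcomm : (1 - specProj R k) * R = R * (1 - specProj R k) := by
      rw [sub_mul, mul_sub, one_mul, mul_one, (commute_specProj_self hsa k).eq]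
    change ‖((1 - specProj R k) * R) z‖ ≤ _
    rw [hcomm]
    refine (ContinuousLinearMap.le_opNorm _ _).trans ?_
    gcongr
    exact norm_mul_one_sub_specProj_le h0 (Nat.cast_nonneg k)

end Bounded

/-! ### Truncations of an unbounded operator. -/

/-- The operator `T 1_{[0,t]}(T)` in terms of the resolvent `R` of `T`. -/
def truncOp (R : H →L[ℂ] H) (t : ℝ) : H →L[ℂ] H := (specInv R t - 1) * specProj R t

/-- `R` is the resolvent of `T` and a positive contraction. -/
structure IsPosResolvent (T : H →ₗ.[ℂ] H) (R : H →L[ℂ] H) : Prop where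
  isResolvent : IsResolvent T R
  nonneg : 0 ≤ R
  le_one : R ≤ 1

section Truncation

variable {R : H →L[ℂ] H} {s t : ℝ}

theorem truncOp_mem {M : VonNeumannAlgebra H} (hR : R ∈ M) (t : ℝ) : truncOp R t ∈ M :=
  mul_mem (sub_mem (specInv_mem hR t) (one_mem M)) (specProj_mem hR t)

theorem commute_specInv_sub_one_specProj (hR : IsSelfAdjoint R) (s t : ℝ) :
    Commute (specInv R s - 1) (specProj R t) :=
  (commute_specInv_specProj hR s t).sub_left (Commute.one_left _)

theorem commute_truncOp_specProj (hR : IsSelfAdjoint R) (s t : ℝ) :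
    Commute (truncOp R s) (specProj R t) :=
  (commute_specInv_sub_one_specProj hR s t).mul_left (commute_specProj_specProj hR s t)

theorem truncOp_nonneg (h0 : 0 ≤ R) (h1 : R ≤ 1) (ht : 0 ≤ t) : 0 ≤ truncOp R t :=
  (commute_specInv_sub_one_specProj (IsSelfAdjoint.of_nonneg h0) t t).mul_nonneg
    (sub_nonneg.mpr (one_le_specInv h0 h1 ht)) isStarProjection_specProj.nonneg

theorem truncOp_mul_specProj (R : H →L[ℂ] H) (t : ℝ) :
    truncOp R t * specProj R t = truncOp R t := by
  rw [truncOp, mul_assoc, isStarProjection_specProj.isIdempotentElem.eq]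

theorem truncOp_le (h0 : 0 ≤ R) (ht : 0 ≤ t) : truncOp R t ≤ t • 1 := by
  have e : t • (1 : H →L[ℂ] H) - (specInv R t - 1) = (1 + t) • 1 - specInv R t := by
    rw [add_smul, one_smul]; abel
  have h : 0 ≤ (t • 1 - (specInv R t - 1)) * specProj R t := by
    refine Commute.mul_nonneg ?_ isStarProjection_specProj.nonneg ?_
    · exact e ▸ sub_nonneg.mpr (specInv_le h0 ht)
    · exact ((Commute.one_left _).smul_left t).sub_left
        (commute_specInv_sub_one_specProj (IsSelfAdjoint.of_nonneg h0) t t)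
  rw [sub_mul, smul_mul_assoc, one_mul, sub_nonneg] at h
  exact h.trans (smul_le_smul_of_nonneg_left isStarProjection_specProj.le_one ht)

variable {T : H →ₗ.[ℂ] H} (hT : IsPosResolvent T R)
include hT

theorem IsPosResolvent.spectralLE_eq (t : ℝ) : spectralLE T t = specProj R t := by
  rw [spectralLE, hT.isResolvent.resolvent_eq, specProj]

theorem IsPosResolvent.isSelfAdjoint : IsSelfAdjoint R := IsSelfAdjoint.of_nonneg hT.nonneg

/-- Here x = R y with y = max(R, c)⁻¹ x, so x lies in the domain and T x = y - x. -/
theorem IsPosResolvent.exists_apply_eq (ht : 0 ≤ t) {x : H} (hx : specProj R t x = x) :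
    ∃ h : x ∈ T.domain, T ⟨x, h⟩ = truncOp R t x := by
  have h1 : R (specInv R t x) = x := by
    have := congrArg (fun b : H →L[ℂ] H => b x) (mul_specInv_mul_specProj hT.nonneg ht)
    simpa [hx] using this
  obtain ⟨hd, h2⟩ := hT.isResolvent.1 (specInv R t x)
  have hxd : x ∈ T.domain := h1 ▸ hd
  refine ⟨hxd, ?_⟩
  have h3 : (⟨R (specInv R t x), hd⟩ : T.domain) = ⟨x, hxd⟩ := Subtype.ext h1
  rw [h3, h1] at h2
  rw [truncOp, mul_apply_eq_comp, hx, sub_apply, one_apply_eq_self, eq_sub_iff_add_eq, add_comm]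
  exact h2

theorem IsPosResolvent.truncation_eq (ht : 0 ≤ t) : truncation T t = truncOp R t := by
  have key : ∀ x, ∃ hx : spectralLE T t x ∈ T.domain, truncOp R t x = T ⟨spectralLE T t x, hx⟩ := by
    intro x
    rw [hT.spectralLE_eq]
    obtain ⟨h, h'⟩ := hT.exists_apply_eq ht (x := specProj R t x)
      (congrArg (fun b : H →L[ℂ] H => b x) isStarProjection_specProj.isIdempotentElem.eq)
    refine ⟨h, ?_⟩
    rw [h', ← mul_apply_eq_comp, truncOp_mul_specProj]
  have hex : ∃ a : H →L[ℂ] H, ∀ x, ∃ hx : spectralLE T t x ∈ T.domain,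
    a x = T ⟨spectralLE T t x, hx⟩ := ⟨_, key⟩
  rw [truncation, dif_pos hex]
  ext x
  obtain ⟨_, h1⟩ := hex.choose_spec x
  obtain ⟨_, h2⟩ := key x
  rw [h1, h2]

/-- Both sides are T applied to the same vector e_s e_t x. -/
theorem IsPosResolvent.truncOp_mul_specProj_comm (hs : 0 ≤ s) (ht : 0 ≤ t) :
    truncOp R s * specProj R t = truncOp R t * specProj R s := by
  have hc := commute_specProj_specProj hT.isSelfAdjoint s t
  ext x
  have hs' : specProj R s (specProj R s (specProj R t x)) = specProj R s (specProj R t x) :=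
    congrArg (fun b : H →L[ℂ] H => b (specProj R t x)) isStarProjection_specProj.isIdempotentElem.eq
  have ht' : specProj R t (specProj R t (specProj R s x)) = specProj R t (specProj R s x) :=
    congrArg (fun b : H →L[ℂ] H => b (specProj R s x)) isStarProjection_specProj.isIdempotentElem.eq
  have hcx : specProj R s (specProj R t x) = specProj R t (specProj R s x) :=
    congrArg (fun b : H →L[ℂ] H => b x) hc.eq
  obtain ⟨h1, h1'⟩ := hT.exists_apply_eq hs hs'
  obtain ⟨h2, h2'⟩ := hT.exists_apply_eq ht ht'
  have e1 : truncOp R s (specProj R s (specProj R t x)) = truncOp R s (specProj R t x) :=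
    congrArg (fun b : H →L[ℂ] H => b (specProj R t x)) (truncOp_mul_specProj R s)
  have e2 : truncOp R t (specProj R t (specProj R s x)) = truncOp R t (specProj R s x) :=
    congrArg (fun b : H →L[ℂ] H => b (specProj R s x)) (truncOp_mul_specProj R t)
  rw [e1] at h1'
  rw [e2] at h2'
  rw [mul_apply_eq_comp, mul_apply_eq_comp, ← h1', ← h2']
  congr 1
  exact Subtype.ext hcx

/-- For y = x + T x one has R y = x, and injectivity of R shows that e_t annihilates y as well. The
bounded estimate then reads (1 + t)‖x‖² ≤ Re ⟨x, x + T x⟩. -/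
theorem IsPosResolvent.le_re_inner (ht : 0 ≤ t) (x : T.domain) (hx : specProj R t (x : H) = 0) :
    t * ‖(x : H)‖ ^ 2 ≤ (inner ℂ (T x) (x : H)).re := by
  set y := (x : H) + T x with hy
  have hRy : R y = x := hT.isResolvent.2 x
  have hey : specProj R t y = 0 := by
    refine hT.isResolvent.injective ?_
    have := congrArg (fun b : H →L[ℂ] H => b y) (commute_specProj_self hT.isSelfAdjoint t).eq
    simp only [mul_apply_eq_comp, hRy, hx] at this
    exact this
  have h := norm_sq_le_of_specProj_eq_zero hT.nonneg hey
  rw [hRy, hy, inner_add_right, inner_self_eq_norm_sq_to_K, Complex.add_re,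
    inv_mul_eq_div, le_div_iff₀ (by positivity)] at h
  have h2 : (((‖(x : H)‖ : ℂ)) ^ 2).re = ‖(x : H)‖ ^ 2 := by norm_cast
  have h3 : (inner ℂ (x : H) (T x)).re = (inner ℂ (T x) (x : H)).re := by
    rw [← inner_conj_symm, Complex.conj_re]
  rw [h3] at h
  have h4 : RCLike.ofReal (K := ℂ) ‖(x : H)‖ = (‖(x : H)‖ : ℂ) := rfl
  rw [h4, h2] at h
  linarith

/-- A vector z in the range of e_s and annihilated by e_t satisfies t‖z‖² ≤ ⟨T z, z⟩ ≤ s‖z‖², so z =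
0 when s < t. -/
theorem IsPosResolvent.specProj_mul_specProj (hs : 0 ≤ s) (hst : s ≤ t) :
    specProj R t * specProj R s = specProj R s := by
  have hc := commute_specProj_specProj hT.isSelfAdjoint s t
  rcases hst.eq_or_lt with rfl | hlt
  · exact isStarProjection_specProj.isIdempotentElem.eq
  ext x
  set z := specProj R s (x - specProj R t x) with hz
  have h1 : specProj R s z = z :=
    congrArg (fun b : H →L[ℂ] H => b (x - specProj R t x))
      isStarProjection_specProj.isIdempotentElem.eq
  have h2 : specProj R t z = 0 := by
    have h3 := congrArg (fun b : H →L[ℂ] H => b (x - specProj R t x)) hc.eq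
    have h4 : specProj R t (x - specProj R t x) = 0 := by
      have := congrArg (fun b : H →L[ℂ] H => b x)
        (isStarProjection_specProj (R := R) (t := t)).isIdempotentElem.eq
      simp only [mul_apply_eq_comp] at this
      rw [map_sub, this, sub_self]
    simp only [mul_apply_eq_comp, h4, map_zero] at h3
    exact h3.symm
  obtain ⟨hd, hTz⟩ := hT.exists_apply_eq hs h1
  have h5 := hT.le_re_inner (hs.trans hst) ⟨z, hd⟩ h2
  have h6 : (inner ℂ (truncOp R s z) z).re ≤ s * ‖z‖ ^ 2 := by
    have := ((ContinuousLinearMap.le_def _ _).mp (truncOp_le hT.nonneg hs)).re_inner_nonneg_left z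
    change 0 ≤ (inner ℂ ((s • 1 - truncOp R s) z) z).re at this
    rw [sub_apply, inner_sub_left, smul_apply, one_apply_eq_self, ← Complex.coe_smul,
      inner_smul_left, Complex.conj_ofReal, Complex.sub_re, Complex.re_ofReal_mul,
      inner_self_eq_norm_sq_to_K, sub_nonneg] at this
    have h2 : ((RCLike.ofReal (K := ℂ) ‖z‖) ^ 2).re = ‖z‖ ^ 2 := by norm_cast
    rwa [h2] at this
  rw [hTz] at h5
  have h7 : ‖z‖ ^ 2 ≤ 0 := by
    have : (t - s) * ‖z‖ ^ 2 ≤ 0 := by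
      have h5' : t * ‖z‖ ^ 2 ≤ (inner ℂ (truncOp R s z) z).re := h5
      linarith
    exact nonpos_of_mul_nonpos_right this (sub_pos.mpr hlt)
  have h8 : z = 0 := by
    rw [← norm_eq_zero]
    exact pow_eq_zero_iff two_ne_zero |>.mp (le_antisymm h7 (sq_nonneg _))
  rw [hz, map_sub, sub_eq_zero] at h8
  exact (h8.trans (congrArg (fun b : H →L[ℂ] H => b x) hc.eq)).symm

theorem IsPosResolvent.truncOp_mono (hs : 0 ≤ s) (hst : s ≤ t) : truncOp R s ≤ truncOp R t := by
  have h1 : truncOp R t * specProj R s = truncOp R s := by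
    rw [hT.truncOp_mul_specProj_comm (hs.trans hst) hs, truncOp, mul_assoc,
      (commute_specProj_specProj hT.isSelfAdjoint s t).eq, hT.specProj_mul_specProj hs hst]
  have h2 : 0 ≤ truncOp R t * (1 - specProj R s) :=
    ((Commute.one_right _).sub_right (commute_truncOp_specProj hT.isSelfAdjoint t s)).mul_nonneg
      (truncOp_nonneg hT.nonneg hT.le_one (hs.trans hst)) isStarProjection_specProj.one_sub.nonneg
  rwa [mul_sub, mul_one, h1, sub_nonneg] at h2

end Truncation

theorem IsPosResolvent.tendsto_re_one_sub {N : VonNeumannAlgebra H} (τ : TracialState N)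
    {T : H →ₗ.[ℂ] H} {R : H →L[ℂ] H} (hT : IsPosResolvent T R) (hR : R ∈ N) :
    Tendsto (fun k : ℕ => τ.re (1 - specProj R k)) atTop (𝓝 0) := by
  have h := τ.tendsto_re (a := fun k : ℕ => specProj R k) (b := 1) (fun k => specProj_mem hR k)
    (one_mem N) 1 (fun k => IsStarProjection.norm_le _ isStarProjection_specProj)
    (tendsto_specProj hT.nonneg fun _ => hT.isResolvent.injective)
  have h2 := h.const_sub (τ.re 1)
  rw [sub_self] at h2
  exact h2.congr fun k => (τ.re_sub (one_mem N) (specProj_mem hR k)).symm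

theorem one_sub_proj_ker (a : H →L[ℂ] H) :
    1 - proj (LinearMap.ker a.toLinearMap) = proj (LinearMap.range (star a).toLinearMap) := by
  have h1 : proj (LinearMap.ker a.toLinearMap) * proj (LinearMap.range (star a).toLinearMap) = 0 := by
    have h : proj (LinearMap.ker a.toLinearMap) * star a = 0 := by
      simpa [(isStarProjection_proj _).isSelfAdjoint.star_eq] using congrArg star (mul_proj_ker a)
    refine mul_proj_eq_zero ?_
    rintro _ ⟨z, rfl⟩
    exact congrArg (fun b : H →L[ℂ] H => b z) h
  have h2 : a * (1 - proj (LinearMap.range (star a).toLinearMap)) = 0 := by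
    have h : proj (LinearMap.range (star a).toLinearMap) * star a = star a := by
      ext z; exact proj_apply_of_mem ⟨z, rfl⟩
    have := congrArg star h
    rw [star_mul, star_star, (isStarProjection_proj _).isSelfAdjoint.star_eq] at this
    rw [mul_sub, this, mul_one, sub_self]
  have h3 : proj (LinearMap.ker a.toLinearMap) * (1 - proj (LinearMap.range (star a).toLinearMap))
      = 1 - proj (LinearMap.range (star a).toLinearMap) := by
    ext z
    exact proj_apply_of_mem (congrArg (fun b : H →L[ℂ] H => b z) h2)
  rw [mul_sub, mul_one, h1, sub_zero] at h3
  rw [h3, sub_sub_cancel]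

/-- This is the density test used below: a subspace invariant under the commutant is dense once the
projection onto its closure has full trace. -/
theorem TracialState.eq_one_of_one_le_re {N : VonNeumannAlgebra H} (τ : TracialState N)
    {p : H →L[ℂ] H} (hp : p ∈ N) (hpp : IsStarProjection p) (h : 1 ≤ τ.re p) : p = 1 := by
  have h1 : τ.re (1 - p) = 0 := by
    refine le_antisymm ?_ (τ.re_nonneg (sub_mem (one_mem N) hp) hpp.one_sub.nonneg)
    rw [τ.re_sub (one_mem N) hp, τ.re_one]
    linarith
  exact (sub_eq_zero.mp
    (τ.eq_zero_of_re_eq_zero (sub_mem (one_mem N) hp) hpp.one_sub.nonneg h1)).symm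

theorem dense_of_proj_eq_one {K : Submodule ℂ H} (h : proj K = 1) : Dense (K : Set H) := by
  intro x
  have := proj_apply_mem K x
  rw [h] at this
  rwa [← Submodule.topologicalClosure_coe]

/-! ### The compression q g q for a finite trace. -/

section Compress

variable {N : VonNeumannAlgebra H} (τ : TracialState N) {g : H →ₗ.[ℂ] H} {R q : H →L[ℂ] H}

omit [CompleteSpace H] in
theorem commutesWith_algCompress {u : H →L[ℂ] H} (hu : CommutesWith u g) (huq : Commute u q) :
    CommutesWith u (algCompress q g) := by
  intro x
  obtain ⟨h, h'⟩ := hu ⟨q x, x.2⟩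
  have hq : ∀ y, q (u y) = u (q y) := fun y =>
    (congrArg (fun b : H →L[ℂ] H => b y) huq.eq).symm
  have hx : u x ∈ (algCompress q g).domain := by
    change q (u x) ∈ g.domain
    rw [hq]; exact h
  refine ⟨hx, ?_⟩
  change q (g ⟨q (u x), hx⟩) = u (q (g ⟨q x, x.2⟩))
  rw [← hq, ← h']
  congr 2
  exact Subtype.ext (hq x)

/-- The projection `q` commutes with `q g q`. -/
theorem commutesWith_algCompress_self (hq : IsStarProjection q) :
    CommutesWith q (algCompress q g) := by
  intro x
  have hqq : ∀ y, q (q y) = q y := fun y =>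
    congrArg (fun b : H →L[ℂ] H => b y) hq.isIdempotentElem.eq
  have hx : q x ∈ (algCompress q g).domain := by
    change q (q x) ∈ g.domain
    rw [hqq]; exact x.2
  refine ⟨hx, ?_⟩
  change q (g ⟨q (q x), hx⟩) = q (q (g ⟨q x, x.2⟩))
  rw [hqq (g _)]
  congr 2
  exact Subtype.ext (hqq x)

include τ in
/-- For a finite trace, the algebraic product `q g q` is essentially self-adjoint. -/
theorem isEssentiallyPos_algCompress (hg : IsEssentiallyPos g) (hR : IsPosResolvent g R)
    (hRN : R ∈ N) (hgN : Affiliated N g) (hqN : q ∈ N) (hq : IsStarProjection q) :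
    IsEssentiallyPos (algCompress q g) := by
  have hqs : ∀ x y, inner ℂ (q x) y = inner ℂ x (q y) := fun x y => by
    have := ContinuousLinearMap.adjoint_inner_left q y x
    rwa [← ContinuousLinearMap.star_eq_adjoint, hq.isSelfAdjoint.star_eq] at this
  have hS : ∀ x : (algCompress q g).domain, algCompress q g x = q (g ⟨q x, x.2⟩) := fun _ => rfl
  have hcomm : ∀ u ∈ N.commutant, CommutesWith u (algCompress q g) := fun u hu =>
    commutesWith_algCompress (hgN u hu) (commute_of_mem_commutant hqN hu)
  have heN : ∀ k : ℕ, 1 - specProj R k ∈ N := fun k => sub_mem (one_mem N) (specProj_mem hRN k)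
  -- the kernels of `(1 - e k) q`
  let K : ℕ → Submodule ℂ H := fun k => LinearMap.ker ((1 - specProj R k) * q).toLinearMap
  have hKN : ∀ k, proj (K k) ∈ N := fun k => proj_ker_mem (mul_mem (heN k) hqN)
  -- The complement of K k is the range projection of q (1 - e_k), whose trace is at most τ(1 -
  -- e_k). So the K k fill out H in trace, and q maps each of them into the domain of g.
  have hKτ : ∀ k : ℕ, 1 - τ.re (1 - specProj R k) ≤ τ.re (proj (K k)) := fun k => by
    have hes := (isStarProjection_specProj (R := R) (t := k)).one_sub
    have h1 := τ.re_proj_range_le (a := star ((1 - specProj R k) * q)) (e := 1 - specProj R k)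
      (star_mem (mul_mem (heN k) hqN)) (heN k) hes (by
        rw [star_mul, hes.isSelfAdjoint.star_eq, mul_assoc, hes.isIdempotentElem.eq])
    rw [← one_sub_proj_ker, τ.re_sub (one_mem N) (hKN k), τ.re_one] at h1
    linarith
  have hKe : ∀ k : ℕ, ∀ x ∈ K k, specProj R k (q x) = q x := fun k x hx => by
    have : (1 - specProj R k) (q x) = 0 := hx
    rwa [sub_apply, one_apply_eq_self, sub_eq_zero, eq_comm] at this
  have hKd : ∀ k : ℕ, ∀ x ∈ K k, ∃ h : x ∈ (algCompress q g).domain,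
      algCompress q g ⟨x, h⟩ = (q * truncOp R k * q) x := fun k x hx => by
    obtain ⟨h, h'⟩ := hR.exists_apply_eq (Nat.cast_nonneg k) (hKe k x hx)
    exact ⟨h, congrArg q h'⟩
  have hlim : Tendsto (fun k : ℕ => 1 - τ.re (1 - specProj R k)) atTop (𝓝 1) := by
    simpa using (hR.tendsto_re_one_sub τ hRN).const_sub 1
  refine ⟨?_, fun x y => ?_, fun x => ?_, ?_⟩
  · refine dense_of_proj_eq_one ?_
    have hmem : proj (algCompress q g).domain ∈ N :=
      proj_mem fun u hu x hx => (hcomm u hu ⟨x, hx⟩).1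
    refine τ.eq_one_of_one_le_re hmem (isStarProjection_proj _) ?_
    refine le_of_tendsto hlim (Eventually.of_forall fun k => (hKτ k).trans ?_)
    exact τ.re_mono (hKN k) hmem (proj_mono fun x hx => (hKd k x hx).1)
  · exact (hqs _ _).trans ((hg.symm ⟨q x, x.2⟩ ⟨q y, y.2⟩).trans (hqs _ _))
  · rw [hS, hqs]
    exact hg.nonneg ⟨q x, x.2⟩
  · let L : Submodule ℂ H :=
      LinearMap.range ((algCompress q g).domain.subtype + (algCompress q g).toFun)
    have hL : (L : Set H) = Set.range fun x : (algCompress q g).domain => (x : H) + algCompress q g x :=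
      rfl
    rw [← hL]
    refine dense_of_proj_eq_one ?_
    have hmem : proj L ∈ N := by
      refine proj_mem fun u hu => ?_
      rintro _ ⟨x, rfl⟩
      obtain ⟨h, h'⟩ := hcomm u hu x
      refine ⟨⟨u x, h⟩, ?_⟩
      change u x + algCompress q g ⟨u x, h⟩ = u (x + algCompress q g x)
      rw [h', map_add]
    refine τ.eq_one_of_one_le_re hmem (isStarProjection_proj _) ?_
    refine le_of_tendsto hlim (Eventually.of_forall fun k => (hKτ k).trans ?_)
    set b := q * truncOp R k * q with hb
    have hb0 : 0 ≤ b := by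
      have := star_right_conjugate_nonneg
        (truncOp_nonneg hR.nonneg hR.le_one (Nat.cast_nonneg (α := ℝ) k)) q
      rwa [hq.isSelfAdjoint.star_eq] at this
    have hbN : b ∈ N := mul_mem (mul_mem hqN (truncOp_mem hRN k)) hqN
    set a := (1 + b) * proj (K k) with ha
    have haN : a ∈ N := mul_mem (add_mem (one_mem N) hbN) (hKN k)
    -- As b ≥ 0, the operator 1 + b is injective, so a = (1 + b) proj(K k) has right support proj(K
    -- k). Its range projection has at least the same trace, and its range lies in the range of 1 +
    -- q g q.
    have hker : LinearMap.ker a.toLinearMap = LinearMap.ker (proj (K k)).toLinearMap := by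
      ext x
      change (1 + b) (proj (K k) x) = 0 ↔ proj (K k) x = 0
      refine ⟨fun h => ?_, fun h => by rw [h, map_zero]⟩
      set y := proj (K k) x
      have h1 : 0 ≤ (inner ℂ (b y) y).re :=
        ((ContinuousLinearMap.nonneg_iff_isPositive _).mp hb0).re_inner_nonneg_left y
      have h2 : inner ℂ ((1 + b) y) y = 0 := by rw [h, inner_zero_left]
      rw [add_apply, one_apply_eq_self, inner_add_left] at h2
      have h3 := congrArg Complex.re h2
      rw [Complex.add_re, Complex.zero_re] at h3
      have h4 : 0 ≤ (inner ℂ y y).re := inner_self_nonneg (𝕜 := ℂ)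
      have h5 : (inner ℂ y y).re = 0 := by linarith
      exact inner_self_eq_zero.mp (Complex.ext h5 (inner_self_im (𝕜 := ℂ) y))
    have hP : proj (LinearMap.range (star a).toLinearMap) = proj (K k) := by
      have h := one_sub_proj_ker (proj (K k))
      rw [(isStarProjection_proj (K k)).isSelfAdjoint.star_eq,
        proj_range (isStarProjection_proj (K k))] at h
      rw [← one_sub_proj_ker, hker, h]
    have h1 := τ.re_proj_range_le (a := star a) (e := proj (LinearMap.range a.toLinearMap))
      (star_mem haN) (proj_range_mem haN) (isStarProjection_proj _) (by
        have h : proj (LinearMap.range a.toLinearMap) * a = a := by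
          ext z; exact proj_apply_of_mem ⟨z, rfl⟩
        have := congrArg star h
        rwa [star_mul, (isStarProjection_proj _).isSelfAdjoint.star_eq] at this)
    rw [hP] at h1
    refine h1.trans (τ.re_mono (proj_range_mem haN) hmem ?_)
    have hKc : IsClosed (K k : Set H) := ((1 - specProj R k) * q).isClosed_ker
    refine proj_mono ?_
    rintro _ ⟨z, rfl⟩
    have hz : proj (K k) z ∈ K k := by
      have := proj_apply_mem (K k) z
      rwa [← SetLike.mem_coe, Submodule.topologicalClosure_coe, hKc.closure_eq] at this
    obtain ⟨h, h'⟩ := hKd k _ hz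
    refine ⟨⟨proj (K k) z, h⟩, ?_⟩
    change proj (K k) z + algCompress q g ⟨proj (K k) z, h⟩ = (1 + b) (proj (K k) z)
    rw [h', add_apply, one_apply_eq_self]

/-- Where the compression `q g q` exceeds `s`, the trace of `g` dominates `s` times the trace. -/
theorem ofReal_mul_re_le_iSup {R' : H →L[ℂ] H} (hR : IsPosResolvent g R) (hRN : R ∈ N)
    (hqN : q ∈ N) (hq : IsStarProjection q) (hR' : IsPosResolvent (compress q g) R')
    (hRN' : R' ∈ N) {s : ℝ} (hs : 0 ≤ s) (hc : Commute q (specProj R' s)) :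
    ENNReal.ofReal (s * τ.re (q * (1 - specProj R' s)))
      ≤ ⨆ k : ℕ, ENNReal.ofReal (τ.re (truncOp R k * (q * (1 - specProj R' s)))) := by
  set p := q * (1 - specProj R' s) with hpdef
  have hp : IsStarProjection p :=
    hq.mul isStarProjection_specProj.one_sub ((Commute.one_right _).sub_right hc)
  have hpN : p ∈ N := mul_mem hqN (sub_mem (one_mem N) (specProj_mem hRN' s))
  have hqp : q * p = p := by rw [hpdef, ← mul_assoc, hq.isIdempotentElem.eq]
  have hep : specProj R' s * p = 0 := by
    rw [hpdef, ← mul_assoc, ← hc.eq, mul_assoc, isStarProjection_specProj.mul_one_sub_self, mul_zero]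
  have heN : ∀ k : ℕ, 1 - specProj R k ∈ N := fun k => sub_mem (one_mem N) (specProj_mem hRN k)
  have key : ∀ k : ℕ, s * τ.re p ≤ τ.re (truncOp R k * p) + s * τ.re (1 - specProj R k) := by
    intro k
    -- Vectors in the range of p need not lie in the domain of g. Removing r leaves a projection c ≤
    -- p below e_k, at a cost in trace of at most τ(1 - e_k).
    set r := proj (LinearMap.range (p * (1 - specProj R k)).toLinearMap) with hrdef
    have hes := (isStarProjection_specProj (R := R) (t := k)).one_sub
    have hr : IsStarProjection r := isStarProjection_proj _
    have hrN : r ∈ N := proj_range_mem (mul_mem hpN (heN k))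
    have hrτ : τ.re r ≤ τ.re (1 - specProj R k) :=
      τ.re_proj_range_le (mul_mem hpN (heN k)) (heN k) hes (by
        rw [mul_assoc, hes.isIdempotentElem.eq])
    have hpr : p * r = r := by
      refine mul_eq_of_proj_le ?_
      rintro _ ⟨z, rfl⟩
      exact congrArg (fun b : H →L[ℂ] H => b ((1 - specProj R k) z)) hp.isIdempotentElem.eq
    have hrp : r * p = r := by
      simpa [hr.isSelfAdjoint.star_eq, hp.isSelfAdjoint.star_eq] using congrArg star hpr
    set c := p - r with hcdef
    have hcp : IsStarProjection c := hr.sub_of_mul_eq_left hp hrp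
    have hcN : c ∈ N := sub_mem hpN hrN
    have hpc : p * c = c := by rw [hcdef, mul_sub, hp.isIdempotentElem.eq, hpr]
    have hec : (1 - specProj R k) * c = 0 := by
      have h1 : r * (p * (1 - specProj R k)) = p * (1 - specProj R k) := by
        ext z; exact proj_apply_of_mem ⟨z, rfl⟩
      have h2 := congrArg star h1
      rw [star_mul, star_mul, hr.isSelfAdjoint.star_eq, hp.isSelfAdjoint.star_eq,
        hes.isSelfAdjoint.star_eq, mul_assoc, hpr] at h2
      rw [hcdef, mul_sub, h2, sub_self]
    -- A vector x in the range of c is fixed by q and e_k and annihilated by the spectral projection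
    -- of q g q, so ⟨g x, x⟩ = ⟨(q g q) x, x⟩ ≥ s‖x‖².
    have hlow : s • c ≤ c * truncOp R k * c := by
      have hsa : IsSelfAdjoint (c * truncOp R k * c) := by
        have := (IsSelfAdjoint.of_nonneg
          (truncOp_nonneg hR.nonneg hR.le_one (Nat.cast_nonneg (α := ℝ) k))).conjugate c
        rwa [hcp.isSelfAdjoint.star_eq] at this
      rw [ContinuousLinearMap.le_def, ContinuousLinearMap.isPositive_def']
      refine ⟨hsa.sub ((IsSelfAdjoint.all s).smul hcp.isSelfAdjoint), fun y => ?_⟩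
      have happ : ∀ {a b d : H →L[ℂ] H}, a * b = d → ∀ z, a (b z) = d z := fun h z =>
        congrArg (fun b : H →L[ℂ] H => b z) h
      set x := c y with hx
      have hpx : p x = x := happ hpc y
      have hqx : q x = x := by
        rw [← hpx]; exact happ hqp x
      have hex : specProj R' s x = 0 := by
        rw [← hpx]; exact happ hep x
      have hkx : specProj R k x = x := by
        have : (1 - specProj R k) (c y) = 0 := happ hec y
        rwa [sub_apply, one_apply_eq_self, sub_eq_zero, eq_comm] at this
      obtain ⟨hd, hgx⟩ := hR.exists_apply_eq (Nat.cast_nonneg k) hkx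
      have hdS : x ∈ (algCompress q g).domain := by
        change q x ∈ g.domain
        rwa [hqx]
      have hSx : algCompress q g ⟨x, hdS⟩ = q (truncOp R k x) := by
        rw [← hgx]
        change q (g ⟨q x, hdS⟩) = _
        congr 2
        exact Subtype.ext hqx
      have hle : algCompress q g ≤ compress q g := LinearPMap.le_closure _
      have hTx : compress q g ⟨x, hle.1 hdS⟩ = q (truncOp R k x) := by
        rw [← hSx]
        exact (hle.2 (x := ⟨x, hdS⟩) (y := ⟨x, hle.1 hdS⟩) rfl).symm
      have h := hR'.le_re_inner hs ⟨x, hle.1 hdS⟩ hex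
      rw [hTx] at h
      have hadj : ∀ {a : H →L[ℂ] H}, IsSelfAdjoint a → ∀ v w, inner ℂ (a v) w = inner ℂ v (a w) :=
        fun {a} ha v w => by
          have := ContinuousLinearMap.adjoint_inner_left a w v
          rwa [← ContinuousLinearMap.star_eq_adjoint, ha.star_eq] at this
      change s * ‖x‖ ^ 2 ≤ (inner ℂ (q (truncOp R k x)) x).re at h
      rw [hadj hq.isSelfAdjoint, hqx] at h
      change 0 ≤ (inner ℂ ((c * truncOp R k * c - s • c) y) y).re
      have hcc : c x = x := happ hcp.isIdempotentElem.eq y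
      have e1 : inner ℂ ((c * truncOp R k * c) y) y = inner ℂ (truncOp R k x) x :=
        hadj hcp.isSelfAdjoint _ _
      have e2 : (inner ℂ (c y) y).re = ‖x‖ ^ 2 := by
        rw [← hx, ← hcc, hadj hcp.isSelfAdjoint, ← hx, inner_self_eq_norm_sq_to_K, hcc]
        norm_cast
      rw [sub_apply, inner_sub_left, e1, smul_apply, ← Complex.coe_smul, inner_smul_left,
        Complex.conj_ofReal, Complex.sub_re, Complex.re_ofReal_mul, e2]
      linarith
    have hkN : truncOp R k ∈ N := truncOp_mem hRN k
    have hk0 := truncOp_nonneg hR.nonneg hR.le_one (Nat.cast_nonneg (α := ℝ) k)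
    have h1 : s * τ.re c ≤ τ.re (truncOp R k * c) := by
      have h2 := τ.re_mono (smul_mem hcN s) (mul_mem (mul_mem hcN hkN) hcN) hlow
      rwa [τ.re_smul hcN, mul_assoc, τ.re_mul_comm hcN (mul_mem hkN hcN), mul_assoc,
        hcp.isIdempotentElem.eq] at h2
    have h2 : τ.re (truncOp R k * c) ≤ τ.re (truncOp R k * p) :=
      τ.re_mul_mono_right hcN hpN hkN (sub_le_self _ hr.nonneg) hk0
    rw [hcdef, τ.re_sub hpN hrN, ← hcdef] at h1
    nlinarith
  -- The error s τ(1 - e_k) tends to 0 while the supremum stays fixed.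
  have hlim : Tendsto (fun k : ℕ => (⨆ k : ℕ, ENNReal.ofReal (τ.re (truncOp R k * p)))
      + ENNReal.ofReal (s * τ.re (1 - specProj R k))) atTop
      (𝓝 ((⨆ k : ℕ, ENNReal.ofReal (τ.re (truncOp R k * p))) + ENNReal.ofReal (s * 0))) :=
    tendsto_const_nhds.add
      (ENNReal.tendsto_ofReal ((hR.tendsto_re_one_sub τ hRN).const_mul s))
  rw [mul_zero, ENNReal.ofReal_zero, add_zero] at hlim
  refine ge_of_tendsto hlim (Eventually.of_forall fun k => ?_)
  refine (ENNReal.ofReal_le_ofReal (key k)).trans (ENNReal.ofReal_add_le.trans ?_)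
  gcongr
  exact le_iSup (fun k : ℕ => ENNReal.ofReal (τ.re (truncOp R k * p))) k

end Compress

theorem mem_commutant_of_le {M N : VonNeumannAlgebra H} (h : M ≤ N) {u : H →L[ℂ] H}
    (hu : u ∈ N.commutant) : u ∈ M.commutant :=
  VonNeumannAlgebra.mem_commutant_iff.mpr fun a ha =>
    VonNeumannAlgebra.mem_commutant_iff.mp hu a (h ha)

/-! ### Positive L₁ operators: one Cuculescu step, and splitting at a height. -/

section L1

variable {N : VonNeumannAlgebra H} {τ : TracialState N} {M : VonNeumannAlgebra H}
  {g : H →ₗ.[ℂ] H}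

theorem TracialState.MemL1Pos.isEssentiallyPos (hg : τ.MemL1Pos M g) : IsEssentiallyPos g :=
  isEssentiallyPos_of_isSelfAdjoint hg.isSelfAdjoint hg.nonneg

theorem TracialState.MemL1Pos.exists_resolvent (hg : τ.MemL1Pos M g) :
    ∃ R ∈ M, IsPosResolvent g R := by
  obtain ⟨R, h0, h1, hR, hR'⟩ := hg.isEssentiallyPos.exists_resolvent
  rw [IsSelfAdjoint.closure_eq hg.isSelfAdjoint] at hR
  exact ⟨R, mem_of_forall_commute fun u hu =>
    commute_resolvent_of_core hg.isEssentiallyPos hR' (hg.affiliated u hu), hR, h0, h1⟩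

theorem IsPosResolvent.traceMul_eq (τ : TracialState N) {R : H →L[ℂ] H} (hR : IsPosResolvent g R)
    (x : H →L[ℂ] H) : τ.traceMul g x = ⨆ k : ℕ, ENNReal.ofReal (τ.re (truncOp R k * x)) := by
  simp only [TracialState.traceMul, hR.truncation_eq (Nat.cast_nonneg _)]

theorem TracialState.MemL1Pos.exists_resolvent_compress (hg : τ.MemL1Pos M g) (hM : M ≤ N)
    {q : H →L[ℂ] H} (hqM : q ∈ M) (hq : IsStarProjection q) :
    ∃ R ∈ M, IsPosResolvent (compress q g) R ∧ Commute q R := by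
  obtain ⟨R, hRM, hR⟩ := hg.exists_resolvent
  have hS := isEssentiallyPos_algCompress τ hg.isEssentiallyPos hR (hM hRM)
    (fun u hu => hg.affiliated u (mem_commutant_of_le hM hu)) (hM hqM) hq
  obtain ⟨R', h0, h1, hR', hR''⟩ := hS.exists_resolvent
  refine ⟨R', mem_of_forall_commute fun u hu => ?_, ⟨hR', h0, h1⟩, ?_⟩
  · exact commute_resolvent_of_core hS hR'' (commutesWith_algCompress (hg.affiliated u hu)
      (commute_of_mem_commutant hqM hu))
  · exact commute_resolvent_of_core hS hR'' (commutesWith_algCompress_self hq)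

/-- One step of Cuculescu's construction. -/
theorem TracialState.MemL1Pos.cuculescu_step (hg : τ.MemL1Pos M g) (hM : M ≤ N)
    {q : H →L[ℂ] H} (hqM : q ∈ M) (hq : IsStarProjection q) {s : ℝ} (hs : 0 ≤ s) :
    spectralLE (compress q g) s ∈ M ∧ IsStarProjection (spectralLE (compress q g) s) ∧
      Commute q (spectralLE (compress q g) s) ∧
      ENNReal.ofReal (s * τ.re (q * (1 - spectralLE (compress q g) s)))
        ≤ τ.traceMul g (q * (1 - spectralLE (compress q g) s)) := by
  obtain ⟨R, hRM, hR⟩ := hg.exists_resolvent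
  obtain ⟨R', hRM', hR', hc⟩ := hg.exists_resolvent_compress hM hqM hq
  have hc' : Commute q (specProj R' s) :=
    commute_specProj hc (by rwa [hq.isSelfAdjoint.star_eq]) s
  rw [hR'.spectralLE_eq, hR.traceMul_eq]
  exact ⟨specProj_mem hRM' s, isStarProjection_specProj, hc',
    ofReal_mul_re_le_iSup τ hR (hM hRM) (hM hqM) hq hR' (hM hRM') hs hc'⟩

theorem IsPosResolvent.monotone_ofReal_re (τ : TracialState N) {R x : H →L[ℂ] H}
    (hR : IsPosResolvent g R) (hRN : R ∈ N) (hx : x ∈ N) (hx0 : 0 ≤ x) :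
    Monotone fun k : ℕ => ENNReal.ofReal (τ.re (truncOp R k * x)) := fun _ _ h =>
  ENNReal.ofReal_le_ofReal (τ.re_mul_mono_left (truncOp_mem hRN _) (truncOp_mem hRN _) hx
    (hR.truncOp_mono (Nat.cast_nonneg _) (Nat.cast_le.mpr h)) hx0)

theorem TracialState.MemL1Pos.traceMul_add (hg : τ.MemL1Pos N g) {x y : H →L[ℂ] H} (hx : x ∈ N)
    (hx0 : 0 ≤ x) (hy : y ∈ N) (hy0 : 0 ≤ y) :
    τ.traceMul g (x + y) = τ.traceMul g x + τ.traceMul g y := by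
  obtain ⟨R, hRN, hR⟩ := hg.exists_resolvent
  rw [hR.traceMul_eq, hR.traceMul_eq, hR.traceMul_eq, ENNReal.iSup_add_iSup_of_monotone
    (hR.monotone_ofReal_re τ hRN hx hx0) (hR.monotone_ofReal_re τ hRN hy hy0)]
  congr 1
  ext k
  have hk0 := truncOp_nonneg hR.nonneg hR.le_one (Nat.cast_nonneg (α := ℝ) k)
  have hkN : truncOp R k ∈ N := truncOp_mem hRN k
  rw [mul_add, τ.re_add (mul_mem hkN hx) (mul_mem hkN hy),
    ENNReal.ofReal_add (τ.re_mul_nonneg hkN hx hk0 hx0) (τ.re_mul_nonneg hkN hy hk0 hy0)]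

/-- Splitting `g` at height `t`: `τ(g P) ≤ t τ(P) + τ(g 1_{(t,∞)}(g))`. -/
theorem TracialState.MemL1Pos.traceMul_le (hg : τ.MemL1Pos N g) {P : H →L[ℂ] H} (hP : P ∈ N)
    (hPp : IsStarProjection P) {t : ℝ} (ht : 0 ≤ t) :
    τ.traceMul g P ≤ ENNReal.ofReal (t * τ.re P) + τ.traceMul g (spectralGT g t) := by
  obtain ⟨R, hRN, hR⟩ := hg.exists_resolvent
  rw [spectralGT, hR.spectralLE_eq, hR.traceMul_eq, hR.traceMul_eq]
  refine iSup_le fun k => ?_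
  set e := specProj R t
  have he : IsStarProjection e := isStarProjection_specProj
  have heN : e ∈ N := specProj_mem hRN t
  have hkN : truncOp R k ∈ N := truncOp_mem hRN k
  have hk0 := truncOp_nonneg hR.nonneg hR.le_one (Nat.cast_nonneg (α := ℝ) k)
  -- g 1_{[0,k]}(g) 1_{[0,t]}(g) = g 1_{[0,t]}(g) 1_{[0,k]}(g), which is at most t whichever of k
  -- and t is larger.
  have h1 : truncOp R k * e ≤ t • 1 := by
    rw [hR.truncOp_mul_specProj_comm (Nat.cast_nonneg k) ht]
    have hsp : IsStarProjection (specProj R (k : ℝ)) := isStarProjection_specProj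
    have hc : Commute (truncOp R t) (specProj R k) := commute_truncOp_specProj hR.isSelfAdjoint t k
    have h := star_left_conjugate_le_conjugate (truncOp_le hR.nonneg ht) (specProj R k)
    rw [hsp.isSelfAdjoint.star_eq, ← hc.eq, mul_assoc, hsp.isIdempotentElem.eq, mul_smul_comm,
      mul_one, smul_mul_assoc, hsp.isIdempotentElem.eq] at h
    exact h.trans (smul_le_smul_of_nonneg_left hsp.le_one ht)
  have h2 : τ.re (truncOp R k * e * P) ≤ t * τ.re P := by
    have := τ.re_mul_mono_left (mul_mem hkN heN) (smul_mem (one_mem N) t) hP h1 hPp.nonneg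
    rwa [smul_mul_assoc, one_mul, τ.re_smul hP] at this
  have h3N : truncOp R k * (1 - e) ∈ N := mul_mem hkN (sub_mem (one_mem N) heN)
  have h3 : 0 ≤ truncOp R k * (1 - e) :=
    ((Commute.one_right _).sub_right (commute_truncOp_specProj hR.isSelfAdjoint k t)).mul_nonneg
      hk0 he.one_sub.nonneg
  have h4 : τ.re (truncOp R k * (1 - e) * P) ≤ τ.re (truncOp R k * (1 - e)) := by
    have := τ.re_mul_mono_right hP (one_mem N) h3N hPp.le_one h3
    rwa [mul_one] at this
  have h5 : τ.re (truncOp R k * P)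
      = τ.re (truncOp R k * e * P) + τ.re (truncOp R k * (1 - e) * P) := by
    rw [← τ.re_add (mul_mem (mul_mem hkN heN) hP) (mul_mem h3N hP)]
    congr 1
    noncomm_ring
  rw [h5]
  refine (ENNReal.ofReal_le_ofReal (add_le_add h2 h4)).trans (ENNReal.ofReal_add_le.trans ?_)
  gcongr
  exact le_iSup (fun k : ℕ => ENNReal.ofReal (τ.re (truncOp R k * (1 - e)))) k

end L1

/-! ### Passage to the infimum and the maximal inequality. -/

/-- Decreasing star projections converge strongly to the projection onto the intersection of
their ranges. -/
theorem tendsto_proj_iInf {q : ℕ → H →L[ℂ] H} (hq : ∀ n, IsStarProjection (q n))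
    (hanti : Antitone q) (x : H) :
    Tendsto (fun n => (1 - q n) x) atTop
      (𝓝 ((1 - proj (⨅ n, LinearMap.range (q n).toLinearMap)) x)) := by
  -- The complements 1 - q n increase, and their join is the complement of the meet of the q n.
  let U : ℕ → Submodule ℂ H := fun n => (LinearMap.range (1 - q n).toLinearMap).topologicalClosure
  have hU : ∀ n, (U n).starProjection = 1 - q n := fun n => proj_range (hq n).one_sub
  have hmono : Monotone U := fun m n h => by
    rw [← Submodule.starProjection_le_starProjection_iff, hU, hU]
    exact sub_le_sub_left (hanti h) 1
  have h := Submodule.starProjection_tendsto_closure_iSup U hmono x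
  set p := proj (⨅ n, LinearMap.range (q n).toLinearMap) with hp
  have hqp : ∀ n, q n * p = p := fun n => mul_eq_of_proj_le fun y hy => by
    obtain ⟨z, rfl⟩ := (Submodule.mem_iInf _).mp hy n
    exact congrArg (fun b : H →L[ℂ] H => b z) (hq n).isIdempotentElem.eq
  have hpq : ∀ n, p * q n = p := fun n => by
    simpa [(hq n).isSelfAdjoint.star_eq, hp, (isStarProjection_proj _).isSelfAdjoint.star_eq]
      using congrArg star (hqp n)
  have h1 : p * proj (⨆ n, U n) = 0 := by
    refine mul_proj_eq_zero fun y hy => ?_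
    have hle : (⨆ n, U n) ≤ LinearMap.ker p.toLinearMap := by
      refine iSup_le fun n => Submodule.topologicalClosure_minimal _ ?_ p.isClosed_ker
      rintro _ ⟨z, rfl⟩
      have : p * (1 - q n) = 0 := by rw [mul_sub, hpq, mul_one, sub_self]
      exact congrArg (fun b : H →L[ℂ] H => b z) this
    exact hle hy
  have h2 : ∀ n, q n * (1 - proj (⨆ n, U n)) = 1 - proj (⨆ n, U n) := fun n => by
    have h3 : proj (⨆ n, U n) * (1 - q n) = 1 - q n := by
      ext z
      exact proj_apply_of_mem ((le_iSup U n) (Submodule.le_topologicalClosure _ ⟨z, rfl⟩))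
    have h4 := congrArg star h3
    rw [star_mul, (isStarProjection_proj _).isSelfAdjoint.star_eq,
      (hq n).one_sub.isSelfAdjoint.star_eq, sub_mul, one_mul] at h4
    rw [mul_sub, mul_one]
    rw [sub_eq_sub_iff_add_eq_add] at h4 ⊢
    rw [add_comm, h4, add_comm]
  have h3 : p * (1 - proj (⨆ n, U n)) = 1 - proj (⨆ n, U n) := by
    ext z
    exact proj_apply_of_mem ((Submodule.mem_iInf _).mpr fun n =>
      ⟨(1 - proj (⨆ n, U n)) z, congrArg (fun b : H →L[ℂ] H => b z) (h2 n)⟩)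
  rw [mul_sub, mul_one, h1, sub_zero] at h3
  rw [h3, sub_sub_cancel]
  simp only [hU] at h
  exact h

/-- The conditional expectations enter only through `IsCondExp`, so any choice of them may serve as
`g`. -/
theorem TracialState.cuculescu_main {N : VonNeumannAlgebra H} (τ : TracialState N)
    {F : ℕ → VonNeumannAlgebra H} (hmono : Monotone F) (hle : ∀ n, F n ≤ N)
    {f : H →ₗ.[ℂ] H} (hf : τ.MemL1Pos N f) {g : ℕ → H →ₗ.[ℂ] H}
    (hg : ∀ n, τ.IsCondExp (F n) f (g n)) {s : ℝ} (hs : 0 < s) :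
    proj (⨅ n, LinearMap.range (cuculescuSeq g s n).toLinearMap) ∈ N ∧
      ENNReal.ofReal (τ.re (1 - proj (⨅ n, LinearMap.range (cuculescuSeq g s n).toLinearMap))) ≤
        2 / ENNReal.ofReal s * τ.traceMul f (spectralGT f (s / 2)) := by
  set q := cuculescuSeq g s with hqdef
  have hsucc : ∀ n, q (n + 1) = q n * spectralLE (compress (q n) (g (n + 1))) s := fun _ => rfl
  have hq : ∀ n, q n ∈ F n ∧ IsStarProjection (q n) := by
    intro n
    induction n with
    | zero => exact ⟨one_mem _, .one _⟩
    | succ n ih =>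
      obtain ⟨h1, h2, h3, -⟩ := (hg (n + 1)).1.cuculescu_step (hle _)
        (hmono n.le_succ ih.1) ih.2 hs.le
      rw [hsucc]
      exact ⟨mul_mem (hmono n.le_succ ih.1) h1, ih.2.mul h2 h3⟩
  have hqN : ∀ n, q n ∈ N := fun n => hle n (hq n).1
  have hstep := fun n => (hg (n + 1)).1.cuculescu_step (hle _)
    (hmono n.le_succ (hq n).1) (hq n).2 hs.le
  have hanti : Antitone q := antitone_nat_of_succ_le fun n => by
    refine (hq (n + 1)).2.le_of_mul_eq_right (hq n).2 ?_
    rw [hsucc, ← mul_assoc, (hq n).2.isIdempotentElem.eq]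
  -- Induction along 1 - q (n+1) = (1 - q n) + q n (1 - e): each newly removed projection
  -- contributes one step inequality.
  have hsum : ∀ n, ENNReal.ofReal (s * τ.re (1 - q n)) ≤ τ.traceMul f (1 - q n) := by
    intro n
    induction n with
    | zero =>
      have : τ.re (1 - q 0) = 0 := by
        change τ.re (1 - 1) = 0
        rw [τ.re_sub (one_mem N) (one_mem N), sub_self]
      simp [this]
    | succ n ih =>
      obtain ⟨h1, h2, h3, h4⟩ := hstep n
      set e := spectralLE (compress (q n) (g (n + 1))) s
      have hpM : q n * (1 - e) ∈ F (n + 1) :=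
        mul_mem (hmono n.le_succ (hq n).1) (sub_mem (one_mem _) h1)
      have hpp : IsStarProjection (q n * (1 - e)) :=
        (hq n).2.mul h2.one_sub ((Commute.one_right _).sub_right h3)
      have hdec : 1 - q (n + 1) = (1 - q n) + q n * (1 - e) := by
        rw [hsucc]; noncomm_ring
      have hqn1 : 1 - q n ∈ N := sub_mem (one_mem N) (hqN n)
      -- The removed projection lies in `F (n + 1)`, so the trace against the conditional
      -- expectation equals the trace against `f`.
      rw [(hg (n + 1)).2 _ hpM hpp.nonneg] at h4
      rw [hdec, hf.traceMul_add hqn1 (hq n).2.one_sub.nonneg (hle _ hpM) hpp.nonneg,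
        τ.re_add hqn1 (hle _ hpM), mul_add]
      exact ENNReal.ofReal_add_le.trans (add_le_add ih h4)
  have hbound : ∀ n, ENNReal.ofReal (τ.re (1 - q n)) ≤
      2 / ENNReal.ofReal s * τ.traceMul f (spectralGT f (s / 2)) := by
    intro n
    set P := 1 - q n
    set X := τ.traceMul f (spectralGT f (s / 2))
    have hPN : P ∈ N := sub_mem (one_mem N) (hqN n)
    have hP0 : 0 ≤ τ.re P := τ.re_nonneg hPN (hq n).2.one_sub.nonneg
    have h1 := (hsum n).trans (hf.traceMul_le hPN (hq n).2.one_sub (half_pos hs).le)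
    have h2 : ENNReal.ofReal (s / 2 * τ.re P) ≤ X := by
      -- Half of the left side cancels against the bounded part of f; this is legitimate in [0, ∞]
      -- because τ(P) is finite.
      have e : s * τ.re P = s / 2 * τ.re P + s / 2 * τ.re P := by ring
      rw [e, ENNReal.ofReal_add (by positivity) (by positivity)] at h1
      exact (ENNReal.add_le_add_iff_left ENNReal.ofReal_ne_top).mp h1
    have h3 : ENNReal.ofReal (τ.re P) = 2 / ENNReal.ofReal s * ENNReal.ofReal (s / 2 * τ.re P) := by
      have e2 : (2 : ℝ≥0∞) / ENNReal.ofReal s = ENNReal.ofReal (2 / s) := by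
        rw [ENNReal.ofReal_div_of_pos hs]; simp
      rw [e2, ← ENNReal.ofReal_mul (by positivity)]
      congr 1
      field_simp
    rw [h3]
    gcongr
  have hmem : proj (⨅ n, LinearMap.range (q n).toLinearMap) ∈ N := by
    refine proj_mem fun u hu x hx => ?_
    rw [Submodule.mem_iInf] at hx ⊢
    intro n
    obtain ⟨z, rfl⟩ := hx n
    exact ⟨u z, (congrArg (fun b : H →L[ℂ] H => b z)
      (commute_of_mem_commutant (hqN n) hu).eq).symm⟩
  refine ⟨hmem, ?_⟩
  have hlim := τ.tendsto_re (fun n => sub_mem (one_mem N) (hqN n)) (sub_mem (one_mem N) hmem) 1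
    (fun n => IsStarProjection.norm_le _ (hq n).2.one_sub)
    (tendsto_proj_iInf (fun n => (hq n).2) hanti)
  exact le_of_tendsto (ENNReal.tendsto_ofReal hlim) (Eventually.of_forall hbound)

/-! ### Normal positive functionals, and the functional τ(f ·). -/

/-- The real part of a positive functional on `M` that is continuous along bounded strongly
convergent sequences. -/
structure IsNormalPositive (M : VonNeumannAlgebra H) (φ : (H →L[ℂ] H) → ℝ) : Prop where
  add : ∀ {a b}, a ∈ M → b ∈ M → φ (a + b) = φ a + φ b
  smul : ∀ {a}, a ∈ M → ∀ r : ℝ, φ (r • a) = r * φ a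
  star : ∀ {a}, a ∈ M → φ (star a) = φ a
  nonneg : ∀ {a}, a ∈ M → 0 ≤ a → 0 ≤ φ a
  tendsto : ∀ {a : ℕ → H →L[ℂ] H} {b : H →L[ℂ] H}, (∀ n, a n ∈ M) → b ∈ M → ∀ C : ℝ,
    (∀ n, ‖a n‖ ≤ C) → (∀ x, Tendsto (fun n => a n x) atTop (𝓝 (b x))) →
    Tendsto (fun n => φ (a n)) atTop (𝓝 (φ b))

namespace IsNormalPositive

variable {M : VonNeumannAlgebra H} {φ : (H →L[ℂ] H) → ℝ} (hφ : IsNormalPositive M φ)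
include hφ

theorem neg {a : H →L[ℂ] H} (ha : a ∈ M) : φ (-a) = -φ a := by
  have := hφ.smul ha (-1)
  rwa [neg_one_smul, neg_one_mul] at this

theorem sub {a b : H →L[ℂ] H} (ha : a ∈ M) (hb : b ∈ M) : φ (a - b) = φ a - φ b := by
  rw [sub_eq_add_neg, hφ.add ha (neg_mem hb), hφ.neg hb, sub_eq_add_neg]

theorem zero : φ 0 = 0 := by
  have := hφ.sub (one_mem M) (one_mem M)
  rwa [sub_self, sub_self] at this

theorem mono {a b : H →L[ℂ] H} (ha : a ∈ M) (hb : b ∈ M) (h : a ≤ b) : φ a ≤ φ b := by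
  have := hφ.nonneg (sub_mem hb ha) (sub_nonneg.mpr h)
  rwa [hφ.sub hb ha, sub_nonneg] at this

theorem abs_le_of_isSelfAdjoint {a : H →L[ℂ] H} (ha : a ∈ M) (hsa : IsSelfAdjoint a) :
    |φ a| ≤ φ 1 * ‖a‖ := by
  have h1 := hφ.mono ha (smul_mem (one_mem M) ‖a‖)
    (by rw [← Algebra.algebraMap_eq_smul_one]; exact hsa.le_algebraMap_norm_self)
  have h2 := hφ.mono (smul_mem (one_mem M) (-‖a‖)) ha
    (by rw [neg_smul, ← Algebra.algebraMap_eq_smul_one]; exact hsa.neg_algebraMap_norm_le_self)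
  rw [hφ.smul (one_mem M)] at h1 h2
  rw [abs_le]
  constructor <;> linarith

/-- The value at `a` is the value at the self-adjoint part of `a`. -/
theorem eq_half_add_star {a : H →L[ℂ] H} (ha : a ∈ M) :
    φ a = φ ((1 / 2 : ℝ) • (a + Star.star a)) := by
  rw [hφ.smul (add_mem ha (star_mem ha)), hφ.add ha (star_mem ha), hφ.star ha]
  ring

theorem abs_le {a : H →L[ℂ] H} (ha : a ∈ M) : |φ a| ≤ φ 1 * ‖a‖ := by
  have hm : (1 / 2 : ℝ) • (a + Star.star a) ∈ M := smul_mem (add_mem ha (star_mem ha)) _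
  have hsa : IsSelfAdjoint ((1 / 2 : ℝ) • (a + Star.star a)) :=
    (IsSelfAdjoint.all (1 / 2 : ℝ)).smul (IsSelfAdjoint.add_star_self a)
  rw [hφ.eq_half_add_star ha]
  refine (hφ.abs_le_of_isSelfAdjoint hm hsa).trans
    (mul_le_mul_of_nonneg_left ?_ (hφ.nonneg (one_mem M) zero_le_one))
  rw [norm_smul]
  have := norm_add_le a (Star.star a)
  rw [norm_star] at this
  norm_num
  linarith

end IsNormalPositive

variable {N : VonNeumannAlgebra H} (τ : TracialState N)

/-- The trace is not assumed hermitian. Its values at A* A and at (1 + iA)*(1 + iA) are real, and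
comparing imaginary parts leaves Re τ(A) = Re τ(A*). -/
theorem TracialState.re_star {a : H →L[ℂ] H} (ha : a ∈ N) : τ.re (star a) = τ.re a := by
  let A : N.toStarSubalgebra := ⟨a, ha⟩
  have h1 := τ.nonneg' (1 + Complex.I • A)
  have e : star (1 + Complex.I • A) * (1 + Complex.I • A)
      = 1 + Complex.I • A - Complex.I • star A + star A * A := by
    apply Subtype.ext
    change star (1 + Complex.I • a) * (1 + Complex.I • a) = 1 + Complex.I • a - Complex.I • star a
      + star a * a
    rw [star_add, star_one, star_smul, RCLike.star_def, Complex.conj_I]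
    simp only [add_mul, mul_add, one_mul, mul_one, smul_mul_assoc, mul_smul_comm, smul_smul, neg_smul,
      neg_mul, smul_add, smul_neg, Complex.I_mul_I, neg_neg, one_smul]
    abel
  have h2 := τ.nonneg' A
  rw [e, map_add, map_sub, map_add, map_smul, map_smul, τ.map_one'] at h1
  have h3 := (Complex.le_def.mp h1).2
  have h4 := (Complex.le_def.mp h2).2
  rw [τ.re_of_mem ha, τ.re_of_mem (star_mem ha)]
  simp only [Complex.zero_im, Complex.add_im, Complex.sub_im, Complex.one_im, smul_eq_mul,
    Complex.I_mul_im] at h3 h4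
  rw [← h4] at h3
  have h5 : (τ.toLinearMap (star A)).re = (τ.toLinearMap A).re := by linarith
  exact h5

theorem TracialState.isNormalPositive {M : VonNeumannAlgebra H} (hM : M ≤ N) :
    IsNormalPositive M τ.re where
  add ha hb := τ.re_add (hM ha) (hM hb)
  smul ha := τ.re_smul (hM ha)
  star ha := τ.re_star (hM ha)
  nonneg ha := τ.re_nonneg (hM ha)
  tendsto ha hb := τ.tendsto_re (fun n => hM (ha n)) (hM hb)

section L1Functional

variable {f : H →ₗ.[ℂ] H} {R : H →L[ℂ] H}

/-- The functional `y ↦ Re τ(f y)` for `f ∈ L₁(N, τ)₊`. -/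
def TracialState.l1Functional (R : H →L[ℂ] H) (y : H →L[ℂ] H) : ℝ :=
  limUnder atTop fun k : ℕ => τ.re (truncOp R k * y)

theorem TracialState.abs_re_mul_le {a y : H →L[ℂ] H} (ha : a ∈ N) (hy : y ∈ N) (h0 : 0 ≤ a) :
    |τ.re (a * y)| ≤ τ.re a * ‖y‖ := by
  have hφ : IsNormalPositive N fun y => τ.re (a * y) :=
    { add := fun hb hc => by simp only [mul_add]; exact τ.re_add (mul_mem ha hb) (mul_mem ha hc)
      smul := fun hb r => by simp only [mul_smul_comm]; exact τ.re_smul (mul_mem ha hb) r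
      star := fun {b} hb => by
        rw [← τ.re_star (mul_mem ha (star_mem hb)), star_mul, star_star,
          (IsSelfAdjoint.of_nonneg h0).star_eq, τ.re_mul_comm hb ha]
      nonneg := fun hb hb0 => τ.re_mul_nonneg ha hb h0 hb0
      tendsto := fun hb hc C hC h => by
        refine τ.tendsto_re (fun n => mul_mem ha (hb n)) (mul_mem ha hc) (‖a‖ * C)
          (fun n => (norm_mul_le _ _).trans (by gcongr; exact hC n)) fun x => ?_
        exact (a.continuous.tendsto _).comp (h x) }
  have := hφ.abs_le hy
  rwa [mul_one] at this

variable (hf : τ.MemL1Pos N f) (hR : IsPosResolvent f R) (hRN : R ∈ N)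
include hf hR hRN

theorem TracialState.MemL1Pos.exists_tendsto_re_truncOp :
    ∃ T : ℝ, Tendsto (fun k : ℕ => τ.re (truncOp R k)) atTop (𝓝 T) ∧
      ∀ k : ℕ, τ.re (truncOp R k) ≤ T := by
  have hmono : Monotone fun k : ℕ => τ.re (truncOp R k) := fun k l h =>
    τ.re_mono (truncOp_mem hRN _) (truncOp_mem hRN _)
      (hR.truncOp_mono (Nat.cast_nonneg _) (Nat.cast_le.mpr h))
  have hfin := hf.trace_lt_top
  rw [hR.traceMul_eq] at hfin
  simp only [mul_one] at hfin
  have hbdd : BddAbove (Set.range fun k : ℕ => τ.re (truncOp R k)) := by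
    refine ⟨(⨆ k : ℕ, ENNReal.ofReal (τ.re (truncOp R k))).toReal, ?_⟩
    rintro _ ⟨k, rfl⟩
    rw [← ENNReal.ofReal_le_iff_le_toReal hfin.ne]
    exact le_iSup (fun k : ℕ => ENNReal.ofReal (τ.re (truncOp R k))) k
  exact ⟨_, tendsto_atTop_ciSup hmono hbdd, fun k => le_ciSup hbdd k⟩

/-- The difference of two truncations is positive, so its pairing with y is at most its trace times
‖y‖. Since τ(f) is finite, the limit is uniform on bounded sets; this is what lets normality pass
from the truncations to the limit. -/
theorem TracialState.MemL1Pos.exists_l1Functional_bound :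
    ∃ δ : ℕ → ℝ, Tendsto δ atTop (𝓝 0) ∧ ∀ y ∈ N, ∀ k : ℕ,
      |τ.l1Functional R y - τ.re (truncOp R k * y)| ≤ δ k * ‖y‖ ∧
      Tendsto (fun k : ℕ => τ.re (truncOp R k * y)) atTop (𝓝 (τ.l1Functional R y)) := by
  obtain ⟨T, hT, hTle⟩ := hf.exists_tendsto_re_truncOp τ hR hRN
  have hkN : ∀ k : ℕ, truncOp R k ∈ N := fun k => truncOp_mem hRN _
  have hdiff : ∀ y ∈ N, ∀ k l : ℕ, k ≤ l →
      |τ.re (truncOp R l * y) - τ.re (truncOp R k * y)| ≤ (T - τ.re (truncOp R k)) * ‖y‖ := by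
    intro y hy k l h
    rw [← τ.re_sub (mul_mem (hkN l) hy) (mul_mem (hkN k) hy), ← sub_mul]
    refine (τ.abs_re_mul_le (sub_mem (hkN l) (hkN k)) hy (sub_nonneg.mpr
      (hR.truncOp_mono (Nat.cast_nonneg _) (Nat.cast_le.mpr h)))).trans ?_
    rw [τ.re_sub (hkN l) (hkN k)]
    gcongr
    exact hTle l
  have hlim : ∀ y ∈ N, Tendsto (fun k : ℕ => τ.re (truncOp R k * y)) atTop
      (𝓝 (τ.l1Functional R y)) := by
    intro y hy
    have hc : CauchySeq fun k : ℕ => τ.re (truncOp R k * y) := by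
      refine cauchySeq_of_le_tendsto_0' (fun k => (T - τ.re (truncOp R k)) * ‖y‖)
        (fun k l h => ?_) ?_
      · rw [dist_comm, Real.dist_eq]
        exact hdiff y hy k l h
      · have := (hT.const_sub T).mul_const ‖y‖
        rwa [sub_self, zero_mul] at this
    exact hc.tendsto_limUnder
  refine ⟨fun k => T - τ.re (truncOp R k), ?_, fun y hy k => ⟨?_, hlim y hy⟩⟩
  · have := hT.const_sub T
    rwa [sub_self] at this
  · exact le_of_tendsto ((hlim y hy).sub_const _).abs
      ((eventually_ge_atTop k).mono fun l hl => hdiff y hy k l hl)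

theorem TracialState.MemL1Pos.tendsto_l1Functional {y : H →L[ℂ] H} (hy : y ∈ N) :
    Tendsto (fun k : ℕ => τ.re (truncOp R k * y)) atTop (𝓝 (τ.l1Functional R y)) := by
  obtain ⟨δ, -, h⟩ := hf.exists_l1Functional_bound τ hR hRN
  exact (h y hy 0).2

theorem TracialState.MemL1Pos.traceMul_eq_ofReal {y : H →L[ℂ] H} (hy : y ∈ N) (hy0 : 0 ≤ y) :
    τ.traceMul f y = ENNReal.ofReal (τ.l1Functional R y) := by
  rw [hR.traceMul_eq]
  exact iSup_eq_of_tendsto (hR.monotone_ofReal_re τ hRN hy hy0)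
    (ENNReal.tendsto_ofReal (hf.tendsto_l1Functional τ hR hRN hy))

theorem TracialState.MemL1Pos.isNormalPositive_l1Functional {M : VonNeumannAlgebra H} (hM : M ≤ N) :
    IsNormalPositive M (τ.l1Functional R) := by
  have hlim := fun {y} (hy : y ∈ M) => hf.tendsto_l1Functional τ hR hRN (hM hy)
  have hkN : ∀ k : ℕ, truncOp R k ∈ N := fun k => truncOp_mem hRN _
  have hk0 : ∀ k : ℕ, 0 ≤ truncOp R k := fun k =>
    truncOp_nonneg hR.nonneg hR.le_one (Nat.cast_nonneg _)
  refine ⟨fun {a b} ha hb => ?_, fun {a} ha r => ?_, fun {a} ha => ?_, fun {a} ha h => ?_,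
    fun {a b} ha hb C hC h => ?_⟩
  · refine tendsto_nhds_unique (hlim (add_mem ha hb)) (((hlim ha).add (hlim hb)).congr fun k => ?_)
    rw [mul_add, τ.re_add (mul_mem (hkN k) (hM ha)) (mul_mem (hkN k) (hM hb))]
  · refine tendsto_nhds_unique (hlim (smul_mem ha r)) (((hlim ha).const_mul r).congr fun k => ?_)
    rw [mul_smul_comm, τ.re_smul (mul_mem (hkN k) (hM ha))]
  · refine tendsto_nhds_unique (hlim (star_mem ha)) ((hlim ha).congr fun k => ?_)
    rw [← τ.re_star (mul_mem (hkN k) (hM ha)), star_mul, (IsSelfAdjoint.of_nonneg (hk0 k)).star_eq,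
      τ.re_mul_comm (star_mem (hM ha)) (hkN k)]
  · exact ge_of_tendsto' (hlim ha) fun k => τ.re_mul_nonneg (hkN k) (hM ha) (hk0 k) h
  · obtain ⟨δ, hδ, hb'⟩ := hf.exists_l1Functional_bound τ hR hRN
    have hC0 : 0 ≤ C := (norm_nonneg _).trans (hC 0)
    rw [Metric.tendsto_atTop]
    intro ε hε
    have hδ' : Tendsto (fun k => δ k * C + δ k * ‖b‖) atTop (𝓝 0) := by
      have := (hδ.mul_const C).add (hδ.mul_const ‖b‖)
      simpa using this
    obtain ⟨k, hk, hk0'⟩ := ((hδ'.eventually_lt_const (half_pos hε)).and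
      (Eventually.of_forall fun k => (abs_nonneg _).trans (hb' 1 (one_mem N) k).1)).exists
    have hδk : ∀ n, δ k * ‖a n‖ ≤ δ k * C := fun n => by
      have h1 : 0 ≤ δ k * ‖(1 : H →L[ℂ] H)‖ := hk0'
      -- The bound at y = 1 shows δ k ≥ 0 as soon as ‖1‖ ≠ 0; if ‖1‖ = 0 then H is trivial, against
      -- τ(1) = 1.
      rcases (norm_nonneg (1 : H →L[ℂ] H)).eq_or_lt with h0 | h0
      · have : ∀ x : H →L[ℂ] H, x = 0 := fun x => by
          rw [← mul_one x, norm_eq_zero.mp h0.symm, mul_zero]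
        have h2 := τ.re_one
        rw [this 1] at h2
        have h3 := τ.re_smul (zero_mem N) 0
        rw [zero_smul, zero_mul, h2] at h3
        exact absurd h3 one_ne_zero
      · exact mul_le_mul_of_nonneg_left (hC n) (nonneg_of_mul_nonneg_left h1 h0)
    have hconv : Tendsto (fun n => τ.re (truncOp R k * a n)) atTop (𝓝 (τ.re (truncOp R k * b))) := by
      refine τ.tendsto_re (fun n => mul_mem (hkN k) (hM (ha n))) (mul_mem (hkN k) (hM hb))
        (‖truncOp R k‖ * C) (fun n => (norm_mul_le _ _).trans (by gcongr; exact hC n)) fun x => ?_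
      exact ((truncOp R k).continuous.tendsto _).comp (h x)
    obtain ⟨n₀, hn₀⟩ := Metric.tendsto_atTop.mp hconv (ε / 2) (half_pos hε)
    refine ⟨n₀, fun n hn => ?_⟩
    have h1 := (hb' (a n) (hM (ha n)) k).1
    have h2 := (hb' b (hM hb) k).1
    have h3 := hn₀ n hn
    have h4 := hδk n
    rw [Real.dist_eq, abs_lt] at h3 ⊢
    rw [_root_.abs_le] at h1 h2
    constructor <;> linarith

end L1Functional

/-! ### Subadditivity of the trace on joins of projections. -/

section Sup

variable {N : VonNeumannAlgebra H} (τ : TracialState N)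

/-- `U` is invariant under the commutant of `N`. -/
def InvariantUnder (N : VonNeumannAlgebra H) (U : Submodule ℂ H) : Prop :=
  ∀ u ∈ N.commutant, ∀ x ∈ U, u x ∈ U

theorem InvariantUnder.iSup {ι : Sort*} {V : ι → Submodule ℂ H} (h : ∀ i, InvariantUnder N (V i)) :
    InvariantUnder N (⨆ i, V i) := fun u hu => by
  have hle : (⨆ i, V i) ≤ (⨆ i, V i).comap u.toLinearMap :=
    iSup_le fun i x hx => (le_iSup V i) (h i u hu x hx)
  exact fun x hx => hle hx

theorem InvariantUnder.sup {U V : Submodule ℂ H} (hU : InvariantUnder N U)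
    (hV : InvariantUnder N V) : InvariantUnder N (U ⊔ V) := fun u hu => by
  have hle : U ⊔ V ≤ (U ⊔ V).comap u.toLinearMap :=
    sup_le (fun x hx => (le_sup_left : U ≤ U ⊔ V) (hU u hu x hx))
      (fun x hx => (le_sup_right : V ≤ U ⊔ V) (hV u hu x hx))
  exact fun x hx => hle hx

theorem InvariantUnder.topologicalClosure {U : Submodule ℂ H} (hU : InvariantUnder N U) :
    InvariantUnder N U.topologicalClosure := fun u hu => by
  have hle : U.topologicalClosure ≤ U.topologicalClosure.comap u.toLinearMap :=
    Submodule.topologicalClosure_minimal _ (fun x hx => U.le_topologicalClosure (hU u hu x hx))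
      (U.isClosed_topologicalClosure.preimage u.continuous)
  exact fun x hx => hle hx

theorem invariantUnder_range {a : H →L[ℂ] H} (ha : a ∈ N) :
    InvariantUnder N (LinearMap.range a.toLinearMap) := by
  rintro u hu _ ⟨z, rfl⟩
  exact ⟨u z, (congrArg (fun b : H →L[ℂ] H => b z) (commute_of_mem_commutant ha hu).eq).symm⟩

/-- The join is at most proj U + W, where W is the range projection of (1 - proj U) proj V, whose
trace is at most τ(proj V). -/
theorem TracialState.re_proj_sup_le {U V : Submodule ℂ H} (hU : InvariantUnder N U)
    (hV : InvariantUnder N V) : τ.re (proj (U ⊔ V)) ≤ τ.re (proj U) + τ.re (proj V) := by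
  have hUN : proj U ∈ N := proj_mem hU
  have hVN : proj V ∈ N := proj_mem hV
  have hU' := isStarProjection_proj U
  have hV' := isStarProjection_proj V
  set a := (1 - proj U) * proj V with ha
  have haN : a ∈ N := mul_mem (sub_mem (one_mem N) hUN) hVN
  set W := proj (LinearMap.range a.toLinearMap)
  have hWN : W ∈ N := proj_range_mem haN
  have hW : IsStarProjection W := isStarProjection_proj _
  have h1 : proj U * W = 0 := by
    refine mul_proj_eq_zero ?_
    rintro _ ⟨z, rfl⟩
    exact congrArg (fun b : H →L[ℂ] H => b (proj V z)) hU'.mul_one_sub_self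
  have h2 : W * proj U = 0 := by
    simpa [hU'.isSelfAdjoint.star_eq, hW.isSelfAdjoint.star_eq] using congrArg star h1
  have hS : IsStarProjection (proj U + W) := hU'.add hW h1
  have hle : proj (U ⊔ V) ≤ proj U + W := by
    refine (isStarProjection_proj _).le_of_mul_eq_right hS (mul_eq_of_proj_le ?_)
    have hsub : U ⊔ V ≤ LinearMap.ker (proj U + W - 1).toLinearMap := by
      refine sup_le (fun y hy => ?_) fun y hy => ?_
      · change (proj U + W - 1) y = 0
        have h3 : W (proj U y) = 0 := congrArg (fun b : H →L[ℂ] H => b y) h2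
        rw [proj_apply_of_mem hy] at h3
        rw [sub_apply, add_apply, h3, proj_apply_of_mem hy, one_apply_eq_self, add_zero, sub_self]
      · change (proj U + W - 1) y = 0
        have h3 : W (proj U y) = 0 := congrArg (fun b : H →L[ℂ] H => b y) h2
        have h4 : W (a y) = a y := proj_apply_of_mem ⟨y, rfl⟩
        have h5 : a y = y - proj U y := by
          rw [ha, mul_apply_eq_comp, proj_apply_of_mem hy, sub_apply, one_apply_eq_self]
        rw [h5, map_sub, h3, sub_zero] at h4
        rw [sub_apply, add_apply, h4, one_apply_eq_self]
        abel
    intro y hy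
    have : (proj U + W - 1) y = 0 := hsub hy
    rwa [sub_apply, one_apply_eq_self, sub_eq_zero] at this
  refine (τ.re_mono (proj_mem (hU.sup hV)) (add_mem hUN hWN) hle).trans ?_
  rw [τ.re_add hUN hWN]
  gcongr
  exact τ.re_proj_range_le haN hVN hV' (by rw [ha, mul_assoc, hV'.isIdempotentElem.eq])

theorem TracialState.re_proj_iSup_le {V : ℕ → Submodule ℂ H} (hV : ∀ n, InvariantUnder N (V n))
    {c : ℝ} (hc : ∀ n, ∑ i ∈ Finset.range n, τ.re (proj (V i)) ≤ c) :
    τ.re (proj (⨆ n, V n)) ≤ c := by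
  have hps : ∀ n, InvariantUnder N (partialSups V n) ∧
      τ.re (proj (partialSups V n)) ≤ ∑ i ∈ Finset.range (n + 1), τ.re (proj (V i)) := by
    intro n
    induction n with
    | zero => simpa using hV 0
    | succ n ih =>
      rw [partialSups_add_one, Finset.sum_range_succ]
      exact ⟨ih.1.sup (hV _), (τ.re_proj_sup_le ih.1 (hV _)).trans (by gcongr; exact ih.2)⟩
  let U : ℕ → Submodule ℂ H := fun n => (partialSups V n).topologicalClosure
  have hmono : Monotone U := fun m n h =>
    Submodule.topologicalClosure_mono ((partialSups V).monotone h)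
  have hUinv : InvariantUnder N (⨆ n, U n) := .iSup fun n => (hps n).1.topologicalClosure
  have hle : (⨆ n, V n) ≤ ⨆ n, U n := iSup_mono fun n =>
    (le_partialSups V n).trans (Submodule.le_topologicalClosure _)
  refine (τ.re_mono (proj_mem (InvariantUnder.iSup hV)) (proj_mem hUinv) (proj_mono hle)).trans ?_
  have hlim := τ.tendsto_re (a := fun n => proj (partialSups V n)) (fun n => proj_mem (hps n).1)
    (proj_mem hUinv) 1 (fun n => IsStarProjection.norm_le _ (isStarProjection_proj _))
    (Submodule.starProjection_tendsto_closure_iSup U hmono)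
  exact le_of_tendsto' hlim fun n => (hps n).2.trans (hc _)

end Sup

/-! ### Bounded sets are complete for the norm τ(x²)^{1/2}. -/

section Complete

variable {N : VonNeumannAlgebra H} (τ : TracialState N)

/-- Chebyshev's inequality for the spectral projection `1_{(c,∞)}(d²)`. -/
theorem TracialState.chebyshev {d : H →L[ℂ] H} (hd : d ∈ N) (hsa : IsSelfAdjoint d) (c : ℝ) :
    c * τ.re (proj (LinearMap.range (cfc (fun r : ℝ => max (r * r - c) 0) d).toLinearMap))
      ≤ τ.re (d * d) ∧
    ∀ y, cfc (fun r : ℝ => max (r * r - c) 0) d y = 0 → ‖d y‖ ^ 2 ≤ c * ‖y‖ ^ 2 := by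
  set b := cfc (fun r : ℝ => max (r * r - c) 0) d with hb
  set b' := cfc (fun r : ℝ => max (c - r * r) 0) d with hb'
  have hbN : b ∈ N := cfc_mem hd _
  have hb0 : 0 ≤ b := cfc_nonneg fun r _ => le_max_right _ _
  have hb0' : 0 ≤ b' := cfc_nonneg fun r _ => le_max_right _ _
  have hbb : b' * b = 0 := by
    rw [hb, hb', ← cfc_mul _ _ d (by fun_prop) (by fun_prop), ← cfc_zero ℝ d]
    refine cfc_congr fun r _ => ?_
    rcases le_total (r * r) c with h | h
    · simp [max_eq_right (sub_nonpos.mpr h)]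
    · simp [max_eq_right (sub_nonpos.mpr h)]
  -- Positive and negative parts of d² - c: the first controls the trace of the exceptional
  -- projection, the second gives the bound off it.
  have hdd : d * d - c • 1 = b - b' := by
    have e1 : d * d - c • 1 = cfc (fun r : ℝ => r * r - c) d := by
      rw [cfc_sub (fun r : ℝ => r * r) (fun _ : ℝ => c) d (by fun_prop) (by fun_prop),
        cfc_mul (fun r : ℝ => r) (fun r : ℝ => r) d continuousOn_id continuousOn_id, cfc_id' ℝ d,
        cfc_const c d, Algebra.algebraMap_eq_smul_one]
    rw [e1, hb, hb', ← cfc_sub _ _ d (by fun_prop) (by fun_prop)]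
    refine cfc_congr fun r _ => ?_
    rcases le_total (r * r) c with h | h
    · simp only [max_eq_right (sub_nonpos.mpr h), max_eq_left (sub_nonneg.mpr h)]; ring
    · simp only [max_eq_right (sub_nonpos.mpr h), max_eq_left (sub_nonneg.mpr h)]; ring
  constructor
  · set P := proj (LinearMap.range b.toLinearMap) with hPdef
    have hP : IsStarProjection P := isStarProjection_proj _
    have hPN : P ∈ N := proj_range_mem hbN
    have h1 : b' * P = 0 := by
      refine mul_proj_eq_zero ?_
      rintro _ ⟨z, rfl⟩
      exact congrArg (fun b : H →L[ℂ] H => b z) hbb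
    have h2 : b * P = b := by
      have h : P * b = b := by ext z; exact proj_apply_of_mem ⟨z, rfl⟩
      simpa [hP.isSelfAdjoint.star_eq, (IsSelfAdjoint.of_nonneg hb0).star_eq] using congrArg star h
    have h3 : d * d * P - c • P = b := by
      have := congrArg (· * P) hdd
      simpa only [sub_mul, smul_mul_assoc, one_mul, h1, h2, sub_zero] using this
    have hddN : d * d ∈ N := mul_mem hd hd
    have h4 := τ.re_nonneg hbN hb0
    rw [← h3, τ.re_sub (mul_mem hddN hPN) (smul_mem hPN c), τ.re_smul hPN] at h4
    have hdd0 : 0 ≤ d * d := by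
      have := star_mul_self_nonneg d
      rwa [hsa.star_eq] at this
    have h5 := τ.re_mul_mono_right hPN (one_mem N) hddN hP.le_one hdd0
    rw [mul_one] at h5
    linarith
  · intro y hy
    have h1 := congrArg (fun a : H →L[ℂ] H => (inner ℂ (a y) y).re) hdd
    have h2 : 0 ≤ (inner ℂ (b' y) y).re :=
      ((ContinuousLinearMap.nonneg_iff_isPositive _).mp hb0').re_inner_nonneg_left y
    have h3 : inner ℂ (d (d y)) y = inner ℂ (d y) (d y) := by
      have := ContinuousLinearMap.adjoint_inner_left d y (d y)
      rwa [← ContinuousLinearMap.star_eq_adjoint, hsa.star_eq] at this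
    simp only [sub_apply, mul_apply_eq_comp, hy, zero_sub, inner_sub_left, inner_neg_left, h3,
      Complex.sub_re, Complex.neg_re, smul_apply, one_apply_eq_self] at h1
    rw [← Complex.coe_smul, inner_smul_left, Complex.conj_ofReal, Complex.re_ofReal_mul,
      inner_self_eq_norm_sq_to_K, inner_self_eq_norm_sq_to_K] at h1
    have h4 : ∀ t : ℝ, ((RCLike.ofReal (K := ℂ) t) ^ 2).re = t ^ 2 := fun t => by norm_cast
    rw [h4, h4] at h1
    linarith

omit [CompleteSpace H] in
theorem cauchySeq_of_dense {x : ℕ → H →L[ℂ] H} {C : ℝ} (hC : ∀ n, ‖x n‖ ≤ C) {D : Set H}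
    (hD : Dense D) (h : ∀ y ∈ D, CauchySeq fun n => x n y) (y : H) : CauchySeq fun n => x n y := by
  have hC0 : 0 ≤ C := (norm_nonneg _).trans (hC 0)
  rw [Metric.cauchySeq_iff]
  intro ε hε
  obtain ⟨z, hz, hyz⟩ := hD.exists_dist_lt y (show 0 < ε / 3 / (C + 1) by positivity)
  obtain ⟨n₀, hn₀⟩ := Metric.cauchySeq_iff.mp (h z hz) (ε / 3) (by positivity)
  refine ⟨n₀, fun m hm n hn => ?_⟩
  have hb : ∀ n, dist (x n y) (x n z) < ε / 3 := fun n => by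
    rw [dist_eq_norm, ← map_sub]
    rw [dist_eq_norm, lt_div_iff₀ (by positivity)] at hyz
    have := (x n).le_opNorm (y - z)
    nlinarith [hC n, norm_nonneg (y - z)]
  have h1 := hb m
  have h2 := hb n
  have h3 := hn₀ m hm n hn
  have h4 := dist_triangle4 (x m y) (x m z) (x n z) (x n y)
  rw [dist_comm (x n z)] at h4
  linarith

/-- Bounded sequences that converge fast for the trace norm `τ(x²)` converge strongly. -/
theorem TracialState.exists_tendsto {M : VonNeumannAlgebra H} (hM : M ≤ N) {x : ℕ → H →L[ℂ] H}
    (hx : ∀ n, x n ∈ M) (hsa : ∀ n, IsSelfAdjoint (x n)) {C : ℝ} (hC : ∀ n, ‖x n‖ ≤ C)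
    (h : ∀ n, τ.re ((x (n + 1) - x n) * (x (n + 1) - x n)) ≤ (1 / 8) ^ n) :
    ∃ a ∈ M, ∀ y, Tendsto (fun n => x n y) atTop (𝓝 (a y)) := by
  set d : ℕ → H →L[ℂ] H := fun n => x (n + 1) - x n with hd
  have hdN : ∀ n, d n ∈ N := fun n => sub_mem (hM (hx _)) (hM (hx _))
  have hdsa : ∀ n, IsSelfAdjoint (d n) := fun n => (hsa _).sub (hsa _)
  -- Threshold 4⁻ⁿ against the bound 8⁻ⁿ: the exceptional projection has trace at most 2⁻ⁿ, and off
  -- it ‖d_n y‖ ≤ 2⁻ⁿ‖y‖. Both series converge.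
  let b : ℕ → H →L[ℂ] H := fun n => cfc (fun r : ℝ => max (r * r - (1 / 4) ^ n) 0) (d n)
  have hbN : ∀ n, b n ∈ N := fun n => cfc_mem (hdN n) _
  have hbsa : ∀ n, IsSelfAdjoint (b n) := fun n =>
    IsSelfAdjoint.of_nonneg (cfc_nonneg fun r _ => le_max_right _ _)
  let V : ℕ → Submodule ℂ H := fun n => LinearMap.range (b n).toLinearMap
  have hVinv : ∀ n, InvariantUnder N (V n) := fun n => invariantUnder_range (hbN n)
  have hVτ : ∀ n, τ.re (proj (V n)) ≤ (1 / 2) ^ n := fun n => by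
    have h1 := ((τ.chebyshev (hdN n) (hdsa n) ((1 / 4) ^ n)).1).trans (h n)
    have h2 : (1 / 8 : ℝ) ^ n = (1 / 4) ^ n * (1 / 2) ^ n := by rw [← mul_pow]; norm_num
    rw [h2] at h1
    exact le_of_mul_le_mul_left h1 (by positivity)
  -- The vectors of convergence are invariant under the commutant. They contain every vector
  -- orthogonal to all exceptional ranges from index m on, so the projection has trace at least 1 -
  -- 2·2⁻ᵐ for every m.
  let D : Submodule ℂ H :=
    { carrier := {y | CauchySeq fun n => x n y}
      add_mem' := fun {y z} hy hz => by
        simp only [Set.mem_ofPred_eq, map_add] at hy hz ⊢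
        exact hy.add hz
      zero_mem' := by
        simp only [Set.mem_ofPred_eq, map_zero]
        exact cauchySeq_const 0
      smul_mem' := fun r y hy => by
        simp only [Set.mem_ofPred_eq, map_smul] at hy ⊢
        exact (uniformContinuous_const_smul r).comp_cauchySeq hy }
  have hDinv : InvariantUnder N D := fun u hu y hy => by
    have hy' : CauchySeq fun n => x n y := hy
    have h1 : CauchySeq fun n => u (x n y) := u.uniformContinuous.comp_cauchySeq hy'
    have h2 : ∀ n, u (x n y) = x n (u y) := fun n =>
      congrArg (fun b : H →L[ℂ] H => b y) (commute_of_mem_commutant (hM (hx n)) hu).eq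
    simp only [h2] at h1
    exact h1
  have hdense : Dense (D : Set H) := by
    refine dense_of_proj_eq_one (τ.eq_one_of_one_le_re (proj_mem hDinv) (isStarProjection_proj _) ?_)
    have hm : ∀ m : ℕ, 1 - 2 * (1 / 2 : ℝ) ^ m ≤ τ.re (proj D) := by
      intro m
      set P := proj (⨆ n, V (n + m)) with hP
      have hPp : IsStarProjection P := isStarProjection_proj _
      have hPN : P ∈ N := proj_mem (InvariantUnder.iSup fun n => hVinv (n + m))
      have hPτ : τ.re P ≤ 2 * (1 / 2 : ℝ) ^ m := by
        refine τ.re_proj_iSup_le (fun n => hVinv (n + m)) fun n => ?_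
        refine (Finset.sum_le_sum fun i _ => hVτ (i + m)).trans ?_
        simp only [pow_add, ← Finset.sum_mul]
        gcongr
        have := Summable.sum_le_tsum (Finset.range n) (fun i _ => by positivity)
          summable_geometric_two
        rwa [tsum_geometric_two] at this
      have hle : 1 - P ≤ proj D := by
        refine hPp.one_sub.le_of_mul_eq_right (isStarProjection_proj D) ?_
        ext z
        refine proj_apply_of_mem ?_
        set y := (1 - P) z
        have hby : ∀ n, b (n + m) y = 0 := fun n => by
          have h1 : P * b (n + m) = b (n + m) := by
            ext v; exact proj_apply_of_mem ((le_iSup (fun n => V (n + m)) n) ⟨v, rfl⟩)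
          have h2 := congrArg star h1
          rw [star_mul, hPp.isSelfAdjoint.star_eq, (hbsa _).star_eq] at h2
          have h3 : b (n + m) * (1 - P) = 0 := by rw [mul_sub, mul_one, h2, sub_self]
          exact congrArg (fun b : H →L[ℂ] H => b z) h3
        have hdy : ∀ n, dist (x (n + m) y) (x (n + 1 + m) y) ≤ ‖y‖ * (1 / 2) ^ n := fun n => by
          have h1 := (τ.chebyshev (hdN (n + m)) (hdsa (n + m)) ((1 / 4) ^ (n + m))).2 y (hby n)
          have h2 : ((1 / 4 : ℝ)) ^ (n + m) ≤ ((1 / 2) ^ n) ^ 2 := by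
            rw [← pow_mul, mul_comm, pow_mul]
            norm_num
            exact pow_le_pow_of_le_one (by norm_num) (by norm_num) (Nat.le_add_right n m)
          have h3 : ‖d (n + m) y‖ ^ 2 ≤ (‖y‖ * (1 / 2) ^ n) ^ 2 := by
            rw [mul_pow, mul_comm (‖y‖ ^ 2)]
            exact h1.trans (by gcongr)
          have h4 := le_of_sq_le_sq h3 (by positivity)
          rw [dist_comm, dist_eq_norm, add_right_comm]
          exact h4
        have hc : CauchySeq fun n => x (n + m) y :=
          cauchySeq_of_le_geometric (1 / 2) ‖y‖ (by norm_num) hdy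
        exact (cauchySeq_shift m).mp hc
      have h1 := τ.re_mono (sub_mem (one_mem N) hPN) (proj_mem hDinv) hle
      rw [τ.re_sub (one_mem N) hPN, τ.re_one] at h1
      linarith
    have hlim : Tendsto (fun m : ℕ => 1 - 2 * (1 / 2 : ℝ) ^ m) atTop (𝓝 1) := by
      have := ((tendsto_pow_atTop_nhds_zero_of_lt_one (r := (1 / 2 : ℝ)) (by norm_num)
        (by norm_num)).const_mul 2).const_sub 1
      simpa using this
    exact le_of_tendsto' hlim hm
  have hlim : ∀ y, ∃ z, Tendsto (fun n => x n y) atTop (𝓝 z) := fun y =>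
    cauchySeq_tendsto_of_complete (cauchySeq_of_dense hC hdense (fun y hy => hy) y)
  choose l hl using hlim
  let a : H →L[ℂ] H := continuousLinearMapOfTendsto (σ₁₂ := RingHom.id ℂ) x (tendsto_pi_nhds.mpr hl)
  have ha : ∀ y, a y = l y := fun _ => rfl
  refine ⟨a, mem_of_forall_commute fun u hu => ?_, hl⟩
  ext y
  have h1 : Tendsto (fun n => u (x n y)) atTop (𝓝 (u (a y))) := (u.continuous.tendsto _).comp (hl y)
  refine tendsto_nhds_unique h1 ((hl (u y)).congr fun n => ?_)
  exact (congrArg (fun b : H →L[ℂ] H => b y) (commute_of_mem_commutant (hx n) hu).eq).symm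

end Complete

omit [CompleteSpace H] in
theorem nonneg_of_tendsto {x : ℕ → H →L[ℂ] H} {a : H →L[ℂ] H} (hx : ∀ n, 0 ≤ x n)
    (h : ∀ y, Tendsto (fun n => x n y) atTop (𝓝 (a y))) : 0 ≤ a := by
  have hp := fun n => (ContinuousLinearMap.nonneg_iff_isPositive _).mp (hx n)
  rw [ContinuousLinearMap.nonneg_iff_isPositive]
  refine ⟨fun y z => ?_, fun y => ?_⟩
  · exact tendsto_nhds_unique ((h y).inner tendsto_const_nhds)
      ((tendsto_const_nhds.inner (h z)).congr fun n => ((hp n).inner_left_eq_inner_right y z).symm)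
  · have h1 : Tendsto (fun n => (inner ℂ (x n y) y).re) atTop (𝓝 (inner ℂ (a y) y).re) :=
      (Complex.continuous_re.tendsto _).comp ((h y).inner tendsto_const_nhds)
    exact ge_of_tendsto' h1 fun n => (hp n).re_inner_nonneg_left y

omit [CompleteSpace H] in
theorem tendsto_mul_apply {a b : ℕ → H →L[ℂ] H} {a' b' : H →L[ℂ] H} {C : ℝ} (hC : ∀ n, ‖a n‖ ≤ C)
    (ha : ∀ y, Tendsto (fun n => a n y) atTop (𝓝 (a' y)))
    (hb : ∀ y, Tendsto (fun n => b n y) atTop (𝓝 (b' y))) (y : H) :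
    Tendsto (fun n => (a n * b n) y) atTop (𝓝 ((a' * b') y)) := by
  have h1 : Tendsto (fun n => a n (b n y - b' y)) atTop (𝓝 0) := by
    have h2 : Tendsto (fun n => C * ‖b n y - b' y‖) atTop (𝓝 0) := by
      have := (tendsto_iff_norm_sub_tendsto_zero.mp (hb y)).const_mul C
      rwa [mul_zero] at this
    exact squeeze_zero_norm (fun n => ((a n).le_opNorm _).trans (by gcongr; exact hC n)) h2
  have h3 := h1.add (ha (b' y))
  rw [zero_add] at h3
  refine h3.congr fun n => ?_
  rw [map_sub, sub_add_cancel, mul_apply_eq_comp]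

/-! ### Minimising the energy over an order interval. -/

section Minimize

variable {N M : VonNeumannAlgebra H} (τ : TracialState N) {φ : (H →L[ℂ] H) → ℝ}

/-- The functional `x ↦ τ((1 - x)²) + φ(x²)`, minimised by `(1 + g)⁻¹` when `φ = τ(g ·)`. -/
def TracialState.energy (φ : (H →L[ℂ] H) → ℝ) (x : H →L[ℂ] H) : ℝ :=
  τ.re ((1 - x) * (1 - x)) + φ (x * x)

/-- The derivative of `energy` at `x` in the direction `d`. -/
def TracialState.energyDeriv (φ : (H →L[ℂ] H) → ℝ) (x d : H →L[ℂ] H) : ℝ :=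
  τ.re ((x - 1) * d + d * (x - 1)) + φ (x * d + d * x)

/-- The elements `x` of `M` with `0 ≤ x ≤ 2`. -/
def orderInterval (M : VonNeumannAlgebra H) : Set (H →L[ℂ] H) :=
  {x | x ∈ M ∧ 0 ≤ x ∧ x ≤ (2 : ℝ) • 1}

theorem convex_orderInterval (M : VonNeumannAlgebra H) {x d : H →L[ℂ] H} (hx : x ∈ orderInterval M)
    (hd : x + d ∈ orderInterval M) {r : ℝ} (h0 : 0 ≤ r) (h1 : r ≤ 1) :
    x + r • d ∈ orderInterval M := by
  have e : x + r • d = (1 - r) • x + r • (x + d) := by module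
  have h1' : 0 ≤ 1 - r := sub_nonneg.mpr h1
  rw [e]
  refine ⟨add_mem (smul_mem hx.1 _) (smul_mem hd.1 _),
    add_nonneg (smul_nonneg h1' hx.2.1) (smul_nonneg h0 hd.2.1), ?_⟩
  have e2 : (2 : ℝ) • (1 : H →L[ℂ] H) = (1 - r) • ((2 : ℝ) • 1) + r • ((2 : ℝ) • 1) := by module
  rw [e2]
  exact add_le_add (smul_le_smul_of_nonneg_left hx.2.2 h1') (smul_le_smul_of_nonneg_left hd.2.2 h0)

theorem norm_le_of_mem_orderInterval {x : H →L[ℂ] H} (hx : x ∈ orderInterval M) : ‖x‖ ≤ 2 :=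
  (CStarAlgebra.norm_le_iff_le_algebraMap x (by norm_num) hx.2.1).mpr
    (by rw [Algebra.algebraMap_eq_smul_one]; exact hx.2.2)

variable (hM : M ≤ N) (hφ : IsNormalPositive M φ)
include hM hφ

theorem TracialState.energy_add_smul {x d : H →L[ℂ] H} (hx : x ∈ M) (hd : d ∈ M) (r : ℝ) :
    τ.energy φ (x + r • d) = τ.energy φ x + r * τ.energyDeriv φ x d
      + r ^ 2 * (τ.re (d * d) + φ (d * d)) := by
  have hτ := τ.isNormalPositive hM
  have h1 : 1 - x ∈ M := sub_mem (one_mem M) hx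
  have h2 : x - 1 ∈ M := sub_mem hx (one_mem M)
  have hdd : d * d ∈ M := mul_mem hd hd
  have hL : (x - 1) * d + d * (x - 1) ∈ M := add_mem (mul_mem h2 hd) (mul_mem hd h2)
  have hL' : x * d + d * x ∈ M := add_mem (mul_mem hx hd) (mul_mem hd hx)
  have e1 : (1 - (x + r • d)) * (1 - (x + r • d)) = (1 - x) * (1 - x)
      + r • ((x - 1) * d + d * (x - 1)) + (r ^ 2) • (d * d) := by
    simp only [sub_mul, mul_sub, add_mul, mul_add, smul_mul_assoc, mul_smul_comm, one_mul, mul_one]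
    module
  have e2 : (x + r • d) * (x + r • d) = x * x + r • (x * d + d * x) + (r ^ 2) • (d * d) := by
    simp only [add_mul, mul_add, smul_mul_assoc, mul_smul_comm]
    module
  rw [energy, energy, energyDeriv, e1, e2,
    hτ.add (add_mem (mul_mem h1 h1) (smul_mem hL r)) (smul_mem hdd _),
    hτ.add (mul_mem h1 h1) (smul_mem hL r), hτ.smul hL, hτ.smul hdd,
    hφ.add (add_mem (mul_mem hx hx) (smul_mem hL' r)) (smul_mem hdd _),
    hφ.add (mul_mem hx hx) (smul_mem hL' r), hφ.smul hL', hφ.smul hdd]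
  ring

theorem TracialState.energy_nonneg {x : H →L[ℂ] H} (hx : x ∈ orderInterval M) :
    0 ≤ τ.energy φ x := by
  have h1 : IsSelfAdjoint x := IsSelfAdjoint.of_nonneg hx.2.1
  have h2 := star_mul_self_nonneg x
  have h3 := star_mul_self_nonneg (1 - x)
  rw [h1.star_eq] at h2
  rw [((IsSelfAdjoint.one _).sub h1).star_eq] at h3
  have h4 : 1 - x ∈ M := sub_mem (one_mem M) hx.1
  exact add_nonneg (τ.re_nonneg (hM (mul_mem h4 h4)) h3) (hφ.nonneg (mul_mem hx.1 hx.1) h2)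

/-- The energy is quadratic with second-order term at least τ(d²), so near-minimisers are close in
the trace norm. A minimising sequence therefore converges strongly, and the energy is continuous
along bounded strong limits. -/
theorem TracialState.exists_min_energy :
    ∃ a ∈ orderInterval M, ∀ y ∈ orderInterval M, τ.energy φ a ≤ τ.energy φ y := by
  have hτ := τ.isNormalPositive hM
  set S := τ.energy φ '' orderInterval M
  have h0 : (0 : H →L[ℂ] H) ∈ orderInterval M :=
    ⟨zero_mem M, le_rfl, smul_nonneg (by norm_num) zero_le_one⟩
  have hne : S.Nonempty := ⟨_, 0, h0, rfl⟩
  have hbdd : BddBelow S := ⟨0, by rintro _ ⟨x, hx, rfl⟩; exact τ.energy_nonneg hM hφ hx⟩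
  have hex : ∀ n : ℕ, ∃ x ∈ orderInterval M, τ.energy φ x < sInf S + (1 / 8) ^ n / 8 := fun n => by
    obtain ⟨_, ⟨x, hx, rfl⟩, hlt⟩ := exists_lt_of_csInf_lt hne
      (lt_add_of_pos_right (sInf S) (show (0 : ℝ) < (1 / 8) ^ n / 8 by positivity))
    exact ⟨x, hx, hlt⟩
  choose x hx hlt using hex
  have hsa : ∀ n, IsSelfAdjoint (x n) := fun n => IsSelfAdjoint.of_nonneg (hx n).2.1
  have hC : ∀ n, ‖x n‖ ≤ 2 := fun n => norm_le_of_mem_orderInterval (hx n)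
  have hcauchy : ∀ n, τ.re ((x (n + 1) - x n) * (x (n + 1) - x n)) ≤ (1 / 8) ^ n := by
    intro n
    -- Parallelogram law: the energy at the midpoint is the mean of the energies at the ends minus a
    -- quarter of the quadratic term of d, and it cannot fall below the infimum.
    set d := x (n + 1) - x n with hd
    have hdM : d ∈ M := sub_mem (hx _).1 (hx _).1
    have hxd : x n + d = x (n + 1) := add_sub_cancel _ _
    have h1 := τ.energy_add_smul hM hφ (hx n).1 hdM (1 / 2)
    have h2 := τ.energy_add_smul hM hφ (hx n).1 hdM 1
    rw [one_smul, hxd] at h2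
    have hmid : x n + (1 / 2 : ℝ) • d ∈ orderInterval M :=
      convex_orderInterval M (hx n) (hxd ▸ hx (n + 1)) (by norm_num) (by norm_num)
    have h3 : sInf S ≤ τ.energy φ (x n + (1 / 2 : ℝ) • d) := csInf_le hbdd ⟨_, hmid, rfl⟩
    have h4 := hlt n
    have h5 := hlt (n + 1)
    have h6 : (1 / 8 : ℝ) ^ (n + 1) ≤ (1 / 8) ^ n :=
      pow_le_pow_of_le_one (by norm_num) (by norm_num) n.le_succ
    have hdsa : IsSelfAdjoint d := (hsa _).sub (hsa _)
    have h7 : 0 ≤ φ (d * d) := hφ.nonneg (mul_mem hdM hdM) (by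
      have := star_mul_self_nonneg d
      rwa [hdsa.star_eq] at this)
    have h8 : (0 : ℝ) ≤ (1 / 8) ^ n := by positivity
    linarith
  obtain ⟨a, haM, ha⟩ := τ.exists_tendsto hM (fun n => (hx n).1) hsa hC hcauchy
  have ha0 : 0 ≤ a := nonneg_of_tendsto (fun n => (hx n).2.1) ha
  have ha2 : a ≤ (2 : ℝ) • 1 := by
    rw [← sub_nonneg]
    refine nonneg_of_tendsto (x := fun n => (2 : ℝ) • 1 - x n)
      (fun n => sub_nonneg.mpr (hx n).2.2) fun y => ?_
    exact (ha y).const_sub _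
  refine ⟨a, ⟨haM, ha0, ha2⟩, fun y hy => ?_⟩
  have h1M : ∀ n, 1 - x n ∈ M := fun n => sub_mem (one_mem M) (hx n).1
  have h1C : ∀ n, ‖1 - x n‖ ≤ 1 + 2 := fun n =>
    (norm_sub_le _ _).trans (add_le_add ContinuousLinearMap.norm_id_le (hC n))
  have h1a : ∀ y, Tendsto (fun n => (1 - x n) y) atTop (𝓝 ((1 - a) y)) := fun y => (ha y).const_sub _
  have hlim : Tendsto (fun n => τ.energy φ (x n)) atTop (𝓝 (τ.energy φ a)) := by
    refine Tendsto.add ?_ ?_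
    · exact hτ.tendsto (fun n => mul_mem (h1M n) (h1M n))
        (mul_mem (sub_mem (one_mem M) haM) (sub_mem (one_mem M) haM)) ((1 + 2) * (1 + 2))
        (fun n => (norm_mul_le _ _).trans (mul_le_mul (h1C n) (h1C n) (norm_nonneg _) (by norm_num)))
        (tendsto_mul_apply h1C h1a h1a)
    · exact hφ.tendsto (fun n => mul_mem (hx n).1 (hx n).1) (mul_mem haM haM) (2 * 2)
        (fun n => (norm_mul_le _ _).trans (mul_le_mul (hC n) (hC n) (norm_nonneg _) (by norm_num)))
        (tendsto_mul_apply hC ha ha)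
  have hlim2 : Tendsto (fun n : ℕ => τ.energy φ y + (1 / 8 : ℝ) ^ n / 8) atTop
      (𝓝 (τ.energy φ y)) := by
    have := ((tendsto_pow_atTop_nhds_zero_of_lt_one (r := (1 / 8 : ℝ)) (by norm_num)
        (by norm_num)).div_const 8).const_add (τ.energy φ y)
    simpa using this
  refine le_of_tendsto_of_tendsto' hlim hlim2 fun n => (hlt n).le.trans ?_
  have : sInf S ≤ τ.energy φ y := csInf_le hbdd ⟨_, hy, rfl⟩
  linarith

theorem TracialState.energyDeriv_nonneg {a : H →L[ℂ] H} (ha : a ∈ orderInterval M)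
    (hmin : ∀ y ∈ orderInterval M, τ.energy φ a ≤ τ.energy φ y) {d : H →L[ℂ] H}
    (hd : a + d ∈ orderInterval M) : 0 ≤ τ.energyDeriv φ a d := by
  have hdM : d ∈ M := by
    have := sub_mem hd.1 ha.1
    rwa [add_sub_cancel_left] at this
  have hdsa : IsSelfAdjoint d := by
    have := (IsSelfAdjoint.of_nonneg hd.2.1).sub (IsSelfAdjoint.of_nonneg ha.2.1)
    rwa [add_sub_cancel_left] at this
  have hdd : 0 ≤ d * d := by
    have := star_mul_self_nonneg d
    rwa [hdsa.star_eq] at this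
  set G := τ.energyDeriv φ a d
  set Q := τ.re (d * d) + φ (d * d) with hQ
  have hQ0 : 0 ≤ Q := add_nonneg (τ.re_nonneg (hM (mul_mem hdM hdM)) hdd)
    (hφ.nonneg (mul_mem hdM hdM) hdd)
  by_contra! hG
  have hpos : 0 < Q - G := by linarith
  -- With this r the increment r (G + r Q) is strictly negative. Dividing by Q - G rather than Q
  -- keeps 0 < r ≤ 1 and also covers Q = 0.
  set r := -G / (Q - G) with hr
  have hr0 : 0 < r := div_pos (by linarith) hpos
  have hr1 : r ≤ 1 := (div_le_one hpos).mpr (by linarith)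
  have h1 := hmin _ (convex_orderInterval M ha hd hr0.le hr1)
  rw [τ.energy_add_smul hM hφ ha.1 hdM r] at h1
  have h2 : 0 ≤ r * (G + r * Q) := by nlinarith
  have h3 : G + r * Q = -(G ^ 2 / (Q - G)) := by
    rw [hr]; field_simp; ring
  have h4 : 0 < G ^ 2 / (Q - G) := div_pos (by nlinarith) hpos
  nlinarith

end Minimize

theorem ker_eq_bot_of_proj_eq_zero {a : H →L[ℂ] H}
    (h : proj (LinearMap.ker a.toLinearMap) = 0) {y : H} (hy : a y = 0) : y = 0 := by
  have : proj (LinearMap.ker a.toLinearMap) y = y := proj_apply_of_mem hy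
  rw [← this, h, zero_apply]

/-- Compress a ≤ c by the complement of the kernel projection, which leaves a unchanged. -/
theorem add_proj_ker_le {a : H →L[ℂ] H} (h0 : 0 ≤ a) {c : ℝ} (hc : a ≤ c • 1) :
    a + c • proj (LinearMap.ker a.toLinearMap) ≤ c • 1 := by
  set p := proj (LinearMap.ker a.toLinearMap)
  have hp : IsStarProjection p := isStarProjection_proj _
  have h1 : a * p = 0 := mul_proj_ker a
  have h2 : p * a = 0 := by
    simpa [hp.isSelfAdjoint.star_eq, (IsSelfAdjoint.of_nonneg h0).star_eq] using congrArg star h1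
  have h3 := star_left_conjugate_le_conjugate hc (1 - p)
  rw [hp.one_sub.isSelfAdjoint.star_eq] at h3
  have e1 : (1 - p) * a * (1 - p) = a := by
    rw [sub_mul, one_mul, h2, sub_zero, mul_sub, mul_one, h1, sub_zero]
  have e2 : (1 - p) * (c • 1) * (1 - p) = c • 1 - c • p := by
    rw [mul_smul_comm, mul_one, smul_mul_assoc, hp.one_sub.isIdempotentElem.eq, smul_sub]
  rw [e1, e2] at h3
  exact le_sub_iff_add_le.mp h3

theorem proj_range_eq_one {w : H →L[ℂ] H} (hw : IsSelfAdjoint w)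
    (hinj : ∀ y, w y = 0 → y = 0) : proj (LinearMap.range w.toLinearMap) = 1 := by
  have h := one_sub_proj_ker w
  have h0 : proj (LinearMap.ker w.toLinearMap) = 0 := by
    ext y
    exact hinj _ (congrArg (fun b : H →L[ℂ] H => b y) (mul_proj_ker w))
  rw [h0, sub_zero, hw.star_eq] at h
  exact h.symm

/-- The square of `w = a (2 - a)` is dominated by multiples of `a` and of `2 - a`. -/
theorem mul_self_le_of_le_two {a : H →L[ℂ] H} (ha0 : 0 ≤ a) (ha2 : a ≤ (2 : ℝ) • 1) :
    (a * ((2 : ℝ) • 1 - a)) * (a * ((2 : ℝ) • 1 - a)) ≤ (8 : ℝ) • a ∧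
    (a * ((2 : ℝ) • 1 - a)) * (a * ((2 : ℝ) • 1 - a)) ≤ (8 : ℝ) • ((2 : ℝ) • 1 - a) := by
  have hsa : IsSelfAdjoint a := IsSelfAdjoint.of_nonneg ha0
  set w := a * ((2 : ℝ) • 1 - a) with hw
  have hsp : ∀ r ∈ spectrum ℝ a, 0 ≤ r ∧ r ≤ 2 := fun r hr =>
    ⟨spectrum_nonneg_of_nonneg ha0 hr, (le_algebraMap_iff_spectrum_le (R := ℝ)).mp
      (by rw [Algebra.algebraMap_eq_smul_one]; exact ha2) r hr⟩
  have hwcfc : w * w = cfc (fun r : ℝ => (r * (2 - r)) * (r * (2 - r))) a := by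
    have e : w = cfc (fun r : ℝ => r * (2 - r)) a := by
      rw [cfc_mul (fun r : ℝ => r) (fun r : ℝ => 2 - r) a continuousOn_id (by fun_prop),
        cfc_id' ℝ a, cfc_sub (fun _ : ℝ => (2 : ℝ)) (fun r : ℝ => r) a (by fun_prop) continuousOn_id,
        cfc_id' ℝ a, cfc_const 2 a, Algebra.algebraMap_eq_smul_one]
    rw [e, ← cfc_mul _ _ a (by fun_prop) (by fun_prop)]
  have hww1 : w * w ≤ (8 : ℝ) • a := by
    have e : (8 : ℝ) • a = cfc (fun r : ℝ => (8 : ℝ) • r) a := by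
      rw [cfc_smul (8 : ℝ) (fun r : ℝ => r) a continuousOn_id, cfc_id' ℝ a]
    rw [hwcfc, e]
    refine cfc_mono (fun r hr => ?_) (by fun_prop) (by fun_prop)
    obtain ⟨h0, h2⟩ := hsp r hr
    have h3 : (2 - r) * (r * (2 - r)) ≤ 8 := by nlinarith [mul_nonneg h0 (sub_nonneg.mpr h2)]
    simp only [smul_eq_mul]
    nlinarith
  have hww2 : w * w ≤ (8 : ℝ) • ((2 : ℝ) • 1 - a) := by
    have e : (8 : ℝ) • ((2 : ℝ) • 1 - a) = cfc (fun r : ℝ => (8 : ℝ) • (2 - r)) a := by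
      rw [cfc_smul (8 : ℝ) (fun r : ℝ => 2 - r) a (by fun_prop),
        cfc_sub (fun _ : ℝ => (2 : ℝ)) (fun r : ℝ => r) a (by fun_prop) continuousOn_id,
        cfc_id' ℝ a, cfc_const 2 a, Algebra.algebraMap_eq_smul_one]
    rw [hwcfc, e]
    refine cfc_mono (fun r hr => ?_) (by fun_prop) (by fun_prop)
    obtain ⟨h0, h2⟩ := hsp r hr
    have h3 : r * (r * (2 - r)) ≤ 8 := by nlinarith [mul_nonneg h0 (sub_nonneg.mpr h2)]
    simp only [smul_eq_mul]
    nlinarith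
  exact ⟨hww1, hww2⟩

/-! ### The Euler equation: the constraints 0 ≤ x ≤ 2 are not active at a minimiser. -/

section Deriv

variable {N M : VonNeumannAlgebra H} (τ : TracialState N) {φ : (H →L[ℂ] H) → ℝ}
  (hM : M ≤ N) (hφ : IsNormalPositive M φ)
include hM hφ

theorem TracialState.isNormalPositive_energyDeriv_linear {a : H →L[ℂ] H} (ha : a ∈ M) :
    (∀ {x y}, x ∈ M → y ∈ M → τ.energyDeriv φ a (x + y)
      = τ.energyDeriv φ a x + τ.energyDeriv φ a y) ∧
    (∀ {x}, x ∈ M → ∀ r : ℝ, τ.energyDeriv φ a (r • x) = r * τ.energyDeriv φ a x) ∧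
    (IsSelfAdjoint a → ∀ {x}, x ∈ M → τ.energyDeriv φ a (star x) = τ.energyDeriv φ a x) ∧
    (∀ {x : ℕ → H →L[ℂ] H} {b : H →L[ℂ] H}, (∀ n, x n ∈ M) → b ∈ M → ∀ C : ℝ, (∀ n, ‖x n‖ ≤ C) →
      (∀ y, Tendsto (fun n => x n y) atTop (𝓝 (b y))) →
      Tendsto (fun n => τ.energyDeriv φ a (x n)) atTop (𝓝 (τ.energyDeriv φ a b))) := by
  have hτ := τ.isNormalPositive hM
  have h1 : a - 1 ∈ M := sub_mem ha (one_mem M)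
  have hL : ∀ {b d : H →L[ℂ] H}, b ∈ M → d ∈ M → b * d + d * b ∈ M := fun hb hd =>
    add_mem (mul_mem hb hd) (mul_mem hd hb)
  have hlim : ∀ {b : H →L[ℂ] H} {x : ℕ → H →L[ℂ] H} {d : H →L[ℂ] H} (C : ℝ), (∀ n, ‖x n‖ ≤ C) →
      (∀ y, Tendsto (fun n => x n y) atTop (𝓝 (d y))) →
      (∀ n, ‖b * x n + x n * b‖ ≤ ‖b‖ * C + C * ‖b‖) ∧
      ∀ y, Tendsto (fun n => (b * x n + x n * b) y) atTop (𝓝 ((b * d + d * b) y)) := by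
    intro b x d C hC hx
    refine ⟨fun n => (norm_add_le _ _).trans (add_le_add ((norm_mul_le _ _).trans ?_)
      ((norm_mul_le _ _).trans ?_)), fun y => ?_⟩
    · gcongr; exact hC n
    · gcongr; exact hC n
    · exact ((b.continuous.tendsto _).comp (hx y)).add (hx (b y))
  refine ⟨fun {x y} hx hy => ?_, fun {x} hx r => ?_, fun hsa x hx => ?_, fun {x b} hx hb C hC h => ?_⟩
  · have e : ∀ b : H →L[ℂ] H, b * (x + y) + (x + y) * b = (b * x + x * b) + (b * y + y * b) :=
      fun b => by noncomm_ring
    rw [energyDeriv, e, e, hτ.add (hL h1 hx) (hL h1 hy), hφ.add (hL ha hx) (hL ha hy), energyDeriv,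
      energyDeriv]
    ring
  · have e : ∀ b : H →L[ℂ] H, b * (r • x) + (r • x) * b = r • (b * x + x * b) :=
      fun b => by rw [mul_smul_comm, smul_mul_assoc, smul_add]
    rw [energyDeriv, e, e, hτ.smul (hL h1 hx), hφ.smul (hL ha hx), energyDeriv]
    ring
  · have e : ∀ b : H →L[ℂ] H, IsSelfAdjoint b → b * star x + star x * b = star (b * x + x * b) :=
      fun b hb => by rw [star_add, star_mul, star_mul, hb.star_eq, add_comm]
    rw [energyDeriv, e _ hsa, e _ (hsa.sub (IsSelfAdjoint.one _)), hτ.star (hL h1 hx),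
      hφ.star (hL ha hx), energyDeriv]
  · exact (hτ.tendsto (fun n => hL h1 (hx n)) (hL h1 hb) _ (hlim C hC h).1 (hlim C hC h).2).add
      (hφ.tendsto (fun n => hL ha (hx n)) (hL ha hb) _ (hlim C hC h).1 (hlim C hC h).2)

/-- The kernel projection p is an admissible direction, and the derivative along it is -2 τ(p);
minimality gives τ(p) = 0. -/
theorem TracialState.injective_of_isMin {a : H →L[ℂ] H} (ha : a ∈ orderInterval M)
    (hmin : ∀ y ∈ orderInterval M, τ.energy φ a ≤ τ.energy φ y) : ∀ y, a y = 0 → y = 0 := by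
  have hτ := τ.isNormalPositive hM
  have haM := ha.1
  have ha0 := ha.2.1
  have ha2 := ha.2.2
  have hsa : IsSelfAdjoint a := IsSelfAdjoint.of_nonneg ha0
  have hG := fun {d} hd => τ.energyDeriv_nonneg hM hφ ha hmin (d := d) hd
  have hinj : ∀ y, a y = 0 → y = 0 := by
    set p := proj (LinearMap.ker a.toLinearMap) with hpdef
    have hp : IsStarProjection p := isStarProjection_proj _
    have hpM : p ∈ M := proj_ker_mem haM
    have h1 : a * p = 0 := mul_proj_ker a
    have h2 : p * a = 0 := by
      simpa [hp.isSelfAdjoint.star_eq, hsa.star_eq] using congrArg star h1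
    have hle : a + p ≤ (2 : ℝ) • 1 := by
      refine le_trans ?_ (add_proj_ker_le ha0 ha2)
      have : p ≤ (2 : ℝ) • p := by
        rw [two_smul]; exact le_add_of_nonneg_left hp.nonneg
      exact add_le_add_right this a
    have h3 : 0 ≤ τ.energyDeriv φ a p :=
      hG ⟨add_mem haM hpM, add_nonneg ha0 hp.nonneg, hle⟩
    have e : (a - 1) * p + p * (a - 1) = (-2 : ℝ) • p := by
      rw [sub_mul, mul_sub, h1, h2, one_mul, mul_one]; module
    rw [energyDeriv, e, h1, h2, add_zero, hφ.zero, hτ.smul hpM, add_zero] at h3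
    have h4 : τ.re p = 0 := le_antisymm (by linarith) (hτ.nonneg hpM hp.nonneg)
    exact fun y hy => ker_eq_bot_of_proj_eq_zero (τ.eq_zero_of_re_eq_zero (hM hpM) hp.nonneg h4) hy
  exact hinj

/-- Where a = 2, the direction -p has derivative -2 τ(p) - 4 φ(p), so minimality gives τ(p) = 0. An
upper bound 1 would not do: where a = 1 the trace part of the derivative vanishes, and φ may vanish
on p. -/
theorem TracialState.injective_two_sub_of_isMin {a : H →L[ℂ] H} (ha : a ∈ orderInterval M)
    (hmin : ∀ y ∈ orderInterval M, τ.energy φ a ≤ τ.energy φ y) :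
    ∀ y, ((2 : ℝ) • 1 - a) y = 0 → y = 0 := by
  have hτ := τ.isNormalPositive hM
  have haM := ha.1
  have ha0 := ha.2.1
  have ha2 := ha.2.2
  have hsa : IsSelfAdjoint a := IsSelfAdjoint.of_nonneg ha0
  have hG := fun {d} hd => τ.energyDeriv_nonneg hM hφ ha hmin (d := d) hd
  have h2a : (2 : ℝ) • 1 - a ∈ M := sub_mem (smul_mem (one_mem M) 2) haM
  have h2a0 : 0 ≤ (2 : ℝ) • 1 - a := sub_nonneg.mpr ha2
  have h2sa : IsSelfAdjoint ((2 : ℝ) • 1 - a) := IsSelfAdjoint.of_nonneg h2a0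
  have hinj2 : ∀ y, ((2 : ℝ) • 1 - a) y = 0 → y = 0 := by
    set p := proj (LinearMap.ker ((2 : ℝ) • 1 - a).toLinearMap) with hpdef
    have hp : IsStarProjection p := isStarProjection_proj _
    have hpM : p ∈ M := proj_ker_mem h2a
    have h1 : ((2 : ℝ) • 1 - a) * p = 0 := mul_proj_ker _
    have h2 : p * ((2 : ℝ) • 1 - a) = 0 := by
      simpa only [star_mul, hp.isSelfAdjoint.star_eq, h2sa.star_eq, star_zero] using congrArg star h1
    rw [sub_mul, smul_mul_assoc, one_mul, sub_eq_zero] at h1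
    rw [mul_sub, mul_smul_comm, mul_one, sub_eq_zero] at h2
    have hle : p ≤ a := by
      have h3 := add_proj_ker_le h2a0 (c := 2) (sub_le_self _ ha0)
      rw [← hpdef, sub_add, sub_le_self_iff, sub_nonneg] at h3
      refine le_trans ?_ h3
      rw [two_smul]; exact le_add_of_nonneg_left hp.nonneg
    have h3 : 0 ≤ τ.energyDeriv φ a (-p) := by
      refine hG ⟨add_mem haM (neg_mem hpM), ?_, ?_⟩
      · rw [← sub_eq_add_neg]; exact sub_nonneg.mpr hle
      · rw [← sub_eq_add_neg]; exact (sub_le_self _ hp.nonneg).trans ha2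
    have e : (a - 1) * (-p) + (-p) * (a - 1) = (-2 : ℝ) • p := by
      rw [sub_mul, mul_sub, mul_neg, neg_mul, ← h1, ← h2, one_mul, mul_one]; module
    have e2 : a * (-p) + (-p) * a = (-4 : ℝ) • p := by
      rw [mul_neg, neg_mul, ← h1, ← h2]; module
    rw [energyDeriv, e, e2, hφ.smul hpM, hτ.smul hpM] at h3
    have h5 := hφ.nonneg hpM hp.nonneg
    have h4 : τ.re p = 0 := le_antisymm (by linarith) (hτ.nonneg hpM hp.nonneg)
    exact fun y hy => ker_eq_bot_of_proj_eq_zero (τ.eq_zero_of_re_eq_zero (hM hpM) hp.nonneg h4) hy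
  exact hinj2

/-- For 0 ≤ z ≤ 1 the two bounds on w² make both directions ±(w z w)/8 admissible, so the derivative
vanishes there. Scaling, shifting by ‖z‖ and taking self-adjoint parts reach all z. -/
theorem TracialState.energyDeriv_conj_eq_zero {a w : H →L[ℂ] H} (ha : a ∈ orderInterval M)
    (hmin : ∀ y ∈ orderInterval M, τ.energy φ a ≤ τ.energy φ y) (hwM : w ∈ M) (hw0 : 0 ≤ w)
    (hww1 : w * w ≤ (8 : ℝ) • a) (hww2 : w * w ≤ (8 : ℝ) • ((2 : ℝ) • 1 - a)) :
    ∀ z ∈ M, τ.energyDeriv φ a (w * z * w) = 0 := by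
  have haM := ha.1
  have ha0 := ha.2.1
  have ha2 := ha.2.2
  have hsa : IsSelfAdjoint a := IsSelfAdjoint.of_nonneg ha0
  have hG := fun {d} hd => τ.energyDeriv_nonneg hM hφ ha hmin (d := d) hd
  have hwsa : IsSelfAdjoint w := IsSelfAdjoint.of_nonneg hw0
  obtain ⟨hadd, hsmul, hstar, -⟩ := τ.isNormalPositive_energyDeriv_linear hM hφ haM
  have hz1 : ∀ z ∈ M, 0 ≤ z → z ≤ 1 → τ.energyDeriv φ a (w * z * w) = 0 := by
    intro z hz hz0 hz1
    have hm : w * z * w ∈ M := mul_mem (mul_mem hwM hz) hwM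
    have h1 : 0 ≤ w * z * w := conjugate_nonneg_of_nonneg hz0 hw0
    have h2 : w * z * w ≤ w * w := by
      have := conjugate_le_conjugate_of_nonneg hz1 hw0
      rwa [mul_one] at this
    have h8 : ∀ b : H →L[ℂ] H, w * w ≤ (8 : ℝ) • b → (1 / 8 : ℝ) • (w * z * w) ≤ b := fun b hb => by
      have := smul_le_smul_of_nonneg_left (h2.trans hb) (show (0 : ℝ) ≤ 1 / 8 by norm_num)
      rwa [smul_smul, show (1 / 8 : ℝ) * 8 = 1 by norm_num, one_smul] at this
    have h10 : 0 ≤ (1 / 8 : ℝ) • (w * z * w) := smul_nonneg (by norm_num) h1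
    have h3 := hG (d := (1 / 8 : ℝ) • (w * z * w)) ⟨add_mem haM (smul_mem hm _), add_nonneg ha0 h10,
      by rw [add_comm]; exact le_sub_iff_add_le.mp (h8 _ hww2)⟩
    have h4 := hG (d := (-(1 / 8) : ℝ) • (w * z * w)) ⟨add_mem haM (smul_mem hm _),
      by rw [neg_smul, ← sub_eq_add_neg]; exact sub_nonneg.mpr (h8 _ hww1),
      by rw [neg_smul, ← sub_eq_add_neg]; exact (sub_le_self _ h10).trans ha2⟩
    rw [hsmul hm] at h3 h4
    linarith
  have hz0 : ∀ z ∈ M, 0 ≤ z → τ.energyDeriv φ a (w * z * w) = 0 := by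
    intro z hz hz0
    have hpos : 0 < ‖z‖ + 1 := by positivity
    have h1 : (‖z‖ + 1)⁻¹ • z ≤ 1 := by
      rw [← CStarAlgebra.norm_le_one_iff_of_nonneg _ (smul_nonneg (by positivity) hz0), norm_smul,
        norm_inv, Real.norm_of_nonneg hpos.le, inv_mul_le_iff₀ hpos]
      linarith
    have h2 := hz1 _ (smul_mem hz _) (smul_nonneg (by positivity) hz0) h1
    rw [mul_smul_comm, smul_mul_assoc, hsmul (mul_mem (mul_mem hwM hz) hwM)] at h2
    exact (mul_eq_zero.mp h2).resolve_left (by positivity)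
  have hzsa : ∀ z ∈ M, IsSelfAdjoint z → τ.energyDeriv φ a (w * z * w) = 0 := by
    intro z hz hzsa
    have h1 : 0 ≤ z + ‖z‖ • 1 := by
      have := hzsa.neg_algebraMap_norm_le_self
      rw [Algebra.algebraMap_eq_smul_one] at this
      exact neg_le_iff_add_nonneg.mp this
    have h2 := hz0 _ (add_mem hz (smul_mem (one_mem M) _)) h1
    have h3 := hz0 1 (one_mem M) zero_le_one
    have e : w * (z + ‖z‖ • 1) * w = w * z * w + ‖z‖ • (w * 1 * w) := by
      rw [mul_add, add_mul, mul_smul_comm, smul_mul_assoc]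
    rw [e, hadd (mul_mem (mul_mem hwM hz) hwM) (smul_mem (mul_mem (mul_mem hwM (one_mem M)) hwM) _),
      hsmul (mul_mem (mul_mem hwM (one_mem M)) hwM), h3, mul_zero, add_zero] at h2
    exact h2
  have hzall : ∀ z ∈ M, τ.energyDeriv φ a (w * z * w) = 0 := by
    intro z hz
    have hm : w * z * w ∈ M := mul_mem (mul_mem hwM hz) hwM
    have h1 := hzsa (z + star z) (add_mem hz (star_mem hz)) (IsSelfAdjoint.add_star_self z)
    have e : w * (z + star z) * w = w * z * w + star (w * z * w) := by
      rw [star_mul, star_mul, hwsa.star_eq, mul_add, add_mul, mul_assoc w (star z) w]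
    rw [e, hadd hm (star_mem hm), hstar hsa hm] at h1
    linarith
  exact hzall

theorem TracialState.energyDeriv_eq_zero_of_conj {a w : H →L[ℂ] H} (haM : a ∈ M) (hwM : w ∈ M)
    (hwsa : IsSelfAdjoint w) (hwinj : ∀ y, w y = 0 → y = 0)
    (hzall : ∀ z ∈ M, τ.energyDeriv φ a (w * z * w) = 0) {d : H →L[ℂ] H} (hd : d ∈ M) :
    τ.energyDeriv φ a d = 0 := by
  obtain ⟨-, -, -, hnorm⟩ := τ.isNormalPositive_energyDeriv_linear hM hφ haM
  -- approximate `d` by `b n * d * b n` with `b n = w² (w² + 1/(n+1))⁻¹`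
  let k : ℕ → H →L[ℂ] H := fun n => regInv w (1 / ((n : ℝ) + 1))
  have hpos : ∀ n : ℕ, (0 : ℝ) < 1 / ((n : ℝ) + 1) := fun n => Nat.one_div_pos_of_nat
  let b : ℕ → H →L[ℂ] H := fun n => w * star w * k n
  have hkM : ∀ n, k n ∈ M := fun n => cfc_mem (mul_mem hwM (star_mem hwM)) _
  have hbM : ∀ n, b n ∈ M := fun n => mul_mem (mul_mem hwM (star_mem hwM)) (hkM n)
  have hb1 : ∀ n, ‖b n‖ ≤ 1 := fun n => mul_star_mul_regInv_le_one (hpos n)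
  have hb : ∀ y, Tendsto (fun n => b n y) atTop (𝓝 ((1 : H →L[ℂ] H) y)) := fun y => by
    have := tendsto_mul_regInv (a := w) y
    rwa [proj_range_eq_one hwsa hwinj] at this
  have hkw : ∀ n, Commute (k n) w := fun n => by
    refine Commute.cfc_real ?_ _
    rw [hwsa.star_eq]
    exact (Commute.refl w).mul_left (Commute.refl w)
  have hbd : ∀ n, τ.energyDeriv φ a (b n * (d * b n)) = 0 := fun n => by
    have e : b n * (d * b n) = w * ((w * k n) * d * (k n * w)) * w := by
      have e1 : b n = w * (w * k n) := by
        change w * star w * k n = _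
        rw [hwsa.star_eq, mul_assoc]
      have e2 : b n = k n * w * w := by
        rw [e1, ← (hkw n).eq, ← mul_assoc, ← (hkw n).eq]
      calc b n * (d * b n) = (w * (w * k n)) * (d * (k n * w * w)) := by rw [← e1, ← e2]
        _ = _ := by simp only [mul_assoc]
    rw [e]
    exact hzall _ (mul_mem (mul_mem (mul_mem hwM (hkM n)) hd) (mul_mem (hkM n) hwM))
  have hlim := hnorm (fun n => mul_mem (hbM n) (mul_mem hd (hbM n))) hd (1 * (‖d‖ * 1))
    (fun n => (norm_mul_le _ _).trans (mul_le_mul (hb1 n) ((norm_mul_le _ _).trans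
      (by gcongr; exact hb1 n)) (norm_nonneg _) zero_le_one)) (fun y => by
      have := tendsto_mul_apply (b := fun n => d * b n) (b' := d) hb1 hb
        (fun y => (d.continuous.tendsto _).comp (hb y)) y
      rwa [one_mul] at this)
  simp only [hbd] at hlim
  exact tendsto_nhds_unique hlim tendsto_const_nhds

/-- There is an injective positive operator at which the energy is stationary. -/
theorem TracialState.exists_stationary :
    ∃ a ∈ M, 0 ≤ a ∧ a ≤ (2 : ℝ) • 1 ∧ (∀ y, a y = 0 → y = 0) ∧
      ∀ d ∈ M, τ.energyDeriv φ a d = 0 := by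
  obtain ⟨a, ha, hmin⟩ := τ.exists_min_energy hM hφ
  obtain ⟨haM, ha0, ha2⟩ := id ha
  have hinj := τ.injective_of_isMin hM hφ ha hmin
  have hinj2 := τ.injective_two_sub_of_isMin hM hφ ha hmin
  have hcomm : Commute a ((2 : ℝ) • 1 - a) :=
    ((Commute.one_right a).smul_right 2).sub_right (Commute.refl a)
  have hwM : a * ((2 : ℝ) • 1 - a) ∈ M := mul_mem haM (sub_mem (smul_mem (one_mem M) 2) haM)
  have hw0 : 0 ≤ a * ((2 : ℝ) • 1 - a) := hcomm.mul_nonneg ha0 (sub_nonneg.mpr ha2)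
  obtain ⟨hww1, hww2⟩ := mul_self_le_of_le_two ha0 ha2
  exact ⟨a, haM, ha0, ha2, hinj, fun d hd => τ.energyDeriv_eq_zero_of_conj hM hφ haM hwM
    (IsSelfAdjoint.of_nonneg hw0) (fun y hy => hinj2 y (hinj _ hy))
    (τ.energyDeriv_conj_eq_zero hM hφ ha hmin hwM hw0 hww1 hww2) hd⟩

end Deriv

/-! ### The Radon–Nikodym density. -/

section Centralizer

variable {M : VonNeumannAlgebra H} {φ : (H →L[ℂ] H) → ℝ} (hφ : IsNormalPositive M φ)
include hφ

/-- The centralizer of a positive functional is closed under functional calculus. -/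
theorem IsNormalPositive.cfc_mul_comm {a : H →L[ℂ] H} (hsa : IsSelfAdjoint a) (ha : a ∈ M)
    (hc : ∀ z ∈ M, φ (a * z) = φ (z * a)) (h : ℝ → ℝ) {z : H →L[ℂ] H} (hz : z ∈ M) :
    φ (cfc h a * z) = φ (z * cfc h a) := by
  suffices hP : ∀ u ∈ StarAlgebra.elemental ℝ a, u ∈ M → ∀ z ∈ M, φ (u * z) = φ (z * u) from
    hP _ (cfc_mem_elemental h a) (cfc_mem ha h) z hz
  have hMcl : IsClosed {u : H →L[ℂ] H | u ∈ M} := by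
    have : {u : H →L[ℂ] H | u ∈ M} = ⋂ v ∈ M.commutant, {u | v * u = u * v} := by
      ext u
      simp only [Set.mem_iInter, Set.mem_ofPred_eq]
      exact ⟨fun hu v hv => commute_of_mem_commutant hu hv, mem_of_forall_commute⟩
    rw [this]
    exact isClosed_biInter fun v _ => isClosed_eq (by fun_prop) (by fun_prop)
  have hkey : ∀ u ∈ StarAlgebra.elemental ℝ a, u ∈ M ∧ ∀ z ∈ M, φ (u * z) = φ (z * u) := by
    intro u hu
    induction hu using StarAlgebra.elemental.induction_on with
    | self => exact ⟨ha, hc⟩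
    | star_self => rw [hsa.star_eq]; exact ⟨ha, hc⟩
    | algebraMap r =>
      rw [Algebra.algebraMap_eq_smul_one]
      exact ⟨smul_mem (one_mem M) r, fun z _ => by
        rw [smul_mul_assoc, mul_smul_comm, one_mul, mul_one]⟩
    | add u _ v _ hu hv =>
      refine ⟨add_mem hu.1 hv.1, fun z hz => ?_⟩
      rw [add_mul, mul_add, hφ.add (mul_mem hu.1 hz) (mul_mem hv.1 hz),
        hφ.add (mul_mem hz hu.1) (mul_mem hz hv.1), hu.2 z hz, hv.2 z hz]
    | mul u _ v _ hu hv =>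
      refine ⟨mul_mem hu.1 hv.1, fun z hz => ?_⟩
      rw [mul_assoc, hu.2 _ (mul_mem hv.1 hz), mul_assoc, hv.2 _ (mul_mem hz hu.1), mul_assoc]
    | closure s _ hs v hv =>
      have hvM : v ∈ M := closure_minimal (fun u hu => (hs u hu).1) hMcl hv
      refine ⟨hvM, fun z hz => ?_⟩
      obtain ⟨x, hx, hxv⟩ := mem_closure_iff_seq_limit.mp hv
      have hxM : ∀ n, x n ∈ M := fun n => (hs _ (hx n)).1
      have hlim : ∀ y : ℕ → H →L[ℂ] H, ∀ b ∈ M, (∀ n, y n ∈ M) → Tendsto y atTop (𝓝 b) →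
          Tendsto (fun n => φ (y n)) atTop (𝓝 (φ b)) := fun y b hb hyM hy => by
        rw [tendsto_iff_norm_sub_tendsto_zero] at hy ⊢
        have h2 := hy.const_mul (φ 1)
        rw [mul_zero] at h2
        refine squeeze_zero_norm (fun n => ?_) h2
        rw [norm_norm, Real.norm_eq_abs, ← hφ.sub (hyM n) hb]
        exact hφ.abs_le (sub_mem (hyM n) hb)
      have h1 := hlim (fun n => x n * z) (v * z) (mul_mem hvM hz) (fun n => mul_mem (hxM n) hz)
        (hxv.mul_const z)
      have h2 := hlim (fun n => z * x n) (z * v) (mul_mem hz hvM) (fun n => mul_mem hz (hxM n))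
        (hxv.const_mul z)
      exact tendsto_nhds_unique h1 (h2.congr fun n => ((hs _ (hx n)).2 z hz).symm)
  exact fun u hu _ => (hkey u hu).2

variable {N : VonNeumannAlgebra H} (τ : TracialState N) (hM : M ≤ N)
include hM

/-- A Radon–Nikodym theorem: `φ` has density `R⁻¹ - 1` with respect to the trace. -/
theorem IsNormalPositive.exists_density :
    ∃ R ∈ M, 0 ≤ R ∧ R ≤ 1 ∧ (∀ y, R y = 0 → y = 0) ∧
      ∀ z ∈ M, φ (R * z) = τ.re ((1 - R) * z) := by
  obtain ⟨R, hR, h0, -, hinj, hst⟩ := τ.exists_stationary hM hφ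
  have hsa : IsSelfAdjoint R := IsSelfAdjoint.of_nonneg h0
  have h1R : 1 - R ∈ M := sub_mem (one_mem M) hR
  have hR1 : R - 1 ∈ M := sub_mem hR (one_mem M)
  -- In the direction of the commutator Rz - zR all trace terms cancel by traciality, leaving φ(R²
  -- z) = φ(z R²).
  have hsq : ∀ z ∈ M, φ (R * R * z) = φ (z * (R * R)) := by
    intro z hz
    have h := hst (R * z - z * R) (sub_mem (mul_mem hR hz) (mul_mem hz hR))
    have e1 : (R - 1) * (R * z - z * R) + (R * z - z * R) * (R - 1)
        = (R * R * z - z * (R * R)) - (2 : ℝ) • (R * z - z * R) := by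
      rw [two_smul]; noncomm_ring
    have e2 : R * (R * z - z * R) + (R * z - z * R) * R = R * R * z - z * (R * R) := by
      noncomm_ring
    have hRR := mul_mem hR hR
    rw [TracialState.energyDeriv, e1, e2, τ.re_sub (hM (sub_mem (mul_mem hRR hz) (mul_mem hz hRR)))
      (hM (smul_mem (sub_mem (mul_mem hR hz) (mul_mem hz hR)) 2)),
      τ.re_smul (hM (sub_mem (mul_mem hR hz) (mul_mem hz hR))),
      τ.re_sub (hM (mul_mem hRR hz)) (hM (mul_mem hz hRR)),
      τ.re_sub (hM (mul_mem hR hz)) (hM (mul_mem hz hR)), τ.re_mul_comm (hM hRR) (hM hz),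
      τ.re_mul_comm (hM hR) (hM hz), sub_self, sub_self, mul_zero, sub_zero, zero_add,
      hφ.sub (mul_mem hRR hz) (mul_mem hz hRR)] at h
    exact sub_eq_zero.mp h
  have hsqrt : cfc Real.sqrt (R * R) = R := by
    have e : R * R = cfc (fun r : ℝ => r * r) R := by
      rw [cfc_mul (fun r : ℝ => r) (fun r : ℝ => r) R continuousOn_id continuousOn_id, cfc_id' ℝ R]
    rw [e, ← cfc_comp' Real.sqrt (fun r : ℝ => r * r) R (by fun_prop) (by fun_prop)]
    conv_rhs => rw [← cfc_id' ℝ R]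
    exact cfc_congr fun r hr => Real.sqrt_mul_self (spectrum_nonneg_of_nonneg h0 hr)
  -- R = √(R²) is a function of an element of the centralizer. After this the two halves of the
  -- Euler equation coincide.
  have hcomm : ∀ z ∈ M, φ (R * z) = φ (z * R) := fun z hz => by
    have hsa2 : IsSelfAdjoint (R * R) := by
      have := IsSelfAdjoint.star_mul_self R
      rwa [hsa.star_eq] at this
    have := hφ.cfc_mul_comm hsa2 (mul_mem hR hR) hsq Real.sqrt hz
    rwa [hsqrt] at this
  have hden : ∀ z ∈ M, φ (R * z) = τ.re ((1 - R) * z) := by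
    intro z hz
    have h := hst z hz
    rw [TracialState.energyDeriv, hφ.add (mul_mem hR hz) (mul_mem hz hR), ← hcomm z hz,
      τ.re_add (hM (mul_mem hR1 hz)) (hM (mul_mem hz hR1)), ← τ.re_mul_comm (hM hR1) (hM hz)] at h
    have e : (1 - R) * z = (-1 : ℝ) • ((R - 1) * z) := by
      rw [neg_one_smul]; noncomm_ring
    rw [e, τ.re_smul (hM (mul_mem hR1 hz))]
    linarith
  refine ⟨R, hR, h0, ?_, hinj, hden⟩
  -- With z = (R - 1)₊ one gets 0 ≤ φ(R z) = τ((1 - R) z) = -τ(z²), so z = 0 and R ≤ 1.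
  set z := cfc (fun r : ℝ => max (r - 1) 0) R with hz
  have hzM : z ∈ M := cfc_mem hR _
  have hz0 : 0 ≤ z := cfc_nonneg fun r _ => le_max_right _ _
  have hzsa : IsSelfAdjoint z := IsSelfAdjoint.of_nonneg hz0
  have e1 : (1 - R) * z = (-1 : ℝ) • (z * z) := by
    have e : 1 - R = cfc (fun r : ℝ => 1 - r) R := by
      rw [cfc_sub (fun _ : ℝ => (1 : ℝ)) (fun r : ℝ => r) R (by fun_prop) continuousOn_id,
        cfc_id' ℝ R, cfc_const_one ℝ R]
    rw [e, hz, ← cfc_mul _ _ R (by fun_prop) (by fun_prop),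
      ← cfc_mul _ _ R (by fun_prop) (by fun_prop), ← cfc_smul (-1 : ℝ) _ R (by fun_prop)]
    refine cfc_congr fun r _ => ?_
    simp only [smul_eq_mul]
    rcases le_total (r - 1) 0 with h | h
    · rw [max_eq_right h]; ring
    · rw [max_eq_left h]; ring
  have hzz : 0 ≤ z * z := by
    have := star_mul_self_nonneg z
    rwa [hzsa.star_eq] at this
  have h1 : 0 ≤ φ (R * z) := hφ.nonneg (mul_mem hR hzM)
    (((Commute.refl R).cfc_real _).symm.mul_nonneg h0 hz0)
  rw [hden z hzM, e1, τ.re_smul (hM (mul_mem hzM hzM))] at h1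
  have h2 := τ.re_nonneg (hM (mul_mem hzM hzM)) hzz
  have h3 := τ.eq_zero_of_re_eq_zero (hM (mul_mem hzM hzM)) hzz (by linarith)
  have h4 : z = 0 := by
    rw [← CStarRing.star_mul_self_eq_zero_iff, hzsa.star_eq, h3]
  have h5 : R ≤ cfc (fun r : ℝ => 1 + max (r - 1) 0) R := by
    conv_lhs => rw [← cfc_id' ℝ R]
    refine cfc_mono (fun r _ => ?_) continuousOn_id (by fun_prop)
    linarith [le_max_left (r - 1) 0]
  rwa [cfc_add R (fun _ : ℝ => (1 : ℝ)) (fun r : ℝ => max (r - 1) 0) (by fun_prop) (by fun_prop),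
    cfc_const_one ℝ R, ← hz, h4, add_zero] at h5

end Centralizer

/-! ### The unbounded operator R⁻¹ - 1. -/

section OfResolvent

/-- The operator `R⁻¹ - 1`, for injective `R`. -/
def ofResolvent (R : H →L[ℂ] H) (hinj : Function.Injective R.toLinearMap) : H →ₗ.[ℂ] H where
  domain := LinearMap.range R.toLinearMap
  toFun := (LinearEquiv.ofInjective R.toLinearMap hinj).symm.toLinearMap
    - (LinearMap.range R.toLinearMap).subtype

variable {R : H →L[ℂ] H} (hinj : Function.Injective R.toLinearMap)

omit [CompleteSpace H] in
theorem mem_domain_ofResolvent (y : H) : R y ∈ (ofResolvent R hinj).domain := ⟨y, rfl⟩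

omit [CompleteSpace H] in
theorem ofResolvent_apply (y : H) :
    ofResolvent R hinj ⟨R y, mem_domain_ofResolvent hinj y⟩ = y - R y :=
  congrArg (· - R y) ((LinearEquiv.ofInjective R.toLinearMap hinj).symm_apply_apply y)

omit [CompleteSpace H] in
theorem isPosResolvent_ofResolvent (h0 : 0 ≤ R) (h1 : R ≤ 1) :
    IsPosResolvent (ofResolvent R hinj) R := by
  refine ⟨⟨fun y => ⟨mem_domain_ofResolvent hinj y, ?_⟩, ?_⟩, h0, h1⟩
  · exact (congrArg (R y + ·) (ofResolvent_apply hinj y)).trans (add_sub_cancel _ _)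
  · rintro ⟨_, y, rfl⟩
    exact congrArg R ((congrArg (R y + ·) (ofResolvent_apply hinj y)).trans
      (add_sub_cancel _ _))

theorem isSelfAdjoint_ofResolvent (hR : IsSelfAdjoint R) : IsSelfAdjoint (ofResolvent R hinj) := by
  have hsymm : ∀ x y, inner ℂ (R x) y = inner ℂ x (R y) := hR.isSymmetric
  have hd : Dense ((ofResolvent R hinj).domain : Set H) := by
    change Dense ((LinearMap.range R.toLinearMap : Submodule ℂ H) : Set H)
    rw [Submodule.dense_iff_topologicalClosure_eq_top,
      Submodule.topologicalClosure_eq_top_iff, Submodule.eq_bot_iff]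
    intro z hz
    refine hinj ((ext_inner_left ℂ fun v => ?_ : R z = 0).trans (map_zero R).symm)
    rw [inner_zero_right, ← hz (R v) ⟨v, rfl⟩]
    exact (hsymm v z).symm
  have hformal : (ofResolvent R hinj).IsFormalAdjoint (ofResolvent R hinj) := by
    rintro ⟨_, y, rfl⟩ ⟨_, z, rfl⟩
    change inner ℂ (ofResolvent R hinj ⟨R y, mem_domain_ofResolvent hinj y⟩) (R z)
      = inner ℂ (R y) (ofResolvent R hinj ⟨R z, mem_domain_ofResolvent hinj z⟩)
    rw [ofResolvent_apply, ofResolvent_apply, inner_sub_left, inner_sub_right, hsymm y z]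
  -- This places every vector of the adjoint's domain in the range of R, so the adjoint has no
  -- larger domain.
  have hadj : ∀ y : (ofResolvent R hinj).adjoint.domain,
      R ((ofResolvent R hinj).adjoint y + y) = y := fun y => by
    refine ext_inner_right ℂ fun z => ?_
    have h : inner ℂ ((ofResolvent R hinj).adjoint y) (R z)
        = inner ℂ (y : H) (ofResolvent R hinj ⟨R z, mem_domain_ofResolvent hinj z⟩) :=
      LinearPMap.adjoint_isFormalAdjoint hd y ⟨R z, mem_domain_ofResolvent hinj z⟩
    rw [ofResolvent_apply, inner_sub_right] at h
    rw [hsymm, inner_add_left, h, sub_add_cancel]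
  change (ofResolvent R hinj).adjoint = ofResolvent R hinj
  have hle : (ofResolvent R hinj).adjoint ≤ ofResolvent R hinj := by
    refine ⟨fun y hy => ⟨_, hadj ⟨y, hy⟩⟩, ?_⟩
    rintro y ⟨_, z, rfl⟩ h
    have h1 : (ofResolvent R hinj).adjoint y + y = z := hinj ((hadj y).trans h)
    refine (eq_sub_of_add_eq h1).trans ?_
    rw [h]
    exact (ofResolvent_apply hinj z).symm
  exact le_antisymm hle (LinearPMap.IsFormalAdjoint.le_adjoint hd hformal)

theorem re_inner_ofResolvent_nonneg (h0 : 0 ≤ R) (h1 : R ≤ 1) (x : (ofResolvent R hinj).domain) :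
    0 ≤ (inner ℂ (ofResolvent R hinj x) (x : H)).re := by
  obtain ⟨_, y, rfl⟩ := x
  change 0 ≤ (inner ℂ (ofResolvent R hinj ⟨R y, mem_domain_ofResolvent hinj y⟩) (R y)).re
  rw [ofResolvent_apply]
  have h : 0 ≤ R * (1 - R) :=
    ((Commute.one_right R).sub_right (Commute.refl R)).mul_nonneg h0 (sub_nonneg.mpr h1)
  have h2 := ((ContinuousLinearMap.nonneg_iff_isPositive _).mp h).re_inner_nonneg_left y
  have h3 := ((ContinuousLinearMap.nonneg_iff_isPositive _).mp h0).inner_left_eq_inner_right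
    ((1 - R) y) y
  rw [mul_apply_eq_comp, h3] at h2
  exact h2

theorem affiliated_ofResolvent {M : VonNeumannAlgebra H} (hR : R ∈ M) :
    Affiliated M (ofResolvent R hinj) := by
  rintro u hu ⟨_, y, rfl⟩
  have hc : u (R y) = R (u y) :=
    congrArg (fun b : H →L[ℂ] H => b y) (commute_of_mem_commutant hR hu).eq
  refine ⟨⟨u y, hc.symm⟩, ?_⟩
  have h1 : ofResolvent R hinj ⟨R (u y), mem_domain_ofResolvent hinj (u y)⟩ = u y - R (u y) := ofResolvent_apply hinj _
  have h2 : ofResolvent R hinj ⟨R y, mem_domain_ofResolvent hinj y⟩ = y - R y := ofResolvent_apply hinj _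
  have h3 : (⟨u (R y), ⟨u y, hc.symm⟩⟩ : (ofResolvent R hinj).domain) = ⟨R (u y), ⟨u y, rfl⟩⟩ :=
    Subtype.ext hc
  refine (congrArg (ofResolvent R hinj) h3).trans (h1.trans ?_)
  refine Eq.trans ?_ (congrArg u h2).symm
  rw [map_sub, hc]

end OfResolvent

/-! ### Existence of the conditional expectation. -/

section CondExp

variable {M N : VonNeumannAlgebra H} {τ : TracialState N} {f : H →ₗ.[ℂ] H}

/-- With m = max(R, c)⁻¹ and e the spectral projection, R m e = e. So the truncation is (1 - R) m e,
and the density identity turns its trace into φ(R m e x) = φ(e x). -/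
theorem TracialState.re_truncOp_mul_eq {φ : (H →L[ℂ] H) → ℝ} {R : H →L[ℂ] H} (hR : R ∈ M)
    (h0 : 0 ≤ R) (hden : ∀ z ∈ M, φ (R * z) = τ.re ((1 - R) * z)) {x : H →L[ℂ] H} (hx : x ∈ M)
    {t : ℝ} (ht : 0 ≤ t) : τ.re (truncOp R t * x) = φ (specProj R t * x) := by
  have h1 := mul_specInv_mul_specProj h0 ht
  have h2 : truncOp R t * x = (1 - R) * (specInv R t * specProj R t * x) := by
    rw [truncOp, sub_mul, one_mul, sub_mul 1 R, one_mul, ← mul_assoc R, ← mul_assoc R, h1, sub_mul]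
  rw [h2, ← hden _ (mul_mem (mul_mem (specInv_mem hR t) (specProj_mem hR t)) hx), ← mul_assoc,
    ← mul_assoc, h1]

/-- The density of τ(f ·) is taken relative to `M`, so its resolvent lies in `M`. The truncated
traces are φ(e_k x), which tend to φ(x) by normality because e_k → 1 strongly. -/
theorem TracialState.MemL1Pos.exists_isCondExp (hf : τ.MemL1Pos N f) (hM : M ≤ N) :
    ∃ g, τ.IsCondExp M f g := by
  obtain ⟨S, hSN, hS⟩ := hf.exists_resolvent
  have hφ := hf.isNormalPositive_l1Functional τ hS hSN hM
  obtain ⟨R, hR, h0, h1, hinj, hden⟩ := hφ.exists_density τ hM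
  have hinj' : Function.Injective R.toLinearMap :=
    (injective_iff_map_eq_zero R.toLinearMap).mpr hinj
  have hg := isPosResolvent_ofResolvent hinj' h0 h1
  have htr : ∀ x ∈ M, 0 ≤ x → τ.traceMul (ofResolvent R hinj') x = τ.traceMul f x := by
    intro x hx hx0
    rw [hf.traceMul_eq_ofReal τ hS hSN (hM hx) hx0, hg.traceMul_eq]
    refine iSup_eq_of_tendsto (hg.monotone_ofReal_re τ (hM hR) (hM hx) hx0)
      (ENNReal.tendsto_ofReal ?_)
    refine (hφ.tendsto (a := fun k : ℕ => specProj R k * x)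
      (fun k => mul_mem (specProj_mem hR _) hx) hx (1 * ‖x‖)
      (fun k => (norm_mul_le _ _).trans ?_) fun y => ?_).congr fun k =>
        (τ.re_truncOp_mul_eq hR h0 hden hx (Nat.cast_nonneg k)).symm
    · gcongr
      exact IsStarProjection.norm_le _ isStarProjection_specProj
    · exact tendsto_specProj h0 hinj (x y)
  refine ⟨ofResolvent R hinj', ⟨isSelfAdjoint_ofResolvent hinj' (IsSelfAdjoint.of_nonneg h0),
    re_inner_ofResolvent_nonneg hinj' h0 h1, affiliated_ofResolvent hinj' hR, ?_⟩, htr⟩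
  rw [htr 1 (one_mem M) zero_le_one]
  exact hf.trace_lt_top

theorem TracialState.MemL1Pos.isCondExp_condExp (hf : τ.MemL1Pos N f) (hM : M ≤ N) :
    τ.IsCondExp M f (τ.condExp M f) := by
  have h := hf.exists_isCondExp hM
  rw [TracialState.condExp, dif_pos h]
  exact h.choose_spec

end CondExp

end NCMart

end

theorem mainTheorem7 {H : Type*} [NormedAddCommGroup H] [InnerProductSpace ℂ H] [CompleteSpace H]
    (N : VonNeumannAlgebra H) (τ : NCMart.TracialState N)
    (F : ℕ → VonNeumannAlgebra H) (hmono : Monotone F) (hle : ∀ n, F n ≤ N)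
    (f : H →ₗ.[ℂ] H) (hf : τ.MemL1Pos N f) (s : ℝ) (hs : 0 < s) :
    ∃ hq : 1 - τ.cuculescu F f s ∈ N.toStarSubalgebra,
      ENNReal.ofReal (τ.toLinearMap ⟨1 - τ.cuculescu F f s, hq⟩).re ≤
        2 / ENNReal.ofReal s * τ.traceMul f (NCMart.spectralGT f (s / 2)) := by
  obtain ⟨h1, h2⟩ := τ.cuculescu_main hmono hle hf (fun n => hf.isCondExp_condExp (hle n)) hs
  have hq : 1 - τ.cuculescu F f s ∈ N := sub_mem (one_mem N) h1
  refine ⟨hq, ?_⟩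
  rw [← τ.re_of_mem hq]
  exact h2
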